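/- Let $k$ be a totally real number field, $E/k$ a totally imaginary quadratic extension with ring of integers $R_E$, and fix an embedding $E\hookrightarrow\mathbb{C}$. Let $H\in M_3(R_E)$ be a Hermitian matrix of signature $(2,1)$ such that for every embedding $\nu:E\to\mathbb{C}$ whose restriction to $k$ differs from that of the fixed embedding, the matrix $H^\nu$ obtained by applying $\nu$ to the entries has signature $(3,0)$. Put $$\mathrm{SU}(H)=\{g\in \mathrm{SL}_3(\mathbb{C}) : gH\overline{g}^{\,t}=H\},\qquad \mathrm{SU}(H,R_E)=\mathrm{SU}(H)\cap \mathrm{SL}_3(R_E),$$ and let $\mathrm{SU}(H)$ act on the complex hyperbolic plane $\mathbb{H}^2_{\mathbb{C}}$, the space of negative lines of $H$ with its complex hyperbolic metric. An element of $\mathrm{SU}(H)$ is called regular elliptic if it fixes a point of $\mathbb{H}^2_{\mathbb{C}}$ and has three distinct eigenvalues. Let $p$ be a prime and let $\Gamma\le \mathrm{SU}(H,R_E)$ be a lattice, i.e. a subgroup of finite index in $\mathrm{SU}(H,R_E)$, that contains a regular elliptic element of order $p$. Then there is an infinite sequence of pairwise nonisomorphic (as groups) subgroups $\Lambda_i\le\Gamma$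 of finite index, each a congruence subgroup of $\Gamma$ (it contains all elements of $\Gamma$ congruent to the identity modulo some nonzero ideal of $R_E$), such that the quotient orbifold $\mathbb{H}^2_{\mathbb{C}}/\Lambda_i$ admits an isometric action of $\mathbb{Z}/p\mathbb{Z}$ that is not free and such that every nontrivial element of $\mathbb{Z}/p\mathbb{Z}$ has only isolated fixed points. Here an isometry of the orbifold $\mathbb{H}^2_{\mathbb{C}}/\Lambda_i$ is a bijection of the quotient that lifts to an isometry of $\mathbb{H}^2_{\mathbb{C}}$. -/

import Mathlib

open scoped Matrix LinearAlgebra.Projectivization NumberField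

namespace CHyp

open scoped ComplexOrder

noncomputable section

/-- The sesquilinear form `v M w^*` on row vectors `v, w ∈ ℂ³`. -/
def herm (M : Matrix (Fin 3) (Fin 3) ℂ) (v w : Fin 3 → ℂ) : ℂ :=
  (v ᵥ* M) ⬝ᵥ star w

/-- `M` is a Hermitian matrix of signature `(2,1)`: it can be brought to the standard form
`diag(1, 1, -1)` by a change of basis in `GL(3, ℂ)`. -/
def HasSignatureTwoOne (M : Matrix (Fin 3) (Fin 3) ℂ) : Prop :=
  ∃ S : GL (Fin 3) ℂ,
    (S : Matrix (Fin 3) (Fin 3) ℂ) * M * (S : Matrix (Fin 3) (Fin 3) ℂ)ᴴ =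
      Matrix.diagonal ![1, 1, -1]

/-- `M` is a Hermitian matrix of signature `(3,0)`, that is, positive definite. -/
def HasSignatureThreeZero (M : Matrix (Fin 3) (Fin 3) ℂ) : Prop :=
  M.PosDef

/-- `SU(M) = {g ∈ SL(3, ℂ) : g M g^* = M}`. -/
def SU (M : Matrix (Fin 3) (Fin 3) ℂ) : Subgroup (Matrix.SpecialLinearGroup (Fin 3) ℂ) where
  carrier := {g | (g : Matrix (Fin 3) (Fin 3) ℂ) * M * (g : Matrix (Fin 3) (Fin 3) ℂ)ᴴ = M}
  one_mem' := by simp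
  mul_mem' := by
    intro a b ha hb
    simp only [Set.mem_ofPred_eq] at ha hb ⊢
    calc ((a * b : Matrix.SpecialLinearGroup (Fin 3) ℂ) : Matrix (Fin 3) (Fin 3) ℂ) * M *
          ((a * b : Matrix.SpecialLinearGroup (Fin 3) ℂ) : Matrix (Fin 3) (Fin 3) ℂ)ᴴ
        = (a : Matrix (Fin 3) (Fin 3) ℂ) * ((b : Matrix (Fin 3) (Fin 3) ℂ) * M *
          (b : Matrix (Fin 3) (Fin 3) ℂ)ᴴ) * (a : Matrix (Fin 3) (Fin 3) ℂ)ᴴ := by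
          simp only [Matrix.SpecialLinearGroup.coe_mul, Matrix.conjTranspose_mul, Matrix.mul_assoc]
      _ = M := by rw [hb, ha]
  inv_mem' := by
    intro a ha
    simp only [Set.mem_ofPred_eq] at ha ⊢
    have h1 : ((a⁻¹ : Matrix.SpecialLinearGroup (Fin 3) ℂ) : Matrix (Fin 3) (Fin 3) ℂ) *
        (a : Matrix (Fin 3) (Fin 3) ℂ) = 1 := by
      rw [← Matrix.SpecialLinearGroup.coe_mul, inv_mul_cancel, Matrix.SpecialLinearGroup.coe_one]
    have h2 : (a : Matrix (Fin 3) (Fin 3) ℂ)ᴴ *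
        ((a⁻¹ : Matrix.SpecialLinearGroup (Fin 3) ℂ) : Matrix (Fin 3) (Fin 3) ℂ)ᴴ = 1 := by
      rw [← Matrix.conjTranspose_mul, h1, Matrix.conjTranspose_one]
    conv_lhs => rw [← ha]
    calc _ = (((a⁻¹ : Matrix.SpecialLinearGroup (Fin 3) ℂ) : Matrix (Fin 3) (Fin 3) ℂ) *
          (a : Matrix (Fin 3) (Fin 3) ℂ)) * M * ((a : Matrix (Fin 3) (Fin 3) ℂ)ᴴ *
        ((a⁻¹ : Matrix.SpecialLinearGroup (Fin 3) ℂ) : Matrix (Fin 3) (Fin 3) ℂ)ᴴ) := by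
          simp only [Matrix.mul_assoc]
      _ = M := by rw [h1, h2, Matrix.one_mul, Matrix.mul_one]

lemma herm_smul (M : Matrix (Fin 3) (Fin 3) ℂ) (a b : ℂ) (v w : Fin 3 → ℂ) :
    herm M (a • v) (b • w) = a * star b * herm M v w := by
  simp only [herm, Matrix.smul_vecMul, star_smul, smul_dotProduct, dotProduct_smul, smul_eq_mul]
  ring

lemma herm_smul_self (M : Matrix (Fin 3) (Fin 3) ℂ) (a : ℂ) (v : Fin 3 → ℂ) :
    (herm M (a • v) (a • v)).re = Complex.normSq a * (herm M v v).re := by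
  rw [herm_smul]
  have : a * star a = (Complex.normSq a : ℂ) := Complex.mul_conj a
  rw [this, Complex.re_ofReal_mul]

lemma herm_vecMul {M : Matrix (Fin 3) (Fin 3) ℂ} (g : SU M) (v w : Fin 3 → ℂ) :
    herm M (v ᵥ* (g : Matrix.SpecialLinearGroup (Fin 3) ℂ))
      (w ᵥ* (g : Matrix.SpecialLinearGroup (Fin 3) ℂ)) = herm M v w := by
  have hg : ((g : Matrix.SpecialLinearGroup (Fin 3) ℂ) : Matrix (Fin 3) (Fin 3) ℂ) * (M *
      ((g : Matrix.SpecialLinearGroup (Fin 3) ℂ) : Matrix (Fin 3) (Fin 3) ℂ)ᴴ) = M := by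
    rw [← Matrix.mul_assoc]
    exact g.2
  unfold herm
  rw [Matrix.star_vecMul, Matrix.dotProduct_mulVec, Matrix.vecMul_vecMul, Matrix.vecMul_vecMul,
    hg]

lemma coe_inv_mul (g : Matrix.SpecialLinearGroup (Fin 3) ℂ) :
    ((g⁻¹ : Matrix.SpecialLinearGroup (Fin 3) ℂ) : Matrix (Fin 3) (Fin 3) ℂ) * (g : Matrix (Fin 3) (Fin 3) ℂ) = 1 := by
  rw [← Matrix.SpecialLinearGroup.coe_mul, inv_mul_cancel, Matrix.SpecialLinearGroup.coe_one]

lemma vecMul_inv_injective (g : Matrix.SpecialLinearGroup (Fin 3) ℂ) :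
    Function.Injective
      (Matrix.vecMulLinear ((g⁻¹ : Matrix.SpecialLinearGroup (Fin 3) ℂ) : Matrix (Fin 3) (Fin 3) ℂ)) := by
  intro v w h
  have := congrArg (· ᵥ* (g : Matrix (Fin 3) (Fin 3) ℂ)) h
  simpa only [Matrix.vecMulLinear_apply, Matrix.vecMul_vecMul, coe_inv_mul, Matrix.vecMul_one]
    using this

/-- The projective action of a matrix of determinant one on lines of row vectors:
`g • [v] = [v g⁻¹]`. -/
def lineMap (g : Matrix.SpecialLinearGroup (Fin 3) ℂ) :
    ℙ ℂ (Fin 3 → ℂ) → ℙ ℂ (Fin 3 → ℂ) :=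
  Projectivization.map
    (Matrix.vecMulLinear ((g⁻¹ : Matrix.SpecialLinearGroup (Fin 3) ℂ) : Matrix (Fin 3) (Fin 3) ℂ))
    (vecMul_inv_injective g)

lemma vecMul_inv_ne_zero (g : Matrix.SpecialLinearGroup (Fin 3) ℂ) {v : Fin 3 → ℂ} (hv : v ≠ 0) :
    v ᵥ* ((g⁻¹ : Matrix.SpecialLinearGroup (Fin 3) ℂ) : Matrix (Fin 3) (Fin 3) ℂ) ≠ 0 := by
  intro h
  exact hv (vecMul_inv_injective g (by simpa using h))

lemma lineMap_mk (g : Matrix.SpecialLinearGroup (Fin 3) ℂ) (v : Fin 3 → ℂ) (hv : v ≠ 0) :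
    lineMap g (Projectivization.mk ℂ v hv) =
      Projectivization.mk ℂ (v ᵥ* ((g⁻¹ : Matrix.SpecialLinearGroup (Fin 3) ℂ) : Matrix (Fin 3) (Fin 3) ℂ))
        (vecMul_inv_ne_zero g hv) := rfl

/-- A complex line is negative for `M` if the Hermitian form is negative on it. -/
def IsNegative (M : Matrix (Fin 3) (Fin 3) ℂ) (ℓ : ℙ ℂ (Fin 3 → ℂ)) : Prop :=
  (herm M ℓ.rep ℓ.rep).re < 0

lemma isNegative_mk (M : Matrix (Fin 3) (Fin 3) ℂ) (v : Fin 3 → ℂ) (hv : v ≠ 0) :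
    IsNegative M (Projectivization.mk ℂ v hv) ↔ (herm M v v).re < 0 := by
  obtain ⟨a, ha⟩ := Projectivization.exists_smul_eq_mk_rep ℂ v hv
  have ha' : ((a : ℂ) • v) = (Projectivization.mk ℂ v hv).rep := ha
  unfold IsNegative
  rw [← ha', herm_smul_self]
  have : 0 < Complex.normSq (a : ℂ) := Complex.normSq_pos.mpr a.ne_zero
  constructor
  · intro h
    by_contra h'
    push Not at h'
    nlinarith [mul_nonneg this.le h']
  · intro h
    exact mul_neg_of_pos_of_neg this h

/-- The complex hyperbolic plane of a form `M` of signature `(2,1)`: the space of negative lines. -/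
@[ext]
structure H2 (M : Matrix (Fin 3) (Fin 3) ℂ) where
  line : ℙ ℂ (Fin 3 → ℂ)
  isNegative : IsNegative M line

/-- `SU(M)` acts on the complex hyperbolic plane by `g • [v] = [v g⁻¹]`. -/
instance (M : Matrix (Fin 3) (Fin 3) ℂ) : MulAction (SU M) (H2 M) where
  smul g x := ⟨lineMap g x.line, by
    obtain ⟨ℓ, hℓ⟩ := x
    induction ℓ using Projectivization.ind with
    | h v hv =>
      rw [isNegative_mk] at hℓ
      rw [lineMap_mk, isNegative_mk]
      have := herm_vecMul g⁻¹ v v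
      rw [Subgroup.coe_inv] at this
      rw [this]
      exact hℓ⟩
  one_smul x := by
    obtain ⟨ℓ, hℓ⟩ := x
    apply H2.ext
    change lineMap _ ℓ = ℓ
    induction ℓ using Projectivization.ind with
    | h v hv =>
      rw [lineMap_mk]
      congr 1
      simp
  mul_smul g h x := by
    obtain ⟨ℓ, hℓ⟩ := x
    apply H2.ext
    change lineMap _ ℓ = lineMap _ (lineMap _ ℓ)
    induction ℓ using Projectivization.ind with
    | h v hv =>
      rw [lineMap_mk, lineMap_mk, lineMap_mk]
      congr 1
      rw [Matrix.vecMul_vecMul, Subgroup.coe_mul, mul_inv_rev]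
      rfl

/-- The complex hyperbolic distance, normalized so that the holomorphic sectional curvature
is `-1`:  `cosh (d([v],[w]) / 2) = |⟨v,w⟩| / √(⟨v,v⟩⟨w,w⟩)`. -/
def hdist {M : Matrix (Fin 3) (Fin 3) ℂ} (x y : H2 M) : ℝ :=
  2 * Real.arcosh (‖herm M x.line.rep y.line.rep‖ /
    √((herm M x.line.rep x.line.rep).re * (herm M y.line.rep y.line.rep).re))

/-- The distance may be computed with arbitrary representatives. -/
lemma hdist_mk {M : Matrix (Fin 3) (Fin 3) ℂ} (v w : Fin 3 → ℂ) (hv : v ≠ 0) (hw : w ≠ 0)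
    (hv' : IsNegative M (Projectivization.mk ℂ v hv))
    (hw' : IsNegative M (Projectivization.mk ℂ w hw)) :
    hdist (⟨Projectivization.mk ℂ v hv, hv'⟩ : H2 M) ⟨Projectivization.mk ℂ w hw, hw'⟩ =
      2 * Real.arcosh (‖herm M v w‖ / √((herm M v v).re * (herm M w w).re)) := by
  obtain ⟨a, ha⟩ := Projectivization.exists_smul_eq_mk_rep ℂ v hv
  obtain ⟨b, hb⟩ := Projectivization.exists_smul_eq_mk_rep ℂ w hw
  have ha' : ((a : ℂ) • v) = (Projectivization.mk ℂ v hv).rep := ha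
  have hb' : ((b : ℂ) • w) = (Projectivization.mk ℂ w hw).rep := hb
  unfold hdist
  simp only
  rw [← ha', ← hb', herm_smul_self, herm_smul_self, herm_smul]
  have e : Complex.normSq (a : ℂ) * (herm M v v).re * (Complex.normSq (b : ℂ) * (herm M w w).re)
      = (‖(a : ℂ)‖ * ‖(b : ℂ)‖) ^ 2 * ((herm M v v).re * (herm M w w).re) := by
    rw [Complex.normSq_eq_norm_sq, Complex.normSq_eq_norm_sq]
    ring
  have hpos : 0 < ‖(a : ℂ)‖ * ‖(b : ℂ)‖ :=
    mul_pos (norm_pos_iff.mpr a.ne_zero) (norm_pos_iff.mpr b.ne_zero)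
  rw [e, Real.sqrt_mul (sq_nonneg _), Real.sqrt_sq hpos.le, norm_mul, norm_mul, norm_star,
    mul_div_mul_left _ _ hpos.ne']

/-- `SU(M)` acts on the complex hyperbolic plane by isometries. -/
lemma hdist_smul {M : Matrix (Fin 3) (Fin 3) ℂ} (g : SU M) (x y : H2 M) :
    hdist (g • x) (g • y) = hdist x y := by
  obtain ⟨ℓ, hℓ⟩ := x
  obtain ⟨m, hm⟩ := y
  induction ℓ using Projectivization.ind with
  | h v hv =>
    induction m using Projectivization.ind with
    | h w hw =>
      have e := herm_vecMul g⁻¹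
      rw [Subgroup.coe_inv] at e
      rw [hdist_mk]
      refine (hdist_mk _ _ (vecMul_inv_ne_zero g.1 hv) (vecMul_inv_ne_zero g.1 hw)
        (g • (⟨_, hℓ⟩ : H2 M)).isNegative (g • (⟨_, hm⟩ : H2 M)).isNegative).trans ?_
      rw [e, e, e]

/-- An element of `SU(M)` is elliptic if it fixes a point of the complex hyperbolic plane. -/
def IsElliptic {M : Matrix (Fin 3) (Fin 3) ℂ} (g : SU M) : Prop :=
  ∃ x : H2 M, g • x = x

/-- An elliptic element is regular elliptic if it has three distinct eigenvalues. -/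
def IsRegularElliptic {M : Matrix (Fin 3) (Fin 3) ℂ} (g : SU M) : Prop :=
  IsElliptic g ∧
    {c : ℂ | Module.End.HasEigenvalue
      (Matrix.toLin' ((g : Matrix.SpecialLinearGroup (Fin 3) ℂ) : Matrix (Fin 3) (Fin 3) ℂ)) c}.ncard = 3

section Arithmetic

variable {E : Type*} [Field E]

/-- The complex matrix obtained from a matrix over `R_E` by applying an embedding `ν : E → ℂ`
to the entries. -/
def conjugate (ν : E →+* ℂ) (H : Matrix (Fin 3) (Fin 3) (𝓞 E)) : Matrix (Fin 3) (Fin 3) ℂ :=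
  H.map (ν.comp (algebraMap (𝓞 E) E))

/-- `SU(H, R_E)`: the elements of `SL(3, R_E)` that lie in `SU(H)`, where `E` is regarded as a
subfield of `ℂ` through `φ`. -/
def SUInt (φ : E →+* ℂ) (H : Matrix (Fin 3) (Fin 3) (𝓞 E)) :
    Subgroup (Matrix.SpecialLinearGroup (Fin 3) (𝓞 E)) :=
  (SU (conjugate φ H)).comap (Matrix.SpecialLinearGroup.map (φ.comp (algebraMap (𝓞 E) E)))

/-- The inclusion `SU(H, R_E) → SU(H)`. -/
def SUInt.toSU (φ : E →+* ℂ) (H : Matrix (Fin 3) (Fin 3) (𝓞 E)) :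
    SUInt φ H →* SU (conjugate φ H) :=
  ((Matrix.SpecialLinearGroup.map (φ.comp (algebraMap (𝓞 E) E))).comp
    (SUInt φ H).subtype).codRestrict (SU (conjugate φ H)) (fun g => g.2)

/-- `SU(H, R_E)` acts on the complex hyperbolic plane of `H` through its inclusion in `SU(H)`. -/
instance (φ : E →+* ℂ) (H : Matrix (Fin 3) (Fin 3) (𝓞 E)) :
    MulAction (SUInt φ H) (H2 (conjugate φ H)) :=
  MulAction.compHom _ (SUInt.toSU φ H)

variable {φ : E →+* ℂ} {H : Matrix (Fin 3) (Fin 3) (𝓞 E)}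

/-- The quotient of the complex hyperbolic plane by a subgroup `Λ` of `SU(H, R_E)`. -/
abbrev Quot2 (Λ : Subgroup (SUInt φ H)) : Type :=
  MulAction.orbitRel.Quotient Λ (H2 (conjugate φ H))

/-- The projection of the complex hyperbolic plane to its quotient. -/
def proj (Λ : Subgroup (SUInt φ H)) (x : H2 (conjugate φ H)) : Quot2 Λ :=
  Quotient.mk _ x

/-- The quotient distance: the infimum of the distances between representatives. -/
def qdist {Λ : Subgroup (SUInt φ H)} (a b : Quot2 Λ) : ℝ :=
  sInf {r : ℝ | ∃ x y : H2 (conjugate φ H), proj Λ x = a ∧ proj Λ y = b ∧ hdist x y = r}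

/-- A self-map of the quotient orbifold is an isometry if it is a bijection that lifts to an
isometry of the complex hyperbolic plane. -/
def IsOrbifoldIsometry {Λ : Subgroup (SUInt φ H)} (f : Equiv.Perm (Quot2 Λ)) : Prop :=
  ∃ F : Equiv.Perm (H2 (conjugate φ H)),
    (∀ x y, hdist (F x) (F y) = hdist x y) ∧ ∀ x, f (proj Λ x) = proj Λ (F x)

/-- A permutation of the quotient has only isolated fixed points: around each fixed point there is
a metric ball that contains no other fixed point. -/
def HasIsolatedFixedPoints {Λ : Subgroup (SUInt φ H)} (f : Equiv.Perm (Quot2 Λ)) : Prop :=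
  ∀ a, f a = a → ∃ ε > 0, ∀ b, f b = b → qdist a b < ε → b = a

/-- The quotient by `Λ` admits an isometric action of `ℤ/pℤ` that is not free and such that the
nontrivial elements have only isolated fixed points. -/
def AdmitsAction (p : ℕ) (Λ : Subgroup (SUInt φ H)) : Prop :=
  ∃ ρ : Multiplicative (ZMod p) →* Equiv.Perm (Quot2 Λ),
    (∀ g, IsOrbifoldIsometry (ρ g)) ∧
    (∃ g, g ≠ 1 ∧ ∃ a, ρ g a = a) ∧
    ∀ g, g ≠ 1 → HasIsolatedFixedPoints (ρ g)

/-- `Λ` is a congruence subgroup of `Γ`: it lies in `Γ` and contains all elements of `Γ` that are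
congruent to the identity modulo some nonzero ideal of `R_E`. -/
def IsCongruenceSubgroupOf (Λ Γ : Subgroup (SUInt φ H)) : Prop :=
  Λ ≤ Γ ∧ ∃ I : Ideal (𝓞 E), I ≠ ⊥ ∧ ∀ g ∈ Γ,
    Matrix.SpecialLinearGroup.map (Ideal.Quotient.mk I)
      (g : Matrix.SpecialLinearGroup (Fin 3) (𝓞 E)) = 1 → g ∈ Λ

/-- An isometry of the quotient orbifold preserves the quotient distance. -/
lemma IsOrbifoldIsometry.qdist_eq {Λ : Subgroup (SUInt φ H)} {f : Equiv.Perm (Quot2 Λ)}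
    (hf : IsOrbifoldIsometry f) (a b : Quot2 Λ) : qdist (f a) (f b) = qdist a b := by
  obtain ⟨F, hF, hFf⟩ := hf
  unfold qdist
  congr 1
  ext r
  constructor
  · rintro ⟨x, y, hx, hy, rfl⟩
    refine ⟨F.symm x, F.symm y, f.injective ?_, f.injective ?_, ?_⟩
    · rw [hFf, F.apply_symm_apply, hx]
    · rw [hFf, F.apply_symm_apply, hy]
    · rw [← hF, F.apply_symm_apply, F.apply_symm_apply]
  · rintro ⟨x, y, rfl, rfl, rfl⟩
    exact ⟨F x, F y, (hFf x).symm, (hFf y).symm, hF x y⟩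

end Arithmetic

end

end CHyp

/-! The groups `Λ` are the principal congruence subgroups `Λ a` of level `3 ^ a` in `Γ`, for large
`a`. Since `τ` normalizes `Λ a`, it acts on the quotient, and its order is `p`. The discriminant of
the characteristic polynomial of `τ` is a nonzero algebraic integer, so that it is not divisible by
`3 ^ a` for large `a`; hence all elements of the coset `Λ a τ` have three distinct eigenvalues
(`exists_roots_nodup`). A fixed point of `τ` in the quotient lifts to a fixed point of an element of
this coset. Such an element has only one fixed point in the complex hyperbolic plane, and as `Λ a`
acts properly discontinuously the fixed points in the quotient are isolated
(`admitsAction_of_normalizes`). The other nontrivial elements of the group of order `p` have the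
same fixed points as `τ`.

It remains to find infinitely many isomorphism classes among the `Λ a`. It is shown that a fixed
`Λ b` is isomorphic to `Λ j` for finitely many `j` only (`eventually_isEmpty`). Neither rigidity nor
volumes are used; there are two cases.

If the form is anisotropic, then `SU(H, R_E)` acts cocompactly (`exists_boundedCone_cover`). This is
deduced from Minkowski's theorem and from the finiteness of the number of integral matrices with
bounded conjugates: the lattice `R_E³` has, for the norm attached to any point of the complex
hyperbolic plane, a basis over the field consisting of short vectors, and there are finitely many
such bases up to the group. So `Λ b` is finitely generated. If `A = Λ b` is isomorphic to its
subgroup `B = Λ j`, the abelianizations have the same rank, and the kernel of `B^ab → A^ab` is a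
finite group whose order is bounded in terms of `A` alone (`exists_pow_mem_commutator`). It contains
the commutators `[g, x]` with `g ∈ A` and `x ∈ B`. Since `[B, B]` is trivial modulo `3 ^ (2 j)`, the
powers `h ^ (3 ^ (j - b))` with `h ∈ A` commute with `A` modulo nearly `3 ^ (2 j)`, but in fact only
modulo a number of the order of magnitude of `3 ^ j`, unless `A` is abelian. A cocompact group is
not abelian.

If the form is isotropic, the group `Λ b` contains a Heisenberg group (`exists_heisenberg`), and thus
a central commutator `z = [x, y]` of infinite order. In every `Λ j` such a commutator is congruent to
one modulo `3 ^ (2 j)`, its sixth power is unipotent, and so it has, up to a bounded power, a root of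
order `3 ^ j` in `Λ j` (`exists_root_of_central_commutator`). In the fixed group `Λ b` this is not
possible for large `j`, because the powers `u ^ (3 ^ j)` tend to one `3`-adically. -/

/-! ### Hermitian forms of signature (2,1) -/

namespace CHyp

open scoped ComplexOrder

section Form

variable {M : Matrix (Fin 3) (Fin 3) ℂ}

lemma herm_add_left (M : Matrix (Fin 3) (Fin 3) ℂ) (u v w : Fin 3 → ℂ) :
    herm M (u + v) w = herm M u w + herm M v w := by
  simp [herm, Matrix.add_vecMul, add_dotProduct]

lemma herm_add_right (M : Matrix (Fin 3) (Fin 3) ℂ) (u v w : Fin 3 → ℂ) :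
    herm M u (v + w) = herm M u v + herm M u w := by
  simp [herm, dotProduct_add]

lemma herm_smul_left (M : Matrix (Fin 3) (Fin 3) ℂ) (a : ℂ) (v w : Fin 3 → ℂ) :
    herm M (a • v) w = a * herm M v w := by
  simpa using herm_smul M a 1 v w

lemma herm_smul_right (M : Matrix (Fin 3) (Fin 3) ℂ) (a : ℂ) (v w : Fin 3 → ℂ) :
    herm M v (a • w) = star a * herm M v w := by
  simpa using herm_smul M 1 a v w

lemma herm_vecMul_vecMul (M A B : Matrix (Fin 3) (Fin 3) ℂ) (v w : Fin 3 → ℂ) :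
    herm M (v ᵥ* A) (w ᵥ* B) = herm (A * M * Bᴴ) v w := by
  unfold herm
  rw [Matrix.star_vecMul, Matrix.dotProduct_mulVec, Matrix.vecMul_vecMul, Matrix.vecMul_vecMul,
    Matrix.mul_assoc]

lemma star_herm (hM : M.IsHermitian) (v w : Fin 3 → ℂ) : star (herm M v w) = herm M w v := by
  unfold herm
  rw [← Matrix.star_dotProduct_star, star_star, Matrix.star_vecMul, hM.eq,
    Matrix.dotProduct_mulVec]

lemma norm_herm_comm (hM : M.IsHermitian) (v w : Fin 3 → ℂ) :
    ‖herm M v w‖ = ‖herm M w v‖ := by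
  rw [← star_herm hM, norm_star]

lemma herm_self_im (hM : M.IsHermitian) (v : Fin 3 → ℂ) : (herm M v v).im = 0 := by
  have := congrArg Complex.im (star_herm hM v v)
  simp at this
  linarith

lemma herm_self_eq (hM : M.IsHermitian) (v : Fin 3 → ℂ) :
    herm M v v = ((herm M v v).re : ℂ) := by
  apply Complex.ext <;> simp [herm_self_im hM]

lemma norm_herm_self (hM : M.IsHermitian) (v : Fin 3 → ℂ) :
    ‖herm M v v‖ = |(herm M v v).re| := by
  rw [herm_self_eq hM, Complex.norm_real, Complex.ofReal_re, Real.norm_eq_abs]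

lemma exists_norm_herm_le (M : Matrix (Fin 3) (Fin 3) ℂ) :
    ∃ K : ℝ, 0 < K ∧ ∀ v w : Fin 3 → ℂ, ‖herm M v w‖ ≤ K * ‖v‖ * ‖w‖ := by
  refine ⟨∑ j, ∑ i, ‖M i j‖ + 1, by positivity, fun v w => ?_⟩
  have h1 : herm M v w = ∑ j, (∑ i, v i * M i j) * star (w j) := by
    simp [herm, dotProduct, Matrix.vecMul]
  rw [h1]
  calc ‖∑ j, (∑ i, v i * M i j) * star (w j)‖
      ≤ ∑ j, (∑ i, ‖v‖ * ‖M i j‖) * ‖w‖ := by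
        refine (norm_sum_le _ _).trans (Finset.sum_le_sum fun j _ => ?_)
        rw [norm_mul, norm_star]
        refine mul_le_mul ((norm_sum_le _ _).trans (Finset.sum_le_sum fun i _ => ?_))
          (norm_le_pi_norm w j) (norm_nonneg _) (by positivity)
        rw [norm_mul]
        exact mul_le_mul_of_nonneg_right (norm_le_pi_norm v i) (norm_nonneg _)
    _ = (∑ j, ∑ i, ‖M i j‖) * ‖v‖ * ‖w‖ := by
        simp_rw [← Finset.mul_sum, ← Finset.sum_mul, ← Finset.mul_sum]
        ring
    _ ≤ _ := by gcongr; linarith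

lemma HasSignatureTwoOne.isHermitian (hM : HasSignatureTwoOne M) : M.IsHermitian := by
  obtain ⟨S, hS⟩ := hM
  have h2 : ((S⁻¹ : GL (Fin 3) ℂ) : Matrix (Fin 3) (Fin 3) ℂ) * (S : Matrix (Fin 3) (Fin 3) ℂ) = 1 :=
    S.inv_mul
  have h3 : (S : Matrix (Fin 3) (Fin 3) ℂ)ᴴ * ((S⁻¹ : GL (Fin 3) ℂ) : Matrix (Fin 3) (Fin 3) ℂ)ᴴ = 1 := by
    rw [← Matrix.conjTranspose_mul, h2, Matrix.conjTranspose_one]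
  have h4 : M = ((S⁻¹ : GL (Fin 3) ℂ) : Matrix (Fin 3) (Fin 3) ℂ) * Matrix.diagonal ![1, 1, -1] *
      ((S⁻¹ : GL (Fin 3) ℂ) : Matrix (Fin 3) (Fin 3) ℂ)ᴴ := by
    rw [← hS]
    calc M = 1 * M * 1 := by simp
      _ = (((S⁻¹ : GL (Fin 3) ℂ) : Matrix (Fin 3) (Fin 3) ℂ) * (S : Matrix (Fin 3) (Fin 3) ℂ)) * M *
          ((S : Matrix (Fin 3) (Fin 3) ℂ)ᴴ *
            ((S⁻¹ : GL (Fin 3) ℂ) : Matrix (Fin 3) (Fin 3) ℂ)ᴴ) := by rw [h2, h3]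
      _ = _ := by simp only [Matrix.mul_assoc]
  have h5 : (Matrix.diagonal ![1, 1, -1] : Matrix (Fin 3) (Fin 3) ℂ).IsHermitian := by
    apply Matrix.isHermitian_diagonal_of_self_adjoint
    ext i
    fin_cases i <;> simp
  rw [h4]
  exact Matrix.isHermitian_mul_mul_conjTranspose _ h5

lemma HasSignatureTwoOne.det_ne_zero (hM : HasSignatureTwoOne M) : M.det ≠ 0 := by
  obtain ⟨S, hS⟩ := hM
  intro h
  have := congrArg Matrix.det hS
  simp [Matrix.det_mul, h, Matrix.det_diagonal, Fin.prod_univ_three] at this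

/-- Coordinates in which the form is `|u₀|² + |u₁|² - |u₂|²`. -/
lemma HasSignatureTwoOne.exists_coordinates (hM : HasSignatureTwoOne M) :
    ∃ S T : Matrix (Fin 3) (Fin 3) ℂ, S * T = 1 ∧ T * S = 1 ∧ ∀ u u' : Fin 3 → ℂ,
      herm M (u ᵥ* S) (u' ᵥ* S) = u 0 * star (u' 0) + u 1 * star (u' 1) - u 2 * star (u' 2) := by
  obtain ⟨S, hS⟩ := hM
  refine ⟨S, (S⁻¹ : GL (Fin 3) ℂ), S.mul_inv, S.inv_mul, fun u u' => ?_⟩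
  rw [herm_vecMul_vecMul, hS]
  simp [herm, Matrix.vecMul_diagonal, dotProduct, Fin.sum_univ_three]
  ring

/-- Vectors orthogonal to a negative vector are positive. -/
lemma HasSignatureTwoOne.pos_of_orthogonal (hM : HasSignatureTwoOne M) {x v : Fin 3 → ℂ}
    (hx : (herm M x x).re < 0) (hvx : herm M v x = 0) (hv : v ≠ 0) : 0 < (herm M v v).re := by
  obtain ⟨S, T, hST, hTS, hh⟩ := hM.exists_coordinates
  obtain ⟨u, rfl⟩ : ∃ u, v = u ᵥ* S := ⟨v ᵥ* T, by rw [Matrix.vecMul_vecMul, hTS, Matrix.vecMul_one]⟩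
  obtain ⟨y, rfl⟩ : ∃ u, x = u ᵥ* S := ⟨x ᵥ* T, by rw [Matrix.vecMul_vecMul, hTS, Matrix.vecMul_one]⟩
  rw [hh] at hx hvx ⊢
  have hself : ∀ z : Fin 3 → ℂ, (z 0 * star (z 0) + z 1 * star (z 1) - z 2 * star (z 2)).re =
      ‖z 0‖ ^ 2 + ‖z 1‖ ^ 2 - ‖z 2‖ ^ 2 := by
    intro z
    have : ∀ a : ℂ, (a * star a).re = ‖a‖ ^ 2 := by
      intro a
      rw [Complex.star_def, Complex.mul_conj, Complex.normSq_eq_norm_sq, Complex.ofReal_re]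
    rw [Complex.sub_re, Complex.add_re, this, this, this]
  rw [hself] at hx ⊢
  have h2 : u 2 * star (y 2) = u 0 * star (y 0) + u 1 * star (y 1) := by linear_combination -hvx
  have h3 : ‖u 2‖ * ‖y 2‖ ≤ ‖u 0‖ * ‖y 0‖ + ‖u 1‖ * ‖y 1‖ := by
    have := norm_add_le (u 0 * star (y 0)) (u 1 * star (y 1))
    rw [← h2] at this
    simpa [norm_mul, norm_star] using this
  have h4 : (‖u 2‖ * ‖y 2‖) ^ 2 ≤ (‖u 0‖ ^ 2 + ‖u 1‖ ^ 2) * (‖y 0‖ ^ 2 + ‖y 1‖ ^ 2) := by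
    refine (pow_le_pow_left₀ (by positivity) h3 2).trans ?_
    nlinarith [sq_nonneg (‖u 0‖ * ‖y 1‖ - ‖u 1‖ * ‖y 0‖)]
  by_contra hcon
  have h5 : ‖u 0‖ ^ 2 + ‖u 1‖ ^ 2 ≤ ‖u 2‖ ^ 2 := by linarith
  have h6 : ‖u 2‖ ^ 2 * ‖y 2‖ ^ 2 ≤ ‖u 2‖ ^ 2 * (‖y 0‖ ^ 2 + ‖y 1‖ ^ 2) := by
    calc _ = (‖u 2‖ * ‖y 2‖) ^ 2 := by ring
      _ ≤ _ := h4
      _ ≤ _ := by gcongr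
  have h7 : ‖u 2‖ ^ 2 = 0 := by
    by_contra h
    have h8 : 0 < ‖u 2‖ ^ 2 := lt_of_le_of_ne (sq_nonneg _) (Ne.symm h)
    nlinarith [le_of_mul_le_mul_left h6 h8]
  have h8 : ‖u 0‖ ^ 2 = 0 := by nlinarith [sq_nonneg ‖u 0‖, sq_nonneg ‖u 1‖]
  have h9 : ‖u 1‖ ^ 2 = 0 := by nlinarith [sq_nonneg ‖u 0‖, sq_nonneg ‖u 1‖]
  apply hv
  have : u = 0 := by
    ext i
    fin_cases i
    · simpa using h8
    · simpa using h9
    · simpa using h7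
  rw [this, Matrix.zero_vecMul]

/-- The reversed Cauchy-Schwarz inequality, with its equality case. -/
lemma HasSignatureTwoOne.reverse_cauchySchwarz (hM : HasSignatureTwoOne M) {x v : Fin 3 → ℂ}
    (hx : (herm M x x).re < 0) (hv : ∀ a : ℂ, v ≠ a • x) :
    (herm M v v).re * (herm M x x).re < ‖herm M v x‖ ^ 2 := by
  have hH := hM.isHermitian
  have hx0 : herm M x x ≠ 0 := fun h => by rw [h] at hx; simp at hx
  set a : ℂ := herm M v x / herm M x x with ha
  have h1 : v - a • x ≠ 0 := fun h => hv a (sub_eq_zero.mp h)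
  have hax : a * herm M x x = herm M v x := by rw [ha]; field_simp
  have h2 : herm M (v - a • x) x = 0 := by
    rw [sub_eq_add_neg, ← neg_smul, herm_add_left, herm_smul_left]
    linear_combination -hax
  have h3 := hM.pos_of_orthogonal hx h2 h1
  have h4 : herm M (v - a • x) (v - a • x) = herm M v v - a * herm M x v := by
    conv_lhs => rw [show v - a • x = v + (-a) • x by rw [neg_smul, sub_eq_add_neg]]
    rw [herm_add_right, herm_smul_right, show v + (-a) • x = v - a • x by rw [neg_smul, sub_eq_add_neg],
      h2, sub_eq_add_neg, ← neg_smul, herm_add_left, herm_smul_left]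
    ring
  have h5 : herm M x x * (herm M v v - a * herm M x v) =
      (((herm M v v).re * (herm M x x).re - ‖herm M v x‖ ^ 2 : ℝ) : ℂ) := by
    have : herm M v x * herm M x v = ((‖herm M v x‖ ^ 2 : ℝ) : ℂ) := by
      rw [← star_herm hH v x, Complex.star_def, Complex.mul_conj, Complex.normSq_eq_norm_sq]
    push_cast at this ⊢
    rw [← herm_self_eq hH, ← herm_self_eq hH, ← this]
    linear_combination -hax * herm M x v
  have h6 := congrArg Complex.re h5
  rw [← h4, herm_self_eq hH x, Complex.re_ofReal_mul, Complex.ofReal_re] at h6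
  simp only [Complex.ofReal_re] at h6
  nlinarith [mul_neg_of_neg_of_pos hx h3]

/-- Two orthogonal isotropic vectors are proportional. -/
lemma HasSignatureTwoOne.isotropic_orthogonal (hM : HasSignatureTwoOne M) {w v : Fin 3 → ℂ}
    (hw : w ≠ 0) (hww : herm M w w = 0) (hvv : herm M v v = 0) (hvw : herm M v w = 0) :
    ∃ a : ℂ, v = a • w := by
  obtain ⟨S, T, hST, hTS, hh⟩ := hM.exists_coordinates
  obtain ⟨u, rfl⟩ : ∃ u, v = u ᵥ* S := ⟨v ᵥ* T, by rw [Matrix.vecMul_vecMul, hTS, Matrix.vecMul_one]⟩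
  obtain ⟨y, rfl⟩ : ∃ u, w = u ᵥ* S := ⟨w ᵥ* T, by rw [Matrix.vecMul_vecMul, hTS, Matrix.vecMul_one]⟩
  have hy2 : y 2 ≠ 0 := by
    intro h
    rw [hh, h] at hww
    have h1 : ∀ a : ℂ, a * star a = ((‖a‖ ^ 2 : ℝ) : ℂ) := by
      intro a
      rw [Complex.star_def, Complex.mul_conj, Complex.normSq_eq_norm_sq]
    rw [h1, h1] at hww
    have h2 : ‖y 0‖ ^ 2 + ‖y 1‖ ^ 2 = 0 := by
      have := congrArg Complex.re hww
      simpa [← Complex.ofReal_pow] using this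
    apply hw
    have : y = 0 := by
      ext i
      fin_cases i
      · have : ‖y 0‖ ^ 2 = 0 := by nlinarith [sq_nonneg ‖y 0‖, sq_nonneg ‖y 1‖]
        simpa using this
      · have : ‖y 1‖ ^ 2 = 0 := by nlinarith [sq_nonneg ‖y 0‖, sq_nonneg ‖y 1‖]
        simpa using this
      · simpa using h
    rw [this, Matrix.zero_vecMul]
  have hH : M.IsHermitian := hM.isHermitian
  refine ⟨u 2 / y 2, ?_⟩
  rw [← Matrix.smul_vecMul]
  have hz : herm M ((u - (u 2 / y 2) • y) ᵥ* S) ((u - (u 2 / y 2) • y) ᵥ* S) = 0 := by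
    have hwv : herm M (y ᵥ* S) (u ᵥ* S) = 0 := by rw [← star_herm hH, hvw, star_zero]
    rw [Matrix.sub_vecMul, Matrix.smul_vecMul, sub_eq_add_neg, ← neg_smul, herm_add_left,
      herm_add_right, herm_add_right, herm_smul_left, herm_smul_right, herm_smul, hww, hvv, hvw, hwv]
    ring
  rw [hh] at hz
  have h1 : ∀ a : ℂ, a * star a = ((‖a‖ ^ 2 : ℝ) : ℂ) := by
    intro a
    rw [Complex.star_def, Complex.mul_conj, Complex.normSq_eq_norm_sq]
  have h20 : (u - (u 2 / y 2) • y) 2 = 0 := by simp [hy2]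
  rw [h20, h1, h1] at hz
  set z := u - (u 2 / y 2) • y with hzdef
  have h2 : ‖z 0‖ ^ 2 + ‖z 1‖ ^ 2 = 0 := by
    have := congrArg Complex.re hz
    simpa [← Complex.ofReal_pow] using this
  have h3 : z = 0 := by
    ext i
    fin_cases i
    · have : ‖z 0‖ ^ 2 = 0 := by nlinarith [sq_nonneg ‖z 0‖, sq_nonneg ‖z 1‖]
      simpa using this
    · have : ‖z 1‖ ^ 2 = 0 := by nlinarith [sq_nonneg ‖z 0‖, sq_nonneg ‖z 1‖]
      simpa using this
    · exact h20
  rw [sub_eq_zero.mp h3]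
  congr 1
  simp [hy2]

end Form

end CHyp

/-! ### Majorants and the negative cone -/

namespace CHyp

open scoped ComplexOrder

section Majorant

variable {M : Matrix (Fin 3) (Fin 3) ℂ}

/-- The Hermite majorant of the form `M` attached to a negative vector `x`: the positive definite
form that agrees with `M` on the orthogonal complement of `x` and with `-M` on `ℂ x`. -/
noncomputable def majorant (M : Matrix (Fin 3) (Fin 3) ℂ) (x v : Fin 3 → ℂ) : ℝ :=
  (herm M v v).re + 2 * ‖herm M v x‖ ^ 2 / -(herm M x x).re

/-- The majorant dominates the absolute value of the form; this is the reversed Cauchy-Schwarz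
inequality. -/
lemma abs_herm_le_majorant (hM : HasSignatureTwoOne M) {x : Fin 3 → ℂ}
    (hx : (herm M x x).re < 0) (v : Fin 3 → ℂ) : |(herm M v v).re| ≤ majorant M x v := by
  have h1 : (herm M v v).re * (herm M x x).re ≤ ‖herm M v x‖ ^ 2 := by
    by_cases hv : ∀ a : ℂ, v ≠ a • x
    · exact (hM.reverse_cauchySchwarz hx hv).le
    · push Not at hv
      obtain ⟨a, rfl⟩ := hv
      rw [herm_smul_self, herm_smul_left, norm_mul, mul_pow, norm_herm_self hM.isHermitian, sq_abs,
        Complex.normSq_eq_norm_sq]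
      exact le_of_eq (by ring)
  have h2 : -(herm M v v).re ≤ ‖herm M v x‖ ^ 2 / -(herm M x x).re := by
    rw [le_div_iff₀ (by linarith)]
    linarith
  have h3 : 0 ≤ ‖herm M v x‖ ^ 2 / -(herm M x x).re := div_nonneg (sq_nonneg _) (by linarith)
  unfold majorant
  rw [abs_le, mul_div_assoc]
  constructor <;> linarith

lemma majorant_nonneg (hM : HasSignatureTwoOne M) {x : Fin 3 → ℂ}
    (hx : (herm M x x).re < 0) (v : Fin 3 → ℂ) : 0 ≤ majorant M x v :=
  (abs_nonneg _).trans (abs_herm_le_majorant hM hx v)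

lemma majorant_pos (hM : HasSignatureTwoOne M) {x v : Fin 3 → ℂ}
    (hx : (herm M x x).re < 0) (hv : v ≠ 0) : 0 < majorant M x v := by
  refine lt_of_le_of_ne (majorant_nonneg hM hx v) fun h => ?_
  have h1 := abs_herm_le_majorant hM hx v
  rw [← h, abs_nonpos_iff] at h1
  have h2 : herm M v x = 0 := by
    unfold majorant at h
    rw [h1, zero_add] at h
    have h3 := (div_eq_zero_iff.mp h.symm).resolve_right (by linarith)
    simpa using h3
  exact absurd h1 (hM.pos_of_orthogonal hx h2 hv).ne'

lemma majorant_vecMul (g : SU M) (x v : Fin 3 → ℂ) :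
    majorant M (x ᵥ* (g : Matrix.SpecialLinearGroup (Fin 3) ℂ))
      (v ᵥ* (g : Matrix.SpecialLinearGroup (Fin 3) ℂ)) = majorant M x v := by
  unfold majorant
  rw [herm_vecMul, herm_vecMul, herm_vecMul]

/-- The Hermitian matrix of the majorant. -/
noncomputable def majorantMatrix (M : Matrix (Fin 3) (Fin 3) ℂ) (x : Fin 3 → ℂ) :
    Matrix (Fin 3) (Fin 3) ℂ :=
  M + ((2 / -(herm M x x).re : ℝ) : ℂ) • Matrix.vecMulVec (M *ᵥ star x) (star (M *ᵥ star x))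

lemma herm_eq_dotProduct_mulVec (M : Matrix (Fin 3) (Fin 3) ℂ) (v w : Fin 3 → ℂ) :
    herm M v w = v ⬝ᵥ (M *ᵥ star w) := by
  rw [herm, Matrix.dotProduct_mulVec]

lemma herm_majorantMatrix (M : Matrix (Fin 3) (Fin 3) ℂ) (x v : Fin 3 → ℂ) :
    herm (majorantMatrix M x) v v = herm M v v +
      ((2 * ‖herm M v x‖ ^ 2 / -(herm M x x).re : ℝ) : ℂ) := by
  have h1 : herm (majorantMatrix M x) v v = herm M v v +
      ((2 / -(herm M x x).re : ℝ) : ℂ) * (herm M v x * star (herm M v x)) := by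
    rw [herm_eq_dotProduct_mulVec M v x, ← Matrix.star_dotProduct_star]
    unfold majorantMatrix herm
    rw [Matrix.vecMul_add, add_dotProduct, Matrix.vecMul_smul, smul_dotProduct, smul_eq_mul,
      Matrix.vecMul_vecMulVec, smul_dotProduct, smul_eq_mul]
  rw [h1, Complex.star_def, Complex.mul_conj, Complex.normSq_eq_norm_sq, ← Complex.ofReal_mul]
  congr 2
  ring

lemma majorantMatrix_isHermitian (hM : M.IsHermitian) (x : Fin 3 → ℂ) :
    (majorantMatrix M x).IsHermitian := by
  unfold majorantMatrix
  refine hM.add ?_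
  unfold Matrix.IsHermitian
  rw [Matrix.conjTranspose_smul, Matrix.conjTranspose_vecMulVec, star_star]
  simp

lemma majorantMatrix_posDef (hM : HasSignatureTwoOne M) {x : Fin 3 → ℂ}
    (hx : (herm M x x).re < 0) : (majorantMatrix M x).PosDef := by
  refine Matrix.PosDef.of_dotProduct_mulVec_pos (majorantMatrix_isHermitian hM.isHermitian x)
    fun v hv => ?_
  have h1 : star v ⬝ᵥ majorantMatrix M x *ᵥ v = ((majorant M x (star v) : ℝ) : ℂ) := by
    have := herm_majorantMatrix M x (star v)
    rw [herm_eq_dotProduct_mulVec, star_star] at this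
    rw [this, herm_self_eq hM.isHermitian, ← Complex.ofReal_add]
    rfl
  rw [h1]
  exact_mod_cast majorant_pos hM hx (star_ne_zero.mpr hv)

/-- The determinant of the majorant does not depend on the negative vector. -/
lemma det_majorantMatrix (hM : HasSignatureTwoOne M) {x : Fin 3 → ℂ}
    (hx : (herm M x x).re < 0) : (majorantMatrix M x).det = -M.det := by
  have hH := hM.isHermitian
  set r : ℂ := ((2 / -(herm M x x).re : ℝ) : ℂ) with hr
  have h0 : M *ᵥ star x = star (x ᵥ* M) := by
    rw [Matrix.star_vecMul, hH.eq]
  have h1 : majorantMatrix M x = M * (1 + Matrix.vecMulVec (r • star x) (x ᵥ* M)) := by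
    unfold majorantMatrix
    rw [Matrix.mul_add, Matrix.mul_one, Matrix.mul_vecMulVec, Matrix.mulVec_smul, h0, star_star,
      ← hr, Matrix.smul_vecMulVec]
  have h2 : (1 + Matrix.vecMulVec (r • star x) (x ᵥ* M)).det = -1 := by
    rw [Matrix.vecMulVec_eq (ι := Unit), Matrix.det_one_add_replicateCol_mul_replicateRow,
      dotProduct_smul]
    change 1 + r • herm M x x = -1
    rw [herm_self_eq hH, hr, smul_eq_mul, ← Complex.ofReal_mul]
    have : 2 / -(herm M x x).re * (herm M x x).re = -2 := by
      have : (herm M x x).re ≠ 0 := hx.ne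
      field_simp
    rw [this]
    norm_num
  rw [h1, Matrix.det_mul, h2]
  ring

/-- Polarization: a parallelogram-type bound for the values of a form dominated by a positive
quadratic form. -/
lemma norm_herm_le_of_dominated {A B : Matrix (Fin 3) (Fin 3) ℂ}
    (hAB : ∀ v, ‖herm A v v‖ ≤ (herm B v v).re) (v w : Fin 3 → ℂ) :
    ‖herm A v w‖ ≤ (herm B v v).re + (herm B w w).re := by
  have h1 : 4 * herm A v w = herm A (v + w) (v + w) - herm A (v + (-1 : ℂ) • w) (v + (-1 : ℂ) • w)
      + Complex.I * herm A (v + Complex.I • w) (v + Complex.I • w)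
      - Complex.I * herm A (v + (-Complex.I) • w) (v + (-Complex.I) • w) := by
    simp only [herm_add_left, herm_add_right, herm_smul_left, herm_smul_right, star_neg, star_one,
      Complex.star_def, Complex.conj_I]
    ring_nf
    simp only [Complex.I_sq]
    ring
  have h2 : (herm B (v + w) (v + w)).re + (herm B (v + (-1 : ℂ) • w) (v + (-1 : ℂ) • w)).re
      + (herm B (v + Complex.I • w) (v + Complex.I • w)).re
      + (herm B (v + (-Complex.I) • w) (v + (-Complex.I) • w)).re =
      4 * ((herm B v v).re + (herm B w w).re) := by
    have : herm B (v + w) (v + w) + herm B (v + (-1 : ℂ) • w) (v + (-1 : ℂ) • w)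
      + herm B (v + Complex.I • w) (v + Complex.I • w)
      + herm B (v + (-Complex.I) • w) (v + (-Complex.I) • w) = 4 * (herm B v v + herm B w w) := by
      simp only [herm_add_left, herm_add_right, herm_smul_left, herm_smul_right, star_neg, star_one,
        Complex.star_def, Complex.conj_I]
      ring_nf
      simp only [Complex.I_sq]
      ring
    have := congrArg Complex.re this
    simpa using this
  have h3 : 4 * ‖herm A v w‖ ≤ 4 * ((herm B v v).re + (herm B w w).re) := by
    calc 4 * ‖herm A v w‖ = ‖4 * herm A v w‖ := by rw [norm_mul]; simp
      _ ≤ ‖herm A (v + w) (v + w)‖ + ‖herm A (v + (-1 : ℂ) • w) (v + (-1 : ℂ) • w)‖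
        + ‖herm A (v + Complex.I • w) (v + Complex.I • w)‖
        + ‖herm A (v + (-Complex.I) • w) (v + (-Complex.I) • w)‖ := by
          rw [h1]
          refine (norm_sub_le _ _).trans ?_
          rw [norm_mul Complex.I, Complex.norm_I, one_mul]
          gcongr
          refine (norm_add_le _ _).trans ?_
          rw [norm_mul Complex.I, Complex.norm_I, one_mul]
          gcongr
          exact norm_sub_le _ _
      _ ≤ _ := by
          rw [← h2]
          gcongr <;> exact hAB _
  linarith

lemma norm_herm_le_majorant (hM : HasSignatureTwoOne M) {x : Fin 3 → ℂ}
    (hx : (herm M x x).re < 0) (v w : Fin 3 → ℂ) :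
    ‖herm M v w‖ ≤ majorant M x v + majorant M x w := by
  have h1 : ∀ v, (herm (majorantMatrix M x) v v).re = majorant M x v := fun v => by
    rw [herm_majorantMatrix, Complex.add_re, Complex.ofReal_re]; rfl
  have := norm_herm_le_of_dominated (A := M) (B := majorantMatrix M x) (fun v => by
    rw [h1, norm_herm_self hM.isHermitian]
    exact abs_herm_le_majorant hM hx v) v w
  rwa [h1, h1] at this

lemma norm_herm_le_of_posDef {A : Matrix (Fin 3) (Fin 3) ℂ} (hA : A.PosDef) (v w : Fin 3 → ℂ) :
    ‖herm A v w‖ ≤ (herm A v v).re + (herm A w w).re := by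
  refine norm_herm_le_of_dominated (fun v => ?_) v w
  rw [norm_herm_self hA.isHermitian, abs_of_nonneg]
  have := hA.posSemidef.dotProduct_mulVec_nonneg (star v)
  rw [star_star, ← star_star v, ← herm_eq_dotProduct_mulVec, star_star] at this
  exact (Complex.nonneg_iff.mp this).1

lemma herm_self_pos_of_posDef {A : Matrix (Fin 3) (Fin 3) ℂ} (hA : A.PosDef) {v : Fin 3 → ℂ}
    (hv : v ≠ 0) : 0 < (herm A v v).re := by
  have := hA.dotProduct_mulVec_pos (star_ne_zero.mpr hv)
  rw [star_star, ← herm_eq_dotProduct_mulVec] at this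
  exact (Complex.pos_iff.mp this).1

lemma continuous_herm {X : Type*} [TopologicalSpace X] (A : Matrix (Fin 3) (Fin 3) ℂ)
    {f g : X → Fin 3 → ℂ} (hf : Continuous f) (hg : Continuous g) :
    Continuous fun x => herm A (f x) (g x) := by
  unfold herm Matrix.vecMul dotProduct
  fun_prop

/-- A positive definite form is comparable with the norm. -/
lemma exists_norm_sq_le_of_posDef {A : Matrix (Fin 3) (Fin 3) ℂ} (hA : A.PosDef) :
    ∃ K : ℝ, 0 < K ∧ ∀ v : Fin 3 → ℂ, ‖v‖ ^ 2 ≤ K * (herm A v v).re := by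
  obtain ⟨v₀, hv₀, hmin⟩ := (isCompact_sphere (0 : Fin 3 → ℂ) 1).exists_isMinOn
    (NormedSpace.sphere_nonempty.mpr zero_le_one)
    (Complex.continuous_re.comp (continuous_herm A continuous_id continuous_id)).continuousOn
  have hv₀' : v₀ ≠ 0 := by
    rintro rfl
    simp at hv₀
  have hpos := herm_self_pos_of_posDef hA hv₀'
  refine ⟨((herm A v₀ v₀).re)⁻¹, inv_pos.mpr hpos, fun v => ?_⟩
  by_cases hv : v = 0
  · simp [hv, herm]
  have hn : ‖v‖ ≠ 0 := norm_ne_zero_iff.mpr hv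
  have h1 : ((‖v‖⁻¹ : ℝ) : ℂ) • v ∈ Metric.sphere (0 : Fin 3 → ℂ) 1 := by
    simp [norm_smul, hn]
  have h2 := hmin h1
  simp only [Set.mem_ofPred_eq, Function.comp_apply, id] at h2
  rw [herm_smul_self, Complex.normSq_eq_norm_sq, Complex.norm_real, norm_inv, norm_norm] at h2
  rw [inv_mul_eq_div, le_div_iff₀ hpos]
  calc ‖v‖ ^ 2 * (herm A v₀ v₀).re ≤ ‖v‖ ^ 2 * (‖v‖⁻¹ ^ 2 * (herm A v v).re) := by gcongr
    _ = (herm A v v).re := by field_simp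

open scoped MatrixOrder in
/-- A Hermitian square root diagonalizes a positive definite form. -/
lemma exists_norm_sq_eq_of_posDef {A : Matrix (Fin 3) (Fin 3) ℂ} (hA : A.PosDef) :
    ∃ B : Matrix (Fin 3) (Fin 3) ℂ, ‖B.det‖ ^ 2 = ‖A.det‖ ∧
      ∀ v, (herm A v v).re = ∑ i, ‖(v ᵥ* B) i‖ ^ 2 := by
  obtain ⟨B, hB⟩ := CStarAlgebra.nonneg_iff_eq_star_mul_self.mp hA.posSemidef.nonneg
  refine ⟨Bᴴ, ?_, fun v => ?_⟩
  · rw [hB, Matrix.det_mul, Matrix.star_eq_conjTranspose, Matrix.det_conjTranspose, norm_mul,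
      norm_star, sq]
  · have : herm A v v = herm 1 (v ᵥ* Bᴴ) (v ᵥ* Bᴴ) := by
      rw [herm_vecMul_vecMul, Matrix.mul_one, Matrix.conjTranspose_conjTranspose, hB,
        Matrix.star_eq_conjTranspose]
    rw [this, herm, Matrix.vecMul_one, dotProduct, Complex.re_sum]
    refine Finset.sum_congr rfl fun i _ => ?_
    rw [Pi.star_apply, Complex.star_def, Complex.mul_conj, Complex.normSq_eq_norm_sq,
      Complex.ofReal_re]

end Majorant

section NegativeCone

variable {M : Matrix (Fin 3) (Fin 3) ℂ}

/-- The cone of negative vectors. -/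
def negCone (M : Matrix (Fin 3) (Fin 3) ℂ) : Set (Fin 3 → ℂ) := {x | (herm M x x).re < 0}

lemma standard_form_re (z : Fin 3 → ℂ) :
    (z 0 * star (z 0) + z 1 * star (z 1) - z 2 * star (z 2)).re =
      ‖z 0‖ ^ 2 + ‖z 1‖ ^ 2 - ‖z 2‖ ^ 2 := by
  have : ∀ a : ℂ, (a * star a).re = ‖a‖ ^ 2 := by
    intro a
    rw [Complex.star_def, Complex.mul_conj, Complex.normSq_eq_norm_sq, Complex.ofReal_re]
  rw [Complex.sub_re, Complex.add_re, this, this, this]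

/-- In coordinates the negative cone consists of the multiples of `(a, b, 1)` with `(a, b)` in the
unit ball. -/
lemma HasSignatureTwoOne.isPreconnected_negCone (hM : HasSignatureTwoOne M) :
    IsPreconnected (negCone M) := by
  obtain ⟨S, T, hST, hTS, hh⟩ := hM.exists_coordinates
  let f : EuclideanSpace ℂ (Fin 2) × ℂ → (Fin 3 → ℂ) := fun p =>
    (p.2 • ![p.1 0, p.1 1, 1]) ᵥ* S
  have hf : Continuous f := by
    have h1 : Continuous fun p : EuclideanSpace ℂ (Fin 2) × ℂ => p.2 • ![p.1 0, p.1 1, 1] := by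
      refine continuous_pi fun i => ?_
      fin_cases i <;> simp <;> fun_prop
    exact h1.matrix_vecMul continuous_const
  have h2 : IsPreconnected ((Metric.ball (0 : EuclideanSpace ℂ (Fin 2)) 1) ×ˢ ({0}ᶜ : Set ℂ)) :=
    (convex_ball _ _).isPreconnected.prod
      (isConnected_compl_singleton_of_one_lt_rank (by simp) 0).isPreconnected
  convert h2.image f hf.continuousOn using 1
  ext x
  constructor
  · intro hx
    obtain ⟨u, rfl⟩ : ∃ u, x = u ᵥ* S :=
      ⟨x ᵥ* T, by rw [Matrix.vecMul_vecMul, hTS, Matrix.vecMul_one]⟩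
    have hx' : (herm M (u ᵥ* S) (u ᵥ* S)).re < 0 := hx
    rw [hh, standard_form_re] at hx'
    have hu2 : u 2 ≠ 0 := by
      intro h
      rw [h] at hx'
      simp at hx'
      nlinarith [sq_nonneg ‖u 0‖, sq_nonneg ‖u 1‖]
    refine ⟨(!₂[u 0 / u 2, u 1 / u 2], u 2), ⟨?_, hu2⟩, ?_⟩
    · have h3 : 0 < ‖u 2‖ := norm_pos_iff.mpr hu2
      have h4 : ‖u 0 / u 2‖ ^ 2 + ‖u 1 / u 2‖ ^ 2 < 1 := by
        rw [norm_div, norm_div, div_pow, div_pow, ← add_div, div_lt_one (by positivity)]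
        linarith
      rw [Metric.mem_ball, dist_zero_right, EuclideanSpace.norm_eq, Fin.sum_univ_two]
      rw [Real.sqrt_lt' one_pos]
      simpa using h4
    · simp only [f]
      congr 1
      ext i
      fin_cases i <;> simp <;> field_simp
  · rintro ⟨⟨p, c⟩, ⟨hp, hc⟩, rfl⟩
    change (herm M _ _).re < 0
    simp only [f]
    rw [hh, standard_form_re]
    have h3 : 0 < ‖c‖ := norm_pos_iff.mpr hc
    rw [Metric.mem_ball, dist_zero_right, EuclideanSpace.norm_eq, Fin.sum_univ_two,
      Real.sqrt_lt' one_pos] at hp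
    simp [mul_pow]
    nlinarith [mul_pos h3 h3]

/-- If `z` moves all points of the complex hyperbolic plane by a bounded amount then `z` is
scalar. In the limit, the sesquilinear form `h(xz, x)` vanishes on the isotropic cone; testing it on
the vectors `(a, b, 1)` with `|a|² + |b|² = 1` shows that it is a multiple of `h`. -/
lemma HasSignatureTwoOne.isScalar_of_bounded (hM : HasSignatureTwoOne M)
    (z : Matrix (Fin 3) (Fin 3) ℂ) (C : ℝ)
    (hz : ∀ x ∈ negCone M, ‖herm M (x ᵥ* z) x‖ ≤ C * -(herm M x x).re) :
    ∃ c : ℂ, z = c • (1 : Matrix (Fin 3) (Fin 3) ℂ) := by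
  obtain ⟨S, T, hST, hTS, hh⟩ := hM.exists_coordinates
  set B := S * z * T with hB
  -- the coefficients of the form in the coordinates
  let β : (Fin 3 → ℂ) → ℂ := fun u => (u ᵥ* B) 0 * star (u 0) + (u ᵥ* B) 1 * star (u 1) -
    (u ᵥ* B) 2 * star (u 2)
  have hβ : ∀ u, herm M ((u ᵥ* S) ᵥ* z) (u ᵥ* S) = β u := by
    intro u
    have : (u ᵥ* S) ᵥ* z = (u ᵥ* B) ᵥ* S := by
      rw [hB, Matrix.vecMul_vecMul, Matrix.vecMul_vecMul, Matrix.mul_assoc, hTS, Matrix.mul_one]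
    rw [this, hh]
  have key : ∀ a b : ℂ, ‖a‖ ^ 2 + ‖b‖ ^ 2 = 1 → β ![a, b, 1] = 0 := by
    intro a b hab
    have h1 : ∀ r ∈ Set.Ioo (0 : ℝ) 1, ‖β ![(r : ℂ) * a, (r : ℂ) * b, 1]‖ ≤ C * (1 - r ^ 2) := by
      intro r hr
      have h2 : (herm M (![(r : ℂ) * a, (r : ℂ) * b, 1] ᵥ* S)
          (![(r : ℂ) * a, (r : ℂ) * b, 1] ᵥ* S)).re = r ^ 2 - 1 := by
        rw [hh, standard_form_re]
        simp [mul_pow]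
        linear_combination r ^ 2 * hab
      have h3 := hz (![(r : ℂ) * a, (r : ℂ) * b, 1] ᵥ* S) (by
        change (herm M _ _).re < 0
        rw [h2]
        nlinarith [hr.1, hr.2])
      rw [hβ, h2] at h3
      linarith
    have h4 : Filter.Tendsto (fun r : ℝ => ‖β ![(r : ℂ) * a, (r : ℂ) * b, 1]‖)
        (nhdsWithin 1 (Set.Iio 1)) (nhds ‖β ![a, b, 1]‖) := by
      have : Continuous fun r : ℝ => ‖β ![(r : ℂ) * a, (r : ℂ) * b, 1]‖ := by
        simp only [β, Matrix.vecMul, dotProduct, Fin.sum_univ_three]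
        simp
        fun_prop
      have h5 := this.tendsto 1
      simp only [Complex.ofReal_one, one_mul] at h5
      exact h5.mono_left nhdsWithin_le_nhds
    have h6 : Filter.Tendsto (fun r : ℝ => C * (1 - r ^ 2)) (nhdsWithin 1 (Set.Iio 1)) (nhds 0) := by
      have : Continuous fun r : ℝ => C * (1 - r ^ 2) := by fun_prop
      have h5 := this.tendsto 1
      simp only [one_pow, sub_self, mul_zero] at h5
      exact h5.mono_left nhdsWithin_le_nhds
    have h7 := le_of_tendsto_of_tendsto h4 h6 (by
      filter_upwards [Ioo_mem_nhdsLT (zero_lt_one' ℝ)] with r hr using h1 r hr)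
    exact norm_le_zero_iff.mp h7
  have hexp : ∀ a b : ℂ, β ![a, b, 1] = (a * B 0 0 + b * B 1 0 + B 2 0) * star a +
      (a * B 0 1 + b * B 1 1 + B 2 1) * star b - (a * B 0 2 + b * B 1 2 + B 2 2) := by
    intro a b
    simp [β, Matrix.vecMul, dotProduct, Fin.sum_univ_three]
  simp only [hexp] at key
  have e1 := key 1 0 (by simp)
  have e2 := key (-1) 0 (by simp)
  have e3 := key Complex.I 0 (by simp)
  have f1 := key 0 1 (by simp)
  have f2 := key 0 (-1) (by simp)
  have f3 := key 0 Complex.I (by simp)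
  have hI := Complex.I_mul_I
  have hn : ‖(3 / 5 : ℂ)‖ ^ 2 + ‖(4 / 5 : ℂ)‖ ^ 2 = 1 := by norm_num
  have hn' : ‖(3 / 5 : ℂ)‖ ^ 2 + ‖(4 / 5 * Complex.I : ℂ)‖ ^ 2 = 1 := by norm_num
  have g1 := key (3 / 5) (4 / 5) hn
  have g2 := key (3 / 5) (4 / 5 * Complex.I) hn'
  simp only [star_one, star_zero, star_neg, Complex.star_def, Complex.conj_I, map_mul, map_div₀,
    map_ofNat] at e1 e2 e3 f1 f2 f3 g1 g2
  have a1 : B 2 0 = B 0 2 := by linear_combination (e1 - e2) / 2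
  have a2 : B 0 2 * Complex.I = 0 := by
    linear_combination (-e3 + (e1 + e2) / 2 + B 0 0 * hI * (-1)) / 2 - Complex.I / 2 * a1
  have a3 : B 0 2 = 0 := by simpa using a2
  have a4 : B 2 0 = 0 := a1.trans a3
  have b1 : B 2 1 = B 1 2 := by linear_combination (f1 - f2) / 2
  have b2 : B 1 2 * Complex.I = 0 := by
    linear_combination (-f3 + (f1 + f2) / 2 + B 1 1 * hI * (-1)) / 2 - Complex.I / 2 * b1
  have b3 : B 1 2 = 0 := by simpa using b2
  have b4 : B 2 1 = 0 := b1.trans b3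
  have c1 : B 0 0 = B 2 2 := by linear_combination (e1 + e2) / 2
  have c2 : B 1 1 = B 2 2 := by linear_combination (f1 + f2) / 2
  simp only [a3, a4, b3, b4, c1, c2] at g1 g2
  have d1 : B 1 0 + B 0 1 = 0 := by linear_combination 25 / 12 * g1
  have d2 : Complex.I * (B 1 0 - B 0 1) = 0 := by
    linear_combination 25 / 12 * g2 + 25 / 12 * (16 / 25) * B 2 2 * hI
  have d3 : B 1 0 - B 0 1 = 0 := by simpa using d2
  have d4 : B 1 0 = 0 := by linear_combination (d1 + d3) / 2
  have d5 : B 0 1 = 0 := by linear_combination (d1 - d3) / 2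
  have hBs : B = B 2 2 • (1 : Matrix (Fin 3) (Fin 3) ℂ) := by
    ext i j
    fin_cases i <;> fin_cases j <;> simp [a3, a4, b3, b4, c1, c2, d4, d5]
  refine ⟨B 2 2, ?_⟩
  calc z = T * (S * z * T) * S := by
        simp only [Matrix.mul_assoc, hTS, Matrix.mul_one]
        rw [← Matrix.mul_assoc, hTS, Matrix.one_mul]
    _ = T * (B 2 2 • (1 : Matrix (Fin 3) (Fin 3) ℂ)) * S := by rw [← hB, ← hBs]
    _ = _ := by simp [hTS]

end NegativeCone

end CHyp

/-! ### Integral unitary matrices -/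

namespace CHyp

open scoped ComplexOrder
open NumberField

section Setup

variable {E : Type*} [Field E]

lemma conjugate_apply (ν : E →+* ℂ) (A : Matrix (Fin 3) (Fin 3) (𝓞 E)) (i j : Fin 3) :
    conjugate ν A i j = ν (A i j : E) := rfl

lemma conjugate_eq_mapMatrix (ν : E →+* ℂ) (A : Matrix (Fin 3) (Fin 3) (𝓞 E)) :
    conjugate ν A = (ν.comp (algebraMap (𝓞 E) E)).mapMatrix A := rfl

lemma conjugate_mul (ν : E →+* ℂ) (A B : Matrix (Fin 3) (Fin 3) (𝓞 E)) :
    conjugate ν (A * B) = conjugate ν A * conjugate ν B := by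
  rw [conjugate_eq_mapMatrix, map_mul]; rfl

lemma conjugate_one (ν : E →+* ℂ) : conjugate ν (1 : Matrix (Fin 3) (Fin 3) (𝓞 E)) = 1 := by
  simp [conjugate_eq_mapMatrix]

lemma det_conjugate (ν : E →+* ℂ) (A : Matrix (Fin 3) (Fin 3) (𝓞 E)) :
    (conjugate ν A).det = ν (A.det : E) := by
  rw [conjugate_eq_mapMatrix, ← RingHom.map_det]; rfl

lemma conjugate_injective (ν : E →+* ℂ) :
    Function.Injective (conjugate ν : Matrix (Fin 3) (Fin 3) (𝓞 E) → _) := by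
  intro A B h
  ext i j
  have := congrFun (congrFun h i) j
  rw [conjugate_apply, conjugate_apply] at this
  exact_mod_cast ν.injective this

/-- The image in `ℂ³` of a vector with entries in the ring of integers. -/
def vecEmb (ν : E →+* ℂ) (v : Fin 3 → 𝓞 E) : Fin 3 → ℂ := fun i => ν (v i : E)

lemma vecEmb_vecMul (ν : E →+* ℂ) (v : Fin 3 → 𝓞 E) (A : Matrix (Fin 3) (Fin 3) (𝓞 E)) :
    vecEmb ν (v ᵥ* A) = vecEmb ν v ᵥ* conjugate ν A := by
  ext i
  simp [vecEmb, Matrix.vecMul, dotProduct, conjugate_apply]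

lemma vecEmb_injective (ν : E →+* ℂ) :
    Function.Injective (vecEmb ν : (Fin 3 → 𝓞 E) → _) := by
  intro A B h
  ext i
  have := congrFun h i
  exact_mod_cast ν.injective this

/-- The matrix in `M₃(R_E)` underlying an element of `SU(H, R_E)`. -/
def mat {φ : E →+* ℂ} {H : Matrix (Fin 3) (Fin 3) (𝓞 E)} (g : SUInt φ H) :
    Matrix (Fin 3) (Fin 3) (𝓞 E) := ((g : Matrix.SpecialLinearGroup (Fin 3) (𝓞 E)) :
      Matrix (Fin 3) (Fin 3) (𝓞 E))

section mat

variable {φ : E →+* ℂ} {H : Matrix (Fin 3) (Fin 3) (𝓞 E)}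

lemma mat_mul (g h : SUInt φ H) : mat (g * h) = mat g * mat h := rfl

lemma mat_one : mat (1 : SUInt φ H) = 1 := rfl

lemma mat_pow (g : SUInt φ H) (n : ℕ) : mat (g ^ n) = mat g ^ n := by
  induction n with
  | zero => simp [mat_one]
  | succ n ih => rw [pow_succ, pow_succ, mat_mul, ih]

lemma mat_injective : Function.Injective (mat : SUInt φ H → _) := by
  intro g h hgh
  exact Subtype.ext (Subtype.ext hgh)

lemma mat_mul_inv (g : SUInt φ H) : mat g * mat g⁻¹ = 1 := by
  rw [← mat_mul, mul_inv_cancel, mat_one]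

lemma det_mat (g : SUInt φ H) : (mat g).det = 1 := g.1.2

lemma coe_toSU (g : SUInt φ H) :
    ((SUInt.toSU φ H g : Matrix.SpecialLinearGroup (Fin 3) ℂ) : Matrix (Fin 3) (Fin 3) ℂ) =
      conjugate φ (mat g) := rfl

lemma conjugate_mat_mul (g : SUInt φ H) :
    conjugate φ (mat g) * conjugate φ H * (conjugate φ (mat g))ᴴ = conjugate φ H := g.2

/-- An integral matrix of determinant one that preserves the form defines an element of
`SU(H, R_E)`. -/
def ofMat (A : Matrix (Fin 3) (Fin 3) (𝓞 E)) (hdet : A.det = 1)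
    (hA : conjugate φ A * conjugate φ H * (conjugate φ A)ᴴ = conjugate φ H) : SUInt φ H :=
  ⟨⟨A, hdet⟩, hA⟩

lemma mat_ofMat (A : Matrix (Fin 3) (Fin 3) (𝓞 E)) (hdet : A.det = 1)
    (hA : conjugate φ A * conjugate φ H * (conjugate φ A)ᴴ = conjugate φ H) :
    mat (ofMat A hdet hA) = A := rfl

lemma vecMul_mem_negCone (g : SUInt φ H) {x : Fin 3 → ℂ} (hx : x ∈ negCone (conjugate φ H)) :
    x ᵥ* conjugate φ (mat g) ∈ negCone (conjugate φ H) := by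
  change (herm _ _ _).re < 0
  rw [← coe_toSU, herm_vecMul]
  exact hx

end mat

end Setup

section Finiteness

variable {E : Type*} [Field E] [NumberField E]

/-- There are finitely many algebraic integers in `E` all of whose conjugates are bounded. -/
lemma finite_setOf_norm_le (B : ℝ) : {x : 𝓞 E | ∀ ν : E →+* ℂ, ‖ν (x : E)‖ ≤ B}.Finite := by
  refine Set.Finite.of_finite_image ((Embeddings.finite_of_norm_le E ℂ B).subset ?_)
    (RingOfIntegers.coe_injective (K := E)).injOn
  rintro _ ⟨x, hx, rfl⟩
  exact ⟨x.isIntegral_coe, hx⟩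

/-- There are finitely many integral matrices all of whose conjugates are bounded. -/
lemma finite_setOf_matrix_norm_le (B : ℝ) :
    {A : Matrix (Fin 3) (Fin 3) (𝓞 E) | ∀ (ν : E →+* ℂ) (i j), ‖ν (A i j : E)‖ ≤ B}.Finite := by
  have h2 := Set.Finite.pi' (fun _ : Fin 3 => Set.Finite.pi' (fun _ : Fin 3 => finite_setOf_norm_le (E := E) B))
  refine h2.subset fun A hA i j ν => hA ν i j

end Finiteness

section CM

variable {E : Type*} [Field E] [NumberField E] [IsCMField E]

/-- Complex conjugation on the ring of integers of a CM field. -/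
noncomputable instance : StarRing (𝓞 E) where
  star := IsCMField.ringOfIntegersComplexConj E
  star_involutive x := by
    apply RingOfIntegers.ext
    simp
  star_mul x y := by rw [map_mul, mul_comm]
  star_add x y := by rw [map_add]

lemma emb_star (ν : E →+* ℂ) (x : 𝓞 E) : ν ((star x : 𝓞 E) : E) = star (ν (x : E)) :=
  IsCMField.complexEmbedding_complexConj E ν x

lemma conjugate_conjTranspose (ν : E →+* ℂ) (A : Matrix (Fin 3) (Fin 3) (𝓞 E)) :
    conjugate ν Aᴴ = (conjugate ν A)ᴴ := by
  ext i j
  rw [conjugate_apply, Matrix.conjTranspose_apply, emb_star]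
  rfl

variable {φ : E →+* ℂ} {H : Matrix (Fin 3) (Fin 3) (𝓞 E)}

lemma isHermitian_of_sig (hsig : HasSignatureTwoOne (conjugate φ H)) : Hᴴ = H := by
  apply conjugate_injective φ
  rw [conjugate_conjTranspose]
  exact hsig.isHermitian

lemma mat_mul_mul (g : SUInt φ H) : mat g * H * (mat g)ᴴ = H := by
  apply conjugate_injective φ
  rw [conjugate_mul, conjugate_mul, conjugate_conjTranspose]
  exact conjugate_mat_mul g

lemma mem_of_mat_mul_mul {A : Matrix (Fin 3) (Fin 3) (𝓞 E)} (hA : A * H * Aᴴ = H) :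
    conjugate φ A * conjugate φ H * (conjugate φ A)ᴴ = conjugate φ H := by
  rw [← conjugate_conjTranspose, ← conjugate_mul, ← conjugate_mul, hA]

/-- The value of the Hermitian form on integral vectors, as an element of the ring of integers. -/
noncomputable def intHerm (H : Matrix (Fin 3) (Fin 3) (𝓞 E)) (v w : Fin 3 → 𝓞 E) : 𝓞 E :=
  (v ᵥ* H) ⬝ᵥ star w

lemma emb_intHerm (ν : E →+* ℂ) (v w : Fin 3 → 𝓞 E) :
    ν (intHerm H v w : E) = herm (conjugate ν H) (vecEmb ν v) (vecEmb ν w) := by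
  unfold herm
  rw [← vecEmb_vecMul]
  simp [intHerm, dotProduct, vecEmb, emb_star]

/-- The form `H` has signature `(2,1)` at the embedding `φ` and is definite at all embeddings other
than `φ` and its complex conjugate. -/
structure IsAdmissible (φ : E →+* ℂ) (H : Matrix (Fin 3) (Fin 3) (𝓞 E)) : Prop where
  sig : HasSignatureTwoOne (conjugate φ H)
  posDef : ∀ ν : E →+* ℂ, ν ≠ φ → ν ≠ ComplexEmbedding.conjugate φ → (conjugate ν H).PosDef

lemma herm_conjugate_conjugate (v w : Fin 3 → 𝓞 E) :
    herm (conjugate (ComplexEmbedding.conjugate φ) H) (vecEmb (ComplexEmbedding.conjugate φ) v)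
      (vecEmb (ComplexEmbedding.conjugate φ) w) =
      star (herm (conjugate φ H) (vecEmb φ v) (vecEmb φ w)) := by
  rw [← emb_intHerm, ← emb_intHerm]
  rfl

/-- The majorant of the form at an embedding: the majorant attached to `x` at `φ`, the form itself
where it is definite. It is zero by convention at the complex conjugate of `φ`, where the values are
those at `φ`. -/
noncomputable def majorantAt (φ : E →+* ℂ) (H : Matrix (Fin 3) (Fin 3) (𝓞 E)) (x : Fin 3 → ℂ)
    (ν : E →+* ℂ) (v : Fin 3 → 𝓞 E) : ℝ :=
  open Classical in
  if ν = φ ∨ ν = ComplexEmbedding.conjugate φ then majorant (conjugate φ H) x (vecEmb φ v)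
  else (herm (conjugate ν H) (vecEmb ν v) (vecEmb ν v)).re

lemma norm_emb_intHerm_le (hH : IsAdmissible φ H) {x : Fin 3 → ℂ} (hx : x ∈ negCone (conjugate φ H))
    (ν : E →+* ℂ) (v w : Fin 3 → 𝓞 E) :
    ‖ν (intHerm H v w : E)‖ ≤ majorantAt φ H x ν v + majorantAt φ H x ν w := by
  unfold majorantAt
  split_ifs with h
  · have h1 : ‖ν (intHerm H v w : E)‖ = ‖herm (conjugate φ H) (vecEmb φ v) (vecEmb φ w)‖ := by
      rcases h with rfl | rfl
      · rw [emb_intHerm]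
      · rw [emb_intHerm, herm_conjugate_conjugate, norm_star]
    rw [h1]
    exact norm_herm_le_majorant hH.sig hx _ _
  · push Not at h
    rw [emb_intHerm]
    exact norm_herm_le_of_posDef (hH.posDef ν h.1 h.2) _ _

lemma norm_emb_intHerm_self_le (hH : IsAdmissible φ H) {x : Fin 3 → ℂ}
    (hx : x ∈ negCone (conjugate φ H)) (ν : E →+* ℂ) (v : Fin 3 → 𝓞 E) :
    ‖ν (intHerm H v v : E)‖ ≤ majorantAt φ H x ν v := by
  unfold majorantAt
  split_ifs with h
  · have h1 : ‖ν (intHerm H v v : E)‖ = ‖herm (conjugate φ H) (vecEmb φ v) (vecEmb φ v)‖ := by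
      rcases h with rfl | rfl
      · rw [emb_intHerm]
      · rw [emb_intHerm, herm_conjugate_conjugate, norm_star]
    rw [h1, norm_herm_self hH.sig.isHermitian]
    exact abs_herm_le_majorant hH.sig hx _
  · push Not at h
    have hpd := hH.posDef ν h.1 h.2
    rw [emb_intHerm, norm_herm_self hpd.isHermitian, abs_of_nonneg]
    by_cases hv : vecEmb ν v = 0
    · simp [hv, herm]
    · exact (herm_self_pos_of_posDef hpd hv).le

lemma intHerm_vecMul (g : SUInt φ H) (v w : Fin 3 → 𝓞 E) :
    intHerm H (v ᵥ* mat g) (w ᵥ* mat g) = intHerm H v w := by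
  unfold intHerm
  rw [Matrix.star_vecMul, Matrix.dotProduct_mulVec, Matrix.vecMul_vecMul, Matrix.vecMul_vecMul,
    ← Matrix.mul_assoc, mat_mul_mul g]

lemma majorantAt_vecMul (g : SUInt φ H) (x : Fin 3 → ℂ) (ν : E →+* ℂ) (v : Fin 3 → 𝓞 E) :
    majorantAt φ H (x ᵥ* conjugate φ (mat g)) ν (v ᵥ* mat g) = majorantAt φ H x ν v := by
  unfold majorantAt
  split_ifs with h
  · rw [vecEmb_vecMul]
    exact majorant_vecMul (SUInt.toSU φ H g) x _
  · rw [← emb_intHerm, ← emb_intHerm, intHerm_vecMul]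

/-- The negative vectors `y` with `‖y‖² < C |h(y,y)|`; they represent a bounded part of the complex
hyperbolic plane. -/
def boundedCone (M : Matrix (Fin 3) (Fin 3) ℂ) (C : ℝ) : Set (Fin 3 → ℂ) :=
  {y | y ∈ negCone M ∧ ‖y‖ ^ 2 < C * -(herm M y y).re}

lemma exists_majorant_le (M : Matrix (Fin 3) (Fin 3) ℂ) (C : ℝ) (v : Fin 3 → ℂ) :
    ∃ K : ℝ, ∀ y ∈ boundedCone M C, majorant M y v ≤ K := by
  obtain ⟨K, hK, hKle⟩ := exists_norm_herm_le M
  refine ⟨(herm M v v).re + 2 * (K * ‖v‖) ^ 2 * C, fun y hy => ?_⟩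
  have hneg : 0 < -(herm M y y).re := neg_pos.mpr hy.1
  unfold majorant
  gcongr
  rw [div_le_iff₀ hneg]
  calc 2 * ‖herm M v y‖ ^ 2 ≤ 2 * (K * ‖v‖ * ‖y‖) ^ 2 := by gcongr; exact hKle v y
    _ = 2 * (K * ‖v‖) ^ 2 * ‖y‖ ^ 2 := by ring
    _ ≤ 2 * (K * ‖v‖) ^ 2 * (C * -(herm M y y).re) := by gcongr; exact hy.2.le
    _ = _ := by ring

/-- Proper discontinuity: only finitely many elements of `SU(H, R_E)` move a point of a bounded set
into the same set. The entries of `g H` are algebraic integers, bounded at all embeddings: at `φ`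
through the majorants, and elsewhere because `g` preserves a definite form. -/
lemma finite_setOf_boundedCone (hH : IsAdmissible φ H) (C : ℝ) :
    {g : SUInt φ H | ∃ y ∈ boundedCone (conjugate φ H) C,
      y ᵥ* conjugate φ (mat g) ∈ boundedCone (conjugate φ H) C}.Finite := by
  classical
  choose K hK using fun i : Fin 3 =>
    exists_majorant_le (conjugate φ H) C (vecEmb φ (Pi.single i (1 : 𝓞 E)))
  let b : (E →+* ℂ) → Fin 3 → ℝ := fun ν i =>
    if ν = φ ∨ ν = ComplexEmbedding.conjugate φ then K i
    else majorantAt φ H 0 ν (Pi.single i 1)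
  have hb : ∀ y ∈ boundedCone (conjugate φ H) C, ∀ ν i,
      majorantAt φ H y ν (Pi.single i 1) ≤ b ν i := by
    intro y hy ν i
    simp only [b, majorantAt]
    split_ifs with h
    · exact hK i y hy
    · exact le_rfl
  let B : ℝ := ∑ ν, ∑ i, ∑ j, |b ν i + b ν j|
  have hB : ∀ ν i j, b ν i + b ν j ≤ B := by
    intro ν i j
    calc b ν i + b ν j ≤ |b ν i + b ν j| := le_abs_self _
      _ ≤ ∑ j, |b ν i + b ν j| :=
        Finset.single_le_sum (f := fun j => |b ν i + b ν j|) (fun _ _ => abs_nonneg _)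
          (Finset.mem_univ j)
      _ ≤ ∑ i, ∑ j, |b ν i + b ν j| :=
        Finset.single_le_sum (f := fun i => ∑ j, |b ν i + b ν j|)
          (fun _ _ => Finset.sum_nonneg fun _ _ => abs_nonneg _) (Finset.mem_univ i)
      _ ≤ B :=
        Finset.single_le_sum (f := fun ν => ∑ i, ∑ j, |b ν i + b ν j|)
          (fun _ _ => Finset.sum_nonneg fun _ _ => Finset.sum_nonneg fun _ _ => abs_nonneg _)
          (Finset.mem_univ ν)
  refine Set.Finite.of_finite_image (f := fun g : SUInt φ H => mat g * H)
    ((finite_setOf_matrix_norm_le (E := E) B).subset ?_) ?_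
  · rintro _ ⟨g, ⟨y, hy, hyg⟩, rfl⟩ ν i j
    have h1 : (mat g * H) i j = intHerm H (Pi.single i 1 ᵥ* mat g) (Pi.single j 1) := by
      have h0 : star (Pi.single j 1 : Fin 3 → 𝓞 E) = Pi.single j 1 := by
        rw [← Pi.single_star, star_one]
      rw [intHerm, h0, Matrix.vecMul_vecMul, dotProduct_single_one, Matrix.single_one_vecMul]
      rfl
    change ‖ν (((mat g * H) i j : 𝓞 E) : E)‖ ≤ B
    rw [h1]
    refine (norm_emb_intHerm_le hH (vecMul_mem_negCone g hy.1) ν _ _).trans ?_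
    rw [majorantAt_vecMul]
    exact (add_le_add (hb y hy ν i) (hb _ hyg ν j)).trans (hB ν i j)
  · intro g _ g' _ hgg
    apply mat_injective
    have hdet : H.det ≠ 0 := by
      intro h
      apply hH.sig.det_ne_zero
      rw [det_conjugate, h]
      simp
    have h2 : (mat g - mat g') * H = 0 := by
      rw [Matrix.sub_mul, sub_eq_zero]
      exact hgg
    have h3 : H.det • (mat g - mat g') = 0 := by
      have := congrArg (· * H.adjugate) h2
      simpa [Matrix.mul_assoc, Matrix.mul_adjugate] using this
    exact sub_eq_zero.mp ((smul_eq_zero.mp h3).resolve_left hdet)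

lemma exists_mem_boundedCone {M : Matrix (Fin 3) (Fin 3) ℂ} (hM : HasSignatureTwoOne M)
    {x : Fin 3 → ℂ} (hx : x ∈ negCone M) (R : ℝ) :
    ∃ C : ℝ, ∀ y ∈ negCone M, ‖herm M x y‖ ^ 2 ≤ R * ((herm M x x).re * (herm M y y).re) →
      y ∈ boundedCone M C := by
  obtain ⟨K, hK, hKle⟩ := exists_norm_sq_le_of_posDef (majorantMatrix_posDef hM hx)
  refine ⟨K * (|2 * R| + 1), fun y hy hxy => ⟨hy, ?_⟩⟩
  have hx' : 0 < -(herm M x x).re := neg_pos.mpr hx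
  have hy' : 0 < -(herm M y y).re := neg_pos.mpr hy
  refine (hKle y).trans_lt ?_
  rw [herm_majorantMatrix, Complex.add_re, Complex.ofReal_re, mul_assoc]
  gcongr
  have h1 : 2 * ‖herm M y x‖ ^ 2 / -(herm M x x).re ≤ 2 * R * -(herm M y y).re := by
    rw [div_le_iff₀ hx', norm_herm_comm hM.isHermitian]
    linarith
  have h2 : 2 * R * -(herm M y y).re ≤ |2 * R| * -(herm M y y).re := by
    gcongr
    exact le_abs_self _
  linarith

end CM

section Reduction

variable {k E : Type*} [Field k] [Field E] [NumberField E] [Algebra k E]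
  [IsTotallyReal k] [IsTotallyComplex E] [Algebra.IsQuadraticExtension k E]

/-- Two embeddings of a CM field that agree on the totally real subfield are equal or complex
conjugate to each other. -/
lemma eq_or_eq_conjugate [IsCMField E] {ν φ : E →+* ℂ}
    (h : ν.comp (algebraMap k E) = φ.comp (algebraMap k E)) :
    ν = φ ∨ ν = ComplexEmbedding.conjugate φ := by
  have h1 : InfinitePlace.mk φ = InfinitePlace.mk ν := by
    apply (IsCMField.equivInfinitePlace E).injective
    ext x
    obtain ⟨y, hy⟩ := (CMExtension.equivMaximalRealSubfield k E).surjective x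
    have h2 : (x : E) = algebraMap k E y := by rw [← hy]; rfl
    have h3 : ν (x : E) = φ (x : E) := by
      rw [h2]; exact RingHom.congr_fun h y
    change ‖φ (x : E)‖ = ‖ν (x : E)‖
    rw [h3]
  rcases InfinitePlace.mk_eq_iff.mp h1 with h2 | h2
  · exact Or.inl h2.symm
  · exact Or.inr h2.symm

lemma isAdmissible_of_forall [IsCMField E] {φ : E →+* ℂ} {H : Matrix (Fin 3) (Fin 3) (𝓞 E)}
    (hsig : HasSignatureTwoOne (conjugate φ H))
    (hdef : ∀ ν : E →+* ℂ, ν.comp (algebraMap k E) ≠ φ.comp (algebraMap k E) →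
      HasSignatureThreeZero (conjugate ν H)) : IsAdmissible φ H where
  sig := hsig
  posDef ν h1 h2 := hdef ν fun h => (eq_or_eq_conjugate h).elim h1 h2

end Reduction

end CHyp

/-! ### Regular matrices and their fixed points -/

namespace CHyp

open scoped ComplexOrder
open NumberField

section Regular

/-- The characteristic polynomial of a `3 × 3` matrix, as a cubic. -/
noncomputable def charCubic {S : Type*} [CommRing S] (A : Matrix (Fin 3) (Fin 3) S) : Cubic S :=
  ⟨1, A.charpoly.coeff 2, A.charpoly.coeff 1, A.charpoly.coeff 0⟩

lemma charCubic_toPoly {S : Type*} [CommRing S] [Nontrivial S] (A : Matrix (Fin 3) (Fin 3) S) :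
    (charCubic A).toPoly = A.charpoly := by
  have hdeg : A.charpoly.natDegree = 3 := by simp [Matrix.charpoly_natDegree_eq_dim]
  have hlead : A.charpoly.coeff 3 = 1 := by
    have := A.charpoly_monic
    rwa [Polynomial.Monic, Polynomial.leadingCoeff, hdeg] at this
  ext n
  match n with
  | 0 => rw [Cubic.coeff_eq_d]; rfl
  | 1 => rw [Cubic.coeff_eq_c]; rfl
  | 2 => rw [Cubic.coeff_eq_b]; rfl
  | 3 => rw [Cubic.coeff_eq_a, hlead]; rfl
  | n + 4 =>
    rw [Cubic.coeff_eq_zero (by omega), Polynomial.coeff_eq_zero_of_natDegree_lt (by omega)]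

lemma map_discr_charCubic {S T : Type*} [CommRing S] [CommRing T] (f : S →+* T)
    (A : Matrix (Fin 3) (Fin 3) S) :
    f (charCubic A).discr = (charCubic (f.mapMatrix A)).discr := by
  have h : charCubic (f.mapMatrix A) = (charCubic A).map f := by
    simp [charCubic, Cubic.map, Matrix.charpoly_map, Polynomial.coeff_map]
  rw [h]
  simp only [Cubic.discr, Cubic.map, map_sub, map_add, map_mul, map_pow, map_ofNat]

lemma charpoly_roots_nodup_iff (A : Matrix (Fin 3) (Fin 3) ℂ) :
    A.charpoly.roots.Nodup ↔ (charCubic A).discr ≠ 0 := by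
  have h := Cubic.discr_ne_zero_iff_roots_nodup (φ := RingHom.id ℂ) (P := charCubic A)
    one_ne_zero (IsAlgClosed.splits _)
  rw [Cubic.map_roots, Polynomial.map_id, charCubic_toPoly] at h
  exact h.symm

lemma ncard_eigenvalues_eq_three_iff (A : Matrix (Fin 3) (Fin 3) ℂ) :
    {c : ℂ | Module.End.HasEigenvalue (Matrix.toLin' A) c}.ncard = 3 ↔
      A.charpoly.roots.Nodup := by
  classical
  have h1 : {c : ℂ | Module.End.HasEigenvalue (Matrix.toLin' A) c} =
      (A.charpoly.roots.toFinset : Set ℂ) := by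
    ext c
    rw [Set.mem_ofPred_eq, Module.End.hasEigenvalue_iff_isRoot_charpoly, Matrix.charpoly_toLin']
    simp [Polynomial.mem_roots A.charpoly_monic.ne_zero]
  have h2 : Multiset.card A.charpoly.roots = 3 := by
    have := (IsAlgClosed.splits A.charpoly).natDegree_eq_card_roots
    rw [← this]
    simp [Matrix.charpoly_natDegree_eq_dim]
  rw [h1, Set.ncard_coe_finset, Multiset.toFinset_card_eq_card_iff_nodup.symm.trans (by rw [h2])]

/-- The eigenspaces of a matrix with distinct eigenvalues are lines. -/
lemma eigenvector_unique {A : Matrix (Fin 3) (Fin 3) ℂ} (hA : A.charpoly.roots.Nodup) {c : ℂ}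
    {v w : Fin 3 → ℂ} (hv : v ≠ 0) (hvA : v ᵥ* A = c • v) (hwA : w ᵥ* A = c • w) :
    ∃ a : ℂ, w = a • v := by
  classical
  have h1 := LinearMap.finrank_eigenspace_le (Matrix.toLin' Aᵀ) c
  rw [Matrix.charpoly_toLin', Matrix.charpoly_transpose, ← Polynomial.count_roots] at h1
  have h2 := h1.trans (Multiset.nodup_iff_count_le_one.mp hA c)
  have hv' : v ∈ Module.End.eigenspace (Matrix.toLin' Aᵀ) c := by
    rw [Module.End.mem_eigenspace_iff, Matrix.toLin'_apply, Matrix.mulVec_transpose, hvA]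
  have hw' : w ∈ Module.End.eigenspace (Matrix.toLin' Aᵀ) c := by
    rw [Module.End.mem_eigenspace_iff, Matrix.toLin'_apply, Matrix.mulVec_transpose, hwA]
  have h3 := (finrank_le_one_iff (K := ℂ)
    (V := Module.End.eigenspace (Matrix.toLin' Aᵀ) c)).mp h2
  obtain ⟨u, hu⟩ := h3
  obtain ⟨a, ha⟩ := hu ⟨v, hv'⟩
  obtain ⟨b, hb⟩ := hu ⟨w, hw'⟩
  have ha' : a • (u : Fin 3 → ℂ) = v := congrArg Subtype.val ha
  have hb' : b • (u : Fin 3 → ℂ) = w := congrArg Subtype.val hb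
  have ha0 : a ≠ 0 := by
    rintro rfl
    rw [zero_smul] at ha'
    exact hv ha'.symm
  refine ⟨b / a, ?_⟩
  rw [← ha', ← hb', smul_smul, div_mul_cancel₀ _ ha0]

end Regular

section Points

variable {M : Matrix (Fin 3) (Fin 3) ℂ}

lemma rep_neg (x : H2 M) : (herm M x.line.rep x.line.rep).re < 0 := x.isNegative

lemma H2.eq_of_smul {x y : H2 M} {a : ℂ} (h : y.line.rep = a • x.line.rep) : x = y := by
  apply H2.ext
  rw [← Projectivization.mk_rep x.line, ← Projectivization.mk_rep y.line,
    Projectivization.mk_eq_mk_iff']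
  have ha : a ≠ 0 := by
    rintro rfl
    rw [zero_smul] at h
    exact y.line.rep_nonzero h
  exact ⟨a⁻¹, by rw [h, smul_smul, inv_mul_cancel₀ ha, one_smul]⟩

lemma one_lt_of_ne (hM : HasSignatureTwoOne M) {x y : H2 M} (hxy : x ≠ y) :
    1 < ‖herm M x.line.rep y.line.rep‖ /
      √((herm M x.line.rep x.line.rep).re * (herm M y.line.rep y.line.rep).re) := by
  have h1 := hM.reverse_cauchySchwarz (rep_neg y) (v := x.line.rep)
    (fun a h => hxy (H2.eq_of_smul h).symm)
  have h2 := mul_pos_of_neg_of_neg (rep_neg x) (rep_neg y)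
  rw [one_lt_div (Real.sqrt_pos.mpr h2), Real.sqrt_lt' (lt_of_le_of_ne (norm_nonneg _) ?_)]
  · exact h1
  · intro h
    rw [← h] at h1
    nlinarith

lemma hdist_pos (hM : HasSignatureTwoOne M) {x y : H2 M} (hxy : x ≠ y) : 0 < hdist x y := by
  unfold hdist
  have := Real.arcosh_pos (one_lt_of_ne hM hxy)
  linarith

lemma norm_herm_sq_le_of_hdist_lt_one (hM : HasSignatureTwoOne M) {x y : H2 M}
    (hxy : hdist x y < 1) : ‖herm M x.line.rep y.line.rep‖ ^ 2 ≤
      Real.cosh 1 ^ 2 * ((herm M x.line.rep x.line.rep).re * (herm M y.line.rep y.line.rep).re) := by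
  by_cases h : x = y
  · subst h
    have h1 : 1 ≤ Real.cosh 1 ^ 2 := one_le_pow₀ (Real.one_le_cosh 1)
    have h2 := mul_pos_of_neg_of_neg (rep_neg x) (rep_neg x)
    rw [norm_herm_self hM.isHermitian, sq_abs]
    nlinarith
  · have h1 := one_lt_of_ne hM h
    have h2 := mul_pos_of_neg_of_neg (rep_neg x) (rep_neg y)
    set r := ‖herm M x.line.rep y.line.rep‖ /
      √((herm M x.line.rep x.line.rep).re * (herm M y.line.rep y.line.rep).re) with hr
    have h3 : Real.arcosh r ≤ 1 := by
      have h4 : hdist x y = 2 * Real.arcosh r := rfl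
      linarith
    have h5 : r ≤ Real.cosh 1 := by
      rw [← Real.cosh_arcosh h1.le, Real.cosh_le_cosh, abs_of_nonneg (Real.arcosh_nonneg h1.le),
        abs_one]
      exact h3
    have h6 : ‖herm M x.line.rep y.line.rep‖ ≤ Real.cosh 1 *
        √((herm M x.line.rep x.line.rep).re * (herm M y.line.rep y.line.rep).re) := by
      rwa [hr, div_le_iff₀ (Real.sqrt_pos.mpr h2)] at h5
    calc _ ≤ (Real.cosh 1 *
        √((herm M x.line.rep x.line.rep).re * (herm M y.line.rep y.line.rep).re)) ^ 2 := by gcongr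
      _ = _ := by rw [mul_pow, Real.sq_sqrt h2.le]

/-- A point fixed by `g` is spanned by an eigenvector, with nonzero eigenvalue. -/
lemma exists_eigenvalue_of_smul_eq {g : SU M} {x : H2 M} (hx : g • x = x) :
    ∃ c : ℂ, c ≠ 0 ∧
      x.line.rep ᵥ* ((g : Matrix.SpecialLinearGroup (Fin 3) ℂ) : Matrix (Fin 3) (Fin 3) ℂ) =
        c • x.line.rep := by
  have h1 : lineMap g.1 x.line = x.line := congrArg H2.line hx
  have hne := x.line.rep_nonzero
  rw [← Projectivization.mk_rep x.line, lineMap_mk, Projectivization.mk_eq_mk_iff'] at h1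
  obtain ⟨a, ha⟩ := h1
  have ha0 : a ≠ 0 := by
    rintro rfl
    rw [zero_smul] at ha
    exact vecMul_inv_ne_zero g.1 hne ha.symm
  refine ⟨a⁻¹, inv_ne_zero ha0, ?_⟩
  have h2 := congrArg
    (· ᵥ* ((g : Matrix.SpecialLinearGroup (Fin 3) ℂ) : Matrix (Fin 3) (Fin 3) ℂ)) ha
  simp only [Matrix.vecMul_vecMul, coe_inv_mul, Matrix.vecMul_one, Matrix.smul_vecMul] at h2
  rw [eq_inv_smul_iff₀ ha0]
  exact h2

/-- An isometry with distinct eigenvalues fixes at most one point: eigenvectors for different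
eigenvalues are orthogonal, and negative vectors are not. -/
lemma fixedPoint_unique (hM : HasSignatureTwoOne M) {g : SU M}
    (hg : ((g : Matrix.SpecialLinearGroup (Fin 3) ℂ) :
      Matrix (Fin 3) (Fin 3) ℂ).charpoly.roots.Nodup)
    {x y : H2 M} (hx : g • x = x) (hy : g • y = y) : x = y := by
  obtain ⟨c, hc, hcx⟩ := exists_eigenvalue_of_smul_eq hx
  obtain ⟨d, hd, hdy⟩ := exists_eigenvalue_of_smul_eq hy
  by_cases hcd : c = d
  · subst hcd
    obtain ⟨a, ha⟩ := eigenvector_unique hg x.line.rep_nonzero hcx hdy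
    exact H2.eq_of_smul ha
  · exfalso
    have h1 := herm_vecMul g x.line.rep y.line.rep
    have h2 := herm_vecMul g y.line.rep y.line.rep
    rw [hcx, hdy, herm_smul] at h1
    rw [hdy, herm_smul] at h2
    have hyn := rep_neg y
    have hy0 : herm M y.line.rep y.line.rep ≠ 0 := by
      intro h
      have : (herm M y.line.rep y.line.rep).re < 0 := hyn
      rw [h] at this
      simp at this
    have h3 : d * star d = 1 := mul_right_cancel₀ hy0 (by rw [h2, one_mul])
    have h4 : (c * star d - 1) * herm M x.line.rep y.line.rep = 0 := by linear_combination h1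
    rcases mul_eq_zero.mp h4 with h5 | h5
    · apply hcd
      have hsd : star d ≠ 0 := star_ne_zero.mpr hd
      apply mul_right_cancel₀ hsd
      rw [h3]
      linear_combination h5
    · have := hM.pos_of_orthogonal hyn h5 x.line.rep_nonzero
      exact absurd this (not_lt.mpr (le_of_lt (rep_neg x)))

end Points

/-! ### The action on the quotient -/

section Action

lemma exists_pos_le_of_finite {α : Type*} {s : Set α} (hs : s.Finite) (f : α → ℝ)
    (hf : ∀ x ∈ s, 0 < f x) : ∃ ε : ℝ, 0 < ε ∧ ε ≤ 1 ∧ ∀ x ∈ s, ε ≤ f x := by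
  induction s, hs using Set.Finite.induction_on with
  | empty => exact ⟨1, one_pos, le_rfl, by simp⟩
  | @insert a s _ _ ih =>
    obtain ⟨ε, h0, h1, h2⟩ := ih fun x hx => hf x (Set.mem_insert_of_mem _ hx)
    refine ⟨min ε (f a), lt_min h0 (hf a (Set.mem_insert _ _)), (min_le_left _ _).trans h1, ?_⟩
    intro x hx
    rcases hx with rfl | hx
    · exact min_le_right _ _
    · exact (min_le_left _ _).trans (h2 x hx)

variable {E : Type*} [Field E] {φ : E →+* ℂ} {H : Matrix (Fin 3) (Fin 3) (𝓞 E)}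

lemma proj_eq_iff {N : Subgroup (SUInt φ H)} {x y : H2 (conjugate φ H)} :
    proj N x = proj N y ↔ ∃ n ∈ N, n • y = x := by
  unfold proj
  rw [Quotient.eq, MulAction.orbitRel_apply, MulAction.mem_orbit_iff]
  exact ⟨fun ⟨n, hn⟩ => ⟨n, n.2, hn⟩, fun ⟨n, hn, h⟩ => ⟨⟨n, hn⟩, h⟩⟩

lemma hdist_smul_int (g : SUInt φ H) (x y : H2 (conjugate φ H)) :
    hdist (g • x) (g • y) = hdist x y := hdist_smul (SUInt.toSU φ H g) x y

/-- The normalizer of `N` acts on the quotient by `N`. -/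
@[reducible]
noncomputable def normalizerAction (N : Subgroup (SUInt φ H)) :
    MulAction (Subgroup.normalizer (N : Set (SUInt φ H))) (Quot2 N) where
  smul t := Quotient.map (fun x => (t : SUInt φ H) • x) (by
    intro x y hxy
    obtain ⟨n, hn⟩ := hxy
    have ht := (Subgroup.mem_normalizer_iff.mp t.2 n).mp n.2
    refine ⟨⟨_, ht⟩, ?_⟩
    have hn' : (n : SUInt φ H) • y = x := hn
    change ((t : SUInt φ H) * n * (t : SUInt φ H)⁻¹) • (t : SUInt φ H) • y = (t : SUInt φ H) • x
    rw [← hn', smul_smul, smul_smul]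
    congr 1
    group)
  one_smul a := by
    induction a using Quotient.inductionOn with
    | h x => exact congrArg (proj N) (one_smul (SUInt φ H) x)
  mul_smul s t a := by
    induction a using Quotient.inductionOn with
    | h x => exact congrArg (proj N) (mul_smul (s : SUInt φ H) (t : SUInt φ H) x)

/-- The action of the normalizer of `N` on the quotient by `N`, as a homomorphism. -/
noncomputable def normalizerPerm (N : Subgroup (SUInt φ H)) :
    Subgroup.normalizer (N : Set (SUInt φ H)) →* Equiv.Perm (Quot2 N) :=
  letI := normalizerAction N
  MulAction.toPermHom _ _

lemma normalizerPerm_proj (N : Subgroup (SUInt φ H))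
    (t : Subgroup.normalizer (N : Set (SUInt φ H))) (x : H2 (conjugate φ H)) :
    normalizerPerm N t (proj N x) = proj N ((t : SUInt φ H) • x) := rfl

variable [NumberField E] [IsCMField E]

/-- The points near `x₀` fixed by some regular element of the coset `N τ` form a finite set, since
each of these elements fixes one point and only finitely many of them fix a point near `x₀`. -/
lemma exists_isolating_radius (hH : IsAdmissible φ H) {P : Set (SUInt φ H)}
    (hP : ∀ g ∈ P, (conjugate φ (mat g)).charpoly.roots.Nodup) (x₀ : H2 (conjugate φ H)) :
    ∃ ε : ℝ, 0 < ε ∧ ∀ y, hdist x₀ y < ε → (∃ g ∈ P, g • y = y) → y = x₀ := by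
  obtain ⟨C, hC⟩ := exists_mem_boundedCone hH.sig (rep_neg x₀) (Real.cosh 1 ^ 2)
  set F := {g : SUInt φ H | ∃ y ∈ boundedCone (conjugate φ H) C,
      y ᵥ* conjugate φ (mat g) ∈ boundedCone (conjugate φ H) C} with hF
  have hFfin : F.Finite := finite_setOf_boundedCone hH C
  let Y : Set (H2 (conjugate φ H)) := ⋃ g ∈ F ∩ P, {y | g • y = y ∧ y ≠ x₀}
  have hY : Y.Finite := by
    refine Set.Finite.biUnion (hFfin.inter_of_left _) fun g hg => Set.Subsingleton.finite ?_
    intro x hx y hy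
    exact fixedPoint_unique hH.sig (g := SUInt.toSU φ H g) (hP g hg.2) hx.1 hy.1
  obtain ⟨ε, h0, h1, h2⟩ := exists_pos_le_of_finite hY (fun y => hdist x₀ y) (by
    intro y hy
    simp only [Y, Set.mem_iUnion] at hy
    obtain ⟨g, _, hy⟩ := hy
    exact hdist_pos hH.sig (Ne.symm hy.2))
  refine ⟨ε, h0, fun y hy ⟨g, hgP, hgy⟩ => ?_⟩
  by_contra hne
  have h3 := norm_herm_sq_le_of_hdist_lt_one hH.sig (hy.trans_le h1)
  have h4 := hC _ (rep_neg y) h3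
  have h5 : g ∈ F := by
    obtain ⟨c, hc, hcy⟩ := exists_eigenvalue_of_smul_eq (g := SUInt.toSU φ H g) hgy
    refine ⟨y.line.rep, h4, ?_⟩
    have h6 : herm (conjugate φ H) (c • y.line.rep) (c • y.line.rep) =
        herm (conjugate φ H) y.line.rep y.line.rep := by
      rw [← hcy, herm_vecMul]
    have h7 : ‖c‖ = 1 := by
      have h8 := congrArg Complex.re h6
      rw [herm_smul_self, Complex.normSq_eq_norm_sq] at h8
      have h9 : (herm (conjugate φ H) y.line.rep y.line.rep).re < 0 := rep_neg y
      have h10 : ‖c‖ ^ 2 = 1 := mul_right_cancel₀ h9.ne (by rw [h8, one_mul])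
      exact (pow_eq_one_iff_of_nonneg (norm_nonneg c) two_ne_zero).mp h10
    have h8 : y.line.rep ᵥ* conjugate φ (mat g) = c • y.line.rep := hcy
    rw [h8]
    constructor
    · change (herm _ _ _).re < 0
      rw [h6]
      exact h4.1
    · rw [norm_smul, h7, one_mul, h6]
      exact h4.2
  have h6 : y ∈ Y := by
    simp only [Y, Set.mem_iUnion]
    exact ⟨g, ⟨h5, hgP⟩, hgy, hne⟩
  exact absurd hy (not_lt.mpr (h2 y h6))

/-- An elliptic element `τ` of prime order that normalizes `N` acts on the quotient by `N` with
isolated fixed points, as soon as all elements of the coset `N τ` have distinct eigenvalues. -/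
theorem admitsAction_of_normalizes (hH : IsAdmissible φ H) {N : Subgroup (SUInt φ H)} {p : ℕ}
    (hp : p.Prime) {τ : SUInt φ H} (hτN : τ ∈ Subgroup.normalizer (N : Set (SUInt φ H)))
    (hτp : τ ^ p = 1) (hell : IsElliptic (SUInt.toSU φ H τ))
    (hreg : ∀ n ∈ N, (conjugate φ (mat (n * τ))).charpoly.roots.Nodup) : AdmitsAction p N := by
  let t : Subgroup.normalizer (N : Set (SUInt φ H)) := ⟨τ, hτN⟩
  have ht : t ^ p = 1 := Subtype.ext hτp
  set σ := normalizerPerm N t with hσ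
  have hσp : σ ^ p = 1 := by rw [hσ, ← map_pow, ht, map_one]
  let f : {f : ℤ →+ Additive (Equiv.Perm (Quot2 N)) // f p = 0} :=
    ⟨zmultiplesHom _ (Additive.ofMul σ), by
      rw [zmultiplesHom_apply, natCast_zsmul, ← ofMul_pow, hσp, ofMul_one]⟩
  let ρ : Multiplicative (ZMod p) →* Equiv.Perm (Quot2 N) :=
    AddMonoidHom.toMultiplicativeLeft (ZMod.lift p f)
  have hρ : ∀ m : ℤ, ρ (Multiplicative.ofAdd (m : ZMod p)) = σ ^ m := by
    intro m
    change ((ZMod.lift p f) (m : ZMod p)).toMul = σ ^ m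
    rw [ZMod.lift_coe]
    rfl
  have hsurj : ∀ g : Multiplicative (ZMod p), ∃ m : ℤ, g = Multiplicative.ofAdd (m : ZMod p) := by
    intro g
    obtain ⟨m, hm⟩ := ZMod.intCast_surjective (Multiplicative.toAdd g)
    exact ⟨m, by rw [hm]; rfl⟩
  have hfix : ∀ g : Multiplicative (ZMod p), g ≠ 1 → ∀ a, ρ g a = a → σ a = a := by
    intro g hg a ha
    obtain ⟨m, rfl⟩ := hsurj g
    rw [hρ] at ha
    have hm : ¬ (p : ℤ) ∣ m := by
      intro h
      apply hg
      rw [(ZMod.intCast_zmod_eq_zero_iff_dvd m p).mpr h]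
      rfl
    have hco : IsCoprime (p : ℤ) m :=
      (Prime.coprime_iff_not_dvd (Nat.prime_iff_prime_int.mp hp)).mpr hm
    obtain ⟨u, v, huv⟩ := hco
    have h1 : σ ^ m ∈ MulAction.stabilizer (Equiv.Perm (Quot2 N)) a := ha
    have h2 : σ = (σ ^ m) ^ v := by
      conv_lhs => rw [← zpow_one σ, ← huv, zpow_add, mul_comm u, zpow_mul, zpow_natCast, hσp,
        one_zpow, one_mul, mul_comm, zpow_mul]
    have h3 : σ ∈ MulAction.stabilizer (Equiv.Perm (Quot2 N)) a := by
      rw [h2]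
      exact Subgroup.zpow_mem _ h1 v
    exact h3
  refine ⟨ρ, fun g => ?_, ?_, fun g hg a ha => ?_⟩
  · obtain ⟨m, rfl⟩ := hsurj g
    refine ⟨MulAction.toPerm (τ ^ m), fun x y => hdist_smul_int _ x y, fun x => ?_⟩
    rw [hρ, hσ, ← map_zpow, normalizerPerm_proj]
    rfl
  · obtain ⟨x, hx⟩ := hell
    refine ⟨Multiplicative.ofAdd ((1 : ℤ) : ZMod p), ?_, proj N x, ?_⟩
    · have := Fact.mk hp
      intro h
      have h1 : ((1 : ℤ) : ZMod p) = 0 := h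
      rw [Int.cast_one] at h1
      exact one_ne_zero h1
    · rw [hρ, zpow_one, hσ, normalizerPerm_proj]
      exact congrArg (proj N) hx
  · obtain ⟨x₀, rfl⟩ : ∃ x₀, proj N x₀ = a := Quotient.exists_rep a
    obtain ⟨ε, h0, hε⟩ := exists_isolating_radius hH (P := {g | ∃ n ∈ N, g = n * τ})
      (by rintro _ ⟨n, hn, rfl⟩; exact hreg n hn) x₀
    refine ⟨ε, h0, fun b hb hab => ?_⟩
    obtain ⟨y₀, rfl⟩ : ∃ y₀, proj N y₀ = b := Quotient.exists_rep b
    have hne : {r : ℝ | ∃ x y : H2 (conjugate φ H), proj N x = proj N x₀ ∧ proj N y = proj N y₀ ∧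
        hdist x y = r}.Nonempty := ⟨_, x₀, y₀, rfl, rfl, rfl⟩
    obtain ⟨r, ⟨x, y, hx, hy, rfl⟩, hr⟩ := exists_lt_of_csInf_lt hne hab
    obtain ⟨n, hn, rfl⟩ := proj_eq_iff.mp hx
    have hr' : hdist x₀ (n⁻¹ • y) < ε := by
      rw [← hdist_smul_int n, smul_inv_smul]
      exact hr
    have hy' : proj N (n⁻¹ • y) = proj N y₀ := by
      rw [← hy]
      exact proj_eq_iff.mpr ⟨n⁻¹, N.inv_mem hn, rfl⟩
    have h1 := hfix g hg _ hb
    rw [← hy', hσ, normalizerPerm_proj] at h1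
    obtain ⟨n', hn', h2⟩ := proj_eq_iff.mp h1.symm
    have h3 := hε (n⁻¹ • y) hr' ⟨n' * τ, ⟨n', hn', rfl⟩, by rw [mul_smul]; exact h2⟩
    rw [← hy', h3]

end Action

end CHyp

/-! ### Congruence subgroups and 3-adic estimates -/

namespace CHyp

open NumberField
open scoped commutatorElement

section Congruence

variable {E : Type*} [Field E] {φ : E →+* ℂ} {H : Matrix (Fin 3) (Fin 3) (𝓞 E)}

/-- The principal congruence subgroup of `SU(H, R_E)` of level `r`. -/
def congr (φ : E →+* ℂ) (H : Matrix (Fin 3) (Fin 3) (𝓞 E)) (r : 𝓞 E) : Subgroup (SUInt φ H) :=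
  ((Matrix.SpecialLinearGroup.map (Ideal.Quotient.mk (Ideal.span {r}))).comp
    (SUInt φ H).subtype).ker

instance (r : 𝓞 E) : (congr φ H r).Normal := by unfold congr; infer_instance

lemma mem_congr_iff {r : 𝓞 E} {g : SUInt φ H} :
    g ∈ congr φ H r ↔ ∃ B : Matrix (Fin 3) (Fin 3) (𝓞 E), mat g = 1 + r • B := by
  unfold congr
  rw [MonoidHom.mem_ker]
  constructor
  · intro h
    have h1 : ∀ i j, ∃ b, mat g i j - (1 : Matrix (Fin 3) (Fin 3) (𝓞 E)) i j = r * b := by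
      intro i j
      have h2 := congrArg (fun A : Matrix.SpecialLinearGroup (Fin 3) (𝓞 E ⧸ Ideal.span {r}) =>
        (A : Matrix (Fin 3) (Fin 3) (𝓞 E ⧸ Ideal.span {r})) i j) h
      have h3 : Ideal.Quotient.mk (Ideal.span {r}) (mat g i j) =
          Ideal.Quotient.mk (Ideal.span {r}) ((1 : Matrix (Fin 3) (Fin 3) (𝓞 E)) i j) := by
        refine Eq.trans h2 ?_
        simp only [Matrix.SpecialLinearGroup.coe_one, Matrix.one_apply]
        split_ifs <;> simp
      rw [Ideal.Quotient.eq, Ideal.mem_span_singleton] at h3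
      exact h3
    choose b hb using h1
    refine ⟨Matrix.of b, ?_⟩
    ext i j
    rw [Matrix.add_apply, Matrix.smul_apply, Matrix.of_apply, smul_eq_mul, ← hb]
    simp
  · rintro ⟨B, hB⟩
    apply Subtype.ext
    ext i j
    change Ideal.Quotient.mk (Ideal.span {r}) (mat g i j) = _
    rw [hB, Matrix.SpecialLinearGroup.coe_one, Matrix.add_apply, Matrix.smul_apply, smul_eq_mul,
      map_add, map_mul, Ideal.Quotient.eq_zero_iff_mem.mpr (Ideal.mem_span_singleton_self r),
      zero_mul, add_zero, Matrix.one_apply, Matrix.one_apply]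
    split_ifs <;> simp

lemma congr_pow_le {r : 𝓞 E} {a b : ℕ} (hab : a ≤ b) :
    congr φ H (r ^ b) ≤ congr φ H (r ^ a) := by
  intro g hg
  obtain ⟨B, hB⟩ := mem_congr_iff.mp hg
  refine mem_congr_iff.mpr ⟨r ^ (b - a) • B, ?_⟩
  rw [hB, smul_smul, ← pow_add, Nat.add_sub_cancel' hab]

lemma mat_commutator_sub (x y : SUInt φ H) :
    mat ⁅x, y⁆ = 1 + (mat x * mat y - mat y * mat x) * (mat x⁻¹ * mat y⁻¹) := by
  have h1 : mat ⁅x, y⁆ = mat x * mat y * (mat x⁻¹ * mat y⁻¹) := by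
    rw [commutatorElement_def, mat_mul, mat_mul, mat_mul, Matrix.mul_assoc (mat x * mat y)]
  have h2 : mat y * mat x * (mat x⁻¹ * mat y⁻¹) = 1 := by
    rw [← mat_mul, ← mat_mul, ← mat_mul, ← mat_one]
    congr 1
    group
  rw [Matrix.sub_mul, h2, h1]
  abel

/-- Commutators of elements of level `r` have level `r²`. -/
lemma commutator_mem_congr {r : 𝓞 E} {x y : SUInt φ H} (hx : x ∈ congr φ H r)
    (hy : y ∈ congr φ H r) : ⁅x, y⁆ ∈ congr φ H (r ^ 2) := by
  obtain ⟨X, hX⟩ := mem_congr_iff.mp hx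
  obtain ⟨Y, hY⟩ := mem_congr_iff.mp hy
  refine mem_congr_iff.mpr ⟨(X * Y - Y * X) * (mat x⁻¹ * mat y⁻¹), ?_⟩
  rw [mat_commutator_sub, ← Matrix.smul_mul]
  congr 2
  rw [hX, hY]
  simp only [Matrix.add_mul, Matrix.mul_add, Matrix.one_mul, Matrix.mul_one, Matrix.smul_mul,
    Matrix.mul_smul, smul_sub, sq, mul_smul, smul_add]
  abel

lemma commute_mod_of_commutator_mem {r : 𝓞 E} {x y : SUInt φ H} (h : ⁅x, y⁆ ∈ congr φ H r) :
    ∃ B, mat x * mat y - mat y * mat x = r • B := by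
  obtain ⟨B, hB⟩ := mem_congr_iff.mp h
  rw [mat_commutator_sub, add_right_inj] at hB
  refine ⟨B * (mat y * mat x), ?_⟩
  have h2 : mat x⁻¹ * mat y⁻¹ * (mat y * mat x) = 1 := by
    rw [← mat_mul, ← mat_mul, ← mat_mul, ← mat_one]
    congr 1
    group
  rw [← Matrix.smul_mul, ← hB, Matrix.mul_assoc, h2, Matrix.mul_one]

end Congruence

section Level

variable {E : Type*} [Field E] [NumberField E] {φ : E →+* ℂ} {H : Matrix (Fin 3) (Fin 3) (𝓞 E)}

lemma finiteIndex_congr {r : 𝓞 E} (hr : r ≠ 0) : (congr φ H r).FiniteIndex := by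
  have : Finite (𝓞 E ⧸ Ideal.span {r}) :=
    Ideal.finiteQuotientOfFreeOfNeBot _ (by rwa [ne_eq, Ideal.span_singleton_eq_bot])
  have : Finite (Matrix (Fin 3) (Fin 3) (𝓞 E ⧸ Ideal.span {r})) := by
    unfold Matrix; infer_instance
  have : Finite (Matrix.SpecialLinearGroup (Fin 3) (𝓞 E ⧸ Ideal.span {r})) := Subtype.finite
  unfold congr
  infer_instance

lemma not_isUnit_three : ¬ IsUnit (3 : 𝓞 E) := by
  intro h
  rw [NumberField.isUnit_iff_norm, RingOfIntegers.coe_norm] at h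
  have h1 : ((3 : 𝓞 E) : E) = algebraMap ℚ E 3 := by rw [map_ofNat]; rfl
  rw [h1, Algebra.norm_algebraMap] at h
  have h2 : 0 < Module.finrank ℚ E := Module.finrank_pos
  rw [abs_of_nonneg (by positivity)] at h
  have h3 : (1 : ℚ) < 3 ^ Module.finrank ℚ E := one_lt_pow₀ (by norm_num) h2.ne'
  exact absurd h h3.ne'

lemma exists_not_three_pow_dvd {x : 𝓞 E} (hx : x ≠ 0) : ∃ n : ℕ, ¬ (3 : 𝓞 E) ^ n ∣ x := by
  obtain ⟨n, hn⟩ := FiniteMultiplicity.of_not_isUnit not_isUnit_three hx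
  exact ⟨_, hn⟩

end Level

section ExactPower

variable {E : Type*} [Field E]

/-- `3ᵃ` is the exact power of `3` dividing the matrix `X`. -/
def ExactThree (a : ℕ) (X : Matrix (Fin 3) (Fin 3) (𝓞 E)) : Prop :=
  ∃ B : Matrix (Fin 3) (Fin 3) (𝓞 E), X = (3 : 𝓞 E) ^ a • B ∧ ∀ C, B ≠ (3 : 𝓞 E) • C

/-- For `w ≡ 1` modulo `3`, cubing `w` multiplies the commutator `[g, w]` by `3` up to higher
order. -/
lemma ExactThree.cube {a : ℕ} {g w W : Matrix (Fin 3) (Fin 3) (𝓞 E)} (hw : w = 1 + (3 : 𝓞 E) • W)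
    (h : ExactThree a (g * w - w * g)) : ExactThree (a + 1) (g * w ^ 3 - w ^ 3 * g) := by
  obtain ⟨B, hB, hBC⟩ := h
  have h1 : g * w ^ 3 - w ^ 3 * g =
      w * w * (g * w - w * g) + w * (g * w - w * g) * w + (g * w - w * g) * (w * w) := by
    noncomm_ring
  let K : Matrix (Fin 3) (Fin 3) (𝓞 E) := W * B + B * W + (W * W * B + W * B * W + B * (W * W))
  have h2 : w * w * B + w * B * w + B * (w * w) = (3 : 𝓞 E) • (B + (3 : 𝓞 E) • K) := by
    have e3 : ∀ A : Matrix (Fin 3) (Fin 3) (𝓞 E), (3 : 𝓞 E) • A = 3 * A := fun A => by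
      rw [← Nat.cast_ofNat (R := 𝓞 E), Nat.cast_smul_eq_nsmul, nsmul_eq_mul, Nat.cast_ofNat]
    simp only [K, hw, e3]
    noncomm_ring
  refine ⟨B + (3 : 𝓞 E) • K, ?_, fun C hC => hBC (C - K) ?_⟩
  · rw [h1, hB, pow_succ, mul_smul, ← h2]
    simp only [Matrix.mul_smul, Matrix.smul_mul, smul_add]
  · rw [smul_sub, ← hC]
    abel

lemma exists_pow_eq_one_add {w W : Matrix (Fin 3) (Fin 3) (𝓞 E)} {r : 𝓞 E} (hw : w = 1 + r • W)
    (n : ℕ) : ∃ V, w ^ n = 1 + r • V := by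
  induction n with
  | zero => exact ⟨0, by simp⟩
  | succ n ih =>
    obtain ⟨V, hV⟩ := ih
    refine ⟨W + V + V * (r • W), ?_⟩
    rw [pow_succ, hV, hw]
    simp only [Matrix.add_mul, Matrix.mul_add, Matrix.one_mul, Matrix.mul_one, Matrix.smul_mul,
      Matrix.mul_smul, smul_add]
    abel

lemma ExactThree.pow_coprime {a n : ℕ} {g w W : Matrix (Fin 3) (Fin 3) (𝓞 E)}
    (hw : w = 1 + (3 : 𝓞 E) • W) (hn : ¬ 3 ∣ n) (h : ExactThree a (g * w - w * g)) :
    ExactThree a (g * w ^ n - w ^ n * g) := by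
  obtain ⟨B, hB, hBC⟩ := h
  have h1 : ∀ n : ℕ, ∃ K, g * w ^ n - w ^ n * g =
      (3 : 𝓞 E) ^ a • ((n : 𝓞 E) • B + (3 : 𝓞 E) • K) := by
    intro n
    induction n with
    | zero => exact ⟨0, by simp⟩
    | succ n ih =>
      obtain ⟨K, hK⟩ := ih
      obtain ⟨V, hV⟩ := exists_pow_eq_one_add hw n
      refine ⟨K + ((n : 𝓞 E) • B + (3 : 𝓞 E) • K) * W + V * B, ?_⟩
      have h2 : g * w ^ (n + 1) - w ^ (n + 1) * g =
          (g * w ^ n - w ^ n * g) * w + w ^ n * (g * w - w * g) := by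
        rw [pow_succ]; noncomm_ring
      rw [h2, hK, hB, Matrix.smul_mul, Matrix.mul_smul, ← smul_add]
      congr 1
      rw [hV]
      conv_lhs => rw [hw]
      simp only [Matrix.mul_add, Matrix.add_mul, Matrix.mul_one, Matrix.one_mul, Matrix.smul_mul,
        Matrix.mul_smul, smul_add, Nat.cast_add, Nat.cast_one, add_smul, one_smul]
      abel
  obtain ⟨K, hK⟩ := h1 n
  refine ⟨_, hK, fun C hC => ?_⟩
  have hco : IsCoprime (3 : ℤ) (n : ℤ) := by
    rw [Prime.coprime_iff_not_dvd Int.prime_three]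
    exact_mod_cast hn
  obtain ⟨u, v, huv⟩ := hco
  refine hBC ((u : 𝓞 E) • B + (v : 𝓞 E) • (C - K)) ?_
  have h3 : (u : 𝓞 E) * 3 + (v : 𝓞 E) * (n : 𝓞 E) = 1 := by
    have := congrArg (Int.cast : ℤ → 𝓞 E) huv
    push_cast at this
    exact this
  have h4 : (n : 𝓞 E) • B = (3 : 𝓞 E) • (C - K) := by
    rw [smul_sub, ← hC]; abel
  calc B = ((u : 𝓞 E) * 3 + (v : 𝓞 E) * (n : 𝓞 E)) • B := by rw [h3, one_smul]
    _ = _ := by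
      rw [add_smul, mul_smul (v : 𝓞 E), h4, smul_add, smul_smul, smul_smul, smul_smul,
        mul_comm (3 : 𝓞 E), mul_comm (3 : 𝓞 E)]

lemma ExactThree.three_pow {a : ℕ} {g w W : Matrix (Fin 3) (Fin 3) (𝓞 E)}
    (hw : w = 1 + (3 : 𝓞 E) • W) (h : ExactThree a (g * w - w * g)) (s : ℕ) :
    ExactThree (a + s) (g * w ^ 3 ^ s - w ^ 3 ^ s * g) := by
  induction s with
  | zero => simpa using h
  | succ s ih =>
    obtain ⟨V, hV⟩ := exists_pow_eq_one_add hw (3 ^ s)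
    have := ih.cube hV
    rwa [← pow_mul, ← pow_succ] at this

/-- The exact power of `3` dividing `[g, wᵉ]` with `e = 3ˢ n`, `n` prime to `3`. -/
lemma ExactThree.pow {a s n : ℕ} {g w W : Matrix (Fin 3) (Fin 3) (𝓞 E)}
    (hw : w = 1 + (3 : 𝓞 E) • W) (hn : ¬ 3 ∣ n) (h : ExactThree a (g * w - w * g)) :
    ExactThree (a + s) (g * w ^ (3 ^ s * n) - w ^ (3 ^ s * n) * g) := by
  obtain ⟨V, hV⟩ := exists_pow_eq_one_add hw (3 ^ s)
  rw [pow_mul]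
  exact (h.three_pow hw s).pow_coprime hV hn

/-- Iterated cubing improves congruences to the identity. -/
lemma pow_three_pow_mem_congr {φ : E →+* ℂ} {H : Matrix (Fin 3) (Fin 3) (𝓞 E)} {a : ℕ}
    (ha : 1 ≤ a) {u : SUInt φ H}
    (hu : u ∈ congr φ H ((3 : 𝓞 E) ^ a)) (s : ℕ) : u ^ 3 ^ s ∈ congr φ H ((3 : 𝓞 E) ^ (a + s)) := by
  induction s with
  | zero => simpa using hu
  | succ s ih =>
    obtain ⟨V, hV⟩ := mem_congr_iff.mp ih
    refine mem_congr_iff.mpr ⟨V + ((3 : 𝓞 E) ^ (a + s)) • (V * V) +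
      ((3 : 𝓞 E) ^ (a + s - 1) * (3 : 𝓞 E) ^ (a + s)) • (V * V * V), ?_⟩
    rw [pow_succ, pow_mul, mat_pow, hV]
    set r : 𝓞 E := (3 : 𝓞 E) ^ (a + s) with hr
    have h1 : (1 + r • V) ^ 3 = 1 + (3 * r) • V + (3 * r * r) • (V * V) + (r * r * r) • (V * V * V) := by
      have : ∀ A : Matrix (Fin 3) (Fin 3) (𝓞 E), (1 + A) ^ 3 = 1 + 3 • A + 3 • (A * A) + A * A * A := by
        intro A; noncomm_ring
      rw [this]
      simp only [Matrix.smul_mul, Matrix.mul_smul, smul_smul, ← Nat.cast_smul_eq_nsmul (𝓞 E),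
        Nat.cast_ofNat, mul_assoc]
    have h2 : r = 3 * (3 : 𝓞 E) ^ (a + s - 1) := by
      rw [hr, ← pow_succ']
      congr 1
      omega
    have h3 : (3 : 𝓞 E) ^ (a + (s + 1)) = 3 * r := by rw [hr, ← pow_succ']; rfl
    rw [h1, h3]
    simp only [smul_add, smul_smul, ← add_assoc]
    congr 2
    linear_combination r ^ 2 * h2

end ExactPower

section ExactPowerNumberField

variable {E : Type*} [Field E] [NumberField E]

lemma three_pow_smul_cancel {a : ℕ} {A B : Matrix (Fin 3) (Fin 3) (𝓞 E)}
    (h : (3 : 𝓞 E) ^ a • A = (3 : 𝓞 E) ^ a • B) : A = B :=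
  smul_right_injective _ (pow_ne_zero a (OfNat.ofNat_ne_zero 3)) h

lemma exists_exactThree {X : Matrix (Fin 3) (Fin 3) (𝓞 E)} (hX : X ≠ 0) :
    ∃ a, ExactThree a X := by
  classical
  obtain ⟨i, j, hij⟩ : ∃ i j, X i j ≠ 0 := by
    by_contra! h
    exact hX (Matrix.ext h)
  obtain ⟨n, hn⟩ := exists_not_three_pow_dvd hij
  have hex : ∃ n : ℕ, ∀ B : Matrix (Fin 3) (Fin 3) (𝓞 E), X ≠ (3 : 𝓞 E) ^ n • B :=
    ⟨n, fun B h => hn ⟨B i j, by rw [h]; rfl⟩⟩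
  obtain ⟨m, hm⟩ : ∃ m, Nat.find hex = m + 1 := by
    refine Nat.exists_eq_succ_of_ne_zero fun h0 => ?_
    have := Nat.find_spec hex X
    rw [h0] at this
    simp at this
  have h1 := Nat.find_min hex (m := m) (by omega)
  push Not at h1
  obtain ⟨B, hB⟩ := h1
  refine ⟨m, B, hB, fun C hC => Nat.find_spec hex C ?_⟩
  rw [hm, pow_succ, mul_smul, ← hC, hB]

lemma ExactThree.not_dvd {a b : ℕ} {X C : Matrix (Fin 3) (Fin 3) (𝓞 E)} (h : ExactThree a X)
    (hX : X = (3 : 𝓞 E) ^ b • C) : b ≤ a := by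
  obtain ⟨B, hB, hBC⟩ := h
  by_contra hab
  obtain ⟨c, rfl⟩ := Nat.exists_eq_add_of_lt (not_le.mp hab)
  refine hBC ((3 : 𝓞 E) ^ c • C) (three_pow_smul_cancel (a := a) ?_)
  rw [← hB, hX, smul_smul, smul_smul]
  congr 1
  ring

lemma ExactThree.ne_zero {a : ℕ} {X : Matrix (Fin 3) (Fin 3) (𝓞 E)} (h : ExactThree a X) :
    X ≠ 0 := by
  intro h0
  have := h.not_dvd (b := a + 1) (C := 0) (by simp [h0])
  omega

end ExactPowerNumberField

end CHyp

/-! ### Two facts about finitely generated groups -/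

namespace CHyp

open scoped commutatorElement

section Groups

/-- A group that acts on a connected space is finitely generated if the translates of some open set
`U` cover the space and only finitely many of them meet `U`. -/
theorem fg_of_open_cover {G X : Type*} [Group G] [TopologicalSpace X] (act : G → X → X)
    (act_one : ∀ x, act 1 x = x) (act_mul : ∀ g h x, act (g * h) x = act g (act h x))
    (act_cont : ∀ g, Continuous (act g)) {U C : Set X} (hU : IsOpen U) (hC : IsPreconnected C)
    (hinv : ∀ g, ∀ x ∈ C, act g x ∈ C) (hUC : U ⊆ C) (hne : U.Nonempty)
    (hcov : ∀ x ∈ C, ∃ g, act g x ∈ U) (hfin : {g | ∃ x ∈ U, act g x ∈ U}.Finite) :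
    Group.FG G := by
  set S := {g | ∃ x ∈ U, act g x ∈ U} with hS
  let O : Set G → Set X := fun K => ⋃ g ∈ K, act g ⁻¹' U
  have hO : ∀ K, IsOpen (O K) := fun K =>
    isOpen_biUnion fun g _ => hU.preimage (act_cont g)
  have hmem : ∀ K x, x ∈ O K ↔ ∃ g ∈ K, act g x ∈ U := fun K x => by simp [O]
  set T := Subgroup.closure S with hT
  have hdisj : ∀ x, x ∈ O T → x ∈ O (T : Set G)ᶜ → False := by
    intro x h1 h2
    obtain ⟨g, hg, hgx⟩ := (hmem _ _).mp h1
    obtain ⟨g', hg', hgx'⟩ := (hmem _ _).mp h2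
    apply hg'
    have h3 : g' * g⁻¹ ∈ S := by
      refine ⟨act g x, hgx, ?_⟩
      rw [← act_mul, inv_mul_cancel_right]
      exact hgx'
    have h4 := T.mul_mem (Subgroup.subset_closure h3) hg
    rwa [inv_mul_cancel_right] at h4
  obtain ⟨u, hu⟩ := hne
  have htop : T = ⊤ := by
    rw [eq_top_iff]
    intro g _
    by_contra hg
    have h1 : (C ∩ O T).Nonempty := ⟨u, hUC hu, (hmem _ _).mpr ⟨1, T.one_mem, by rwa [act_one]⟩⟩
    have h2 : (C ∩ O (T : Set G)ᶜ).Nonempty :=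
      ⟨act g⁻¹ u, hinv _ _ (hUC hu), (hmem _ _).mpr ⟨g, hg, by
        rwa [← act_mul, mul_inv_cancel, act_one]⟩⟩
    have h3 : C ⊆ O T ∪ O (T : Set G)ᶜ := by
      intro x hx
      obtain ⟨g, hg⟩ := hcov x hx
      by_cases h : g ∈ T
      · exact Or.inl ((hmem _ _).mpr ⟨g, h, hg⟩)
      · exact Or.inr ((hmem _ _).mpr ⟨g, h, hg⟩)
    obtain ⟨x, _, hx1, hx2⟩ := hC _ _ (hO _) (hO _) h3 h1 h2
    exact hdisj x hx1 hx2
  exact ⟨⟨hfin.toFinset, by rw [hfin.coe_toFinset, ← hT, htop]⟩⟩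

/-- Suppose that a finitely generated group `A` is isomorphic to a normal subgroup `B` of finite
index. The map from the abelianization of `B` to that of `A` has finite cokernel, hence also finite
kernel, both groups having the same rank. The commutators `[g, x]` with `g ∈ A` and `x ∈ B` lie in
the kernel, so some power of them is a product of commutators of `B`. The exponent depends only
on `A`. -/
theorem exists_pow_mem_commutator (A : Type*) [Group A] [Group.FG A] :
    ∃ e : ℕ, 0 < e ∧ ∀ (B : Subgroup A) [B.Normal] [B.FiniteIndex] (_ : A ≃* B) (g x : A),
      x ∈ B → ⁅g, x⁆ ^ e ∈ ⁅B, B⁆ := by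
  have hfg : Group.FG (Abelianization A) :=
    Group.fg_of_surjective (f := Abelianization.of) Quot.mk_surjective
  have hfin : Module.Finite ℤ (Additive (Abelianization A)) :=
    Module.Finite.iff_addGroup_fg.mpr inferInstance
  set M := Additive (Abelianization A) with hM
  let T := Submodule.torsion ℤ M
  have hTfin : Finite T := Module.finite_of_fg_torsion _ (Submodule.torsion_isTorsion)
  refine ⟨Nat.card T, Nat.card_pos, fun B _ _ f g x hx => ?_⟩
  let j : A →* A := B.subtype.comp f.toMonoidHom
  let ψ : M →ₗ[ℤ] M := (MonoidHom.toAdditive (Abelianization.map j)).toIntLinearMap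
  have hψ : ∀ a : A, ψ (Additive.ofMul (Abelianization.of a)) =
      Additive.ofMul (Abelianization.of (j a)) := fun a => rfl
  have hrange : ∀ m : M, (B.index : ℤ) • m ∈ LinearMap.range ψ := by
    intro m
    obtain ⟨a, ha⟩ : ∃ a : A, Additive.ofMul (Abelianization.of a) = m := Quot.mk_surjective m
    refine ⟨Additive.ofMul (Abelianization.of (f.symm ⟨a ^ B.index, B.pow_index_mem a⟩)), ?_⟩
    rw [hψ, ← ha]
    have : j (f.symm ⟨a ^ B.index, B.pow_index_mem a⟩) = a ^ B.index := by simp [j]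
    rw [this, map_pow, ofMul_pow, natCast_zsmul]
  have h1 : Module.finrank ℤ (M ⧸ LinearMap.range ψ) = 0 := by
    rw [Module.finrank_eq_zero_iff_isTorsion]
    intro y
    obtain ⟨m, rfl⟩ := Submodule.Quotient.mk_surjective _ y
    refine ⟨⟨(B.index : ℤ), mem_nonZeroDivisors_of_ne_zero
      (by exact_mod_cast Subgroup.FiniteIndex.index_ne_zero)⟩, ?_⟩
    rw [Submonoid.mk_smul, ← Submodule.Quotient.mk_smul, Submodule.Quotient.mk_eq_zero]
    exact hrange m
  have h2 := Submodule.finrank_quotient_add_finrank (LinearMap.range ψ)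
  have h3 := Submodule.finrank_quotient_add_finrank (LinearMap.ker ψ)
  rw [ψ.quotKerEquivRange.finrank_eq] at h3
  have h4 : Module.finrank ℤ (LinearMap.ker ψ) = 0 := by omega
  rw [Module.finrank_eq_zero_iff_isTorsion] at h4
  -- the commutator, viewed in `A` through the isomorphism
  have hc : ⁅g, x⁆ ∈ B := by
    rw [commutatorElement_def]
    exact B.mul_mem (Subgroup.Normal.conj_mem inferInstance x hx g) (B.inv_mem hx)
  let a := f.symm ⟨⁅g, x⁆, hc⟩
  have hja : j a = ⁅g, x⁆ := by simp [j, a]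
  have hker : Additive.ofMul (Abelianization.of a) ∈ LinearMap.ker ψ := by
    rw [LinearMap.mem_ker, hψ, hja, map_commutatorElement, commutatorElement_eq_one_iff_mul_comm.mpr
      (mul_comm _ _), ofMul_one]
  obtain ⟨n, hn⟩ := @h4 ⟨_, hker⟩
  have htor : Additive.ofMul (Abelianization.of a) ∈ T :=
    (Submodule.mem_torsion_iff _).mpr ⟨n, congrArg Subtype.val hn⟩
  have h5 : Nat.card T • Additive.ofMul (Abelianization.of a) = 0 :=
    congrArg Subtype.val (card_nsmul_eq_zero' (x := (⟨_, htor⟩ : T)))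
  have h6 : Abelianization.of (a ^ Nat.card T) = 1 := by
    rw [map_pow]
    exact h5
  have h7 : a ^ Nat.card T ∈ commutator A := by
    rw [← Abelianization.ker_of]
    exact h6
  have h8 : j (a ^ Nat.card T) ∈ (commutator A).map j := Subgroup.mem_map_of_mem _ h7
  rw [map_pow, hja, commutator_def, Subgroup.map_commutator] at h8
  have h9 : (⊤ : Subgroup A).map j ≤ B := by
    rintro _ ⟨y, _, rfl⟩
    exact (f y).2
  exact Subgroup.commutator_mono h9 h9 h8

end Groups

/-! ### Geometry of numbers -/

section Minkowski

open MeasureTheory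

/-- A version of Minkowski's theorem that produces lattice vectors outside a hyperplane: a nonzero
lattice vector `v` of the convex body `K` which is divisible by `q` if it lies in the kernel of the
functional `lam`. It is Minkowski's theorem for the sublattice of index `q ^ (d - 1)` that is
obtained by stretching the lattice by the factor `q` along the kernel of `lam`. -/
theorem exists_lattice_vector_of_functional {V ι : Type*} [NormedAddCommGroup V] [NormedSpace ℝ V]
    [FiniteDimensional ℝ V] [MeasurableSpace V] [BorelSpace V] (μ : Measure V)
    [μ.IsAddHaarMeasure] [Finite ι] (β : Module.Basis ι ℝ V) (lam : V →ₗ[ℝ] ℝ) {c : V}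
    (hc : c ∈ Submodule.span ℤ (Set.range β)) {m : ℝ} (hm : m ≠ 0) (hcm : lam c = m)
    (hlam : ∀ v ∈ Submodule.span ℤ (Set.range β), ∃ n : ℤ, lam v = n * m) {q : ℕ} (hq : 1 ≤ q)
    {K : Set V} (hsymm : ∀ x ∈ K, -x ∈ K) (hconv : Convex ℝ K)
    (hK : ENNReal.ofReal (q ^ (Module.finrank ℝ V - 1)) * (μ (ZSpan.fundamentalDomain β) *
      2 ^ Module.finrank ℝ V) < μ K) :
    ∃ v ∈ Submodule.span ℤ (Set.range β), v ≠ 0 ∧ v ∈ K ∧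
      (lam v = 0 → ∃ u ∈ Submodule.span ℤ (Set.range β), u ≠ 0 ∧ v = (q : ℝ) • u) := by
  have hq0 : (q : ℝ) ≠ 0 := by exact_mod_cast (by omega : q ≠ 0)
  have hqpos : (0 : ℝ) < q := by positivity
  let f : V →ₗ[ℝ] V := (q : ℝ) • LinearMap.transvection lam (-(((q : ℝ) - 1) / (q * m)) • c)
  have hf : ∀ v, f v = (q : ℝ) • v - (((q : ℝ) - 1) / m * lam v) • c := by
    intro v
    simp only [f, LinearMap.smul_apply, LinearMap.transvection.apply, smul_add, smul_smul,
      sub_eq_add_neg, ← neg_smul]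
    congr 2
    field_simp
  have hlf : ∀ v, lam (f v) = lam v := by
    intro v
    rw [hf, map_sub, map_smul, map_smul, hcm, smul_eq_mul, smul_eq_mul]
    field_simp
    ring
  have hpos : 0 < Module.finrank ℝ V := by
    have : Nontrivial V := ⟨c, 0, fun h => hm (by rw [← hcm, h, map_zero])⟩
    exact Module.finrank_pos
  have hdet : LinearMap.det f = (q : ℝ) ^ (Module.finrank ℝ V - 1) := by
    simp only [f]
    rw [LinearMap.det_smul, LinearMap.transvection.det, map_smul, hcm, smul_eq_mul]
    obtain ⟨d, hd⟩ := Nat.exists_eq_succ_of_ne_zero hpos.ne'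
    rw [hd, Nat.succ_eq_add_one, Nat.add_sub_cancel, pow_succ]
    field_simp
    ring
  have hdet0 : LinearMap.det f ≠ 0 := by rw [hdet]; positivity
  have hvol : μ (ZSpan.fundamentalDomain β) * 2 ^ Module.finrank ℝ V < μ (f ⁻¹' K) := by
    rw [Measure.addHaar_preimage_linearMap _ hdet0, hdet, abs_inv, abs_of_pos (by positivity),
      ENNReal.ofReal_inv_of_pos (by positivity), mul_comm _ (μ K), ← div_eq_mul_inv,
      ENNReal.lt_div_iff_mul_lt (Or.inl (by positivity)) (Or.inl ENNReal.ofReal_ne_top),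
      mul_comm]
    exact hK
  have : Countable (Submodule.span ℤ (Set.range β)).toAddSubgroup :=
    inferInstanceAs (Countable (Submodule.span ℤ (Set.range β)))
  obtain ⟨u, hu0, huK⟩ := exists_ne_zero_mem_lattice_of_measure_mul_two_pow_lt_measure
    (ZSpan.isAddFundamentalDomain' β μ) (s := f ⁻¹' K)
    (fun x hx => by
      rw [Set.mem_preimage, map_neg]; exact hsymm _ hx)
    (hconv.is_linear_preimage f.isLinear) hvol
  have huL : (u : V) ∈ Submodule.span ℤ (Set.range β) := u.2
  have hu0' : (u : V) ≠ 0 := fun h => hu0 (Subtype.ext h)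
  refine ⟨f u, ?_, ?_, huK, fun h0 => ⟨u, huL, hu0', ?_⟩⟩
  · obtain ⟨n, hn⟩ := hlam u huL
    have : f u = (q : ℤ) • (u : V) - (((q : ℤ) - 1) * n) • c := by
      rw [hf, hn, ← Int.cast_smul_eq_zsmul ℝ, ← Int.cast_smul_eq_zsmul ℝ]
      congr 2
      · push_cast
        field_simp
    rw [this]
    exact sub_mem (Submodule.smul_mem _ _ huL) (Submodule.smul_mem _ _ hc)
  · intro h
    have h1 : lam u = 0 := by rw [← hlf, h, map_zero]
    rw [hf, h1, mul_zero, zero_smul, sub_zero] at h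
    exact hu0' ((smul_eq_zero.mp h).resolve_left hq0)
  · rw [hlf] at h0
    rw [hf, h0, mul_zero, zero_smul, sub_zero]

end Minkowski

end CHyp

/-! ### Reduction theory of anisotropic forms -/

namespace CHyp

open scoped ComplexOrder
open NumberField MeasureTheory

section Lattice

variable {E : Type*} [Field E]

/-- The real vector space `∏_w ℂ³`, the product being over the complex places `w` of `E`. -/
abbrev RealSpace (E : Type*) [Field E] : Type _ :=
  {w : InfinitePlace E // w.IsComplex} → Fin 3 → ℂ

/-- The diagonal embedding of `R_E³` in `∏_w ℂ³`. -/
noncomputable def latticeEmb (E : Type*) [Field E] : (Fin 3 → 𝓞 E) →ₗ[ℤ] RealSpace E :=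
  AddMonoidHom.toIntLinearMap
    { toFun := fun v w => vecEmb w.1.embedding v
      map_zero' := by ext w i; simp [vecEmb]
      map_add' := fun u v => by ext w i; simp [vecEmb] }

lemma latticeEmb_apply (v : Fin 3 → 𝓞 E) (w : {w : InfinitePlace E // w.IsComplex}) :
    latticeEmb E v w = vecEmb w.1.embedding v := rfl

/-- For a totally complex field, `R_E³` is a lattice in `∏_w ℂ³`: an integral basis is a real
basis. -/
lemma exists_latticeBasis (E : Type*) [Field E] [NumberField E] [IsTotallyComplex E] :
    ∃ (ι : Type) (_ : Finite ι) (b : Module.Basis ι ℤ (Fin 3 → 𝓞 E))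
      (β : Module.Basis ι ℝ (RealSpace E)), ∀ i, β i = latticeEmb E (b i) := by
  have hempty : IsEmpty {w : InfinitePlace E // w.IsReal} :=
    ⟨fun w => InfinitePlace.not_isReal_iff_isComplex.mpr (IsTotallyComplex.isComplex w.1) w.2⟩
  let e : mixedEmbedding.mixedSpace E ≃ₗ[ℝ] ({w : InfinitePlace E // w.IsComplex} → ℂ) :=
    LinearEquiv.ofBijective (LinearMap.snd ℝ _ _) ⟨fun x y h => Prod.ext (Subsingleton.elim _ _) h,
      fun y => ⟨(0, y), rfl⟩⟩
  let s : (Fin 3 → {w : InfinitePlace E // w.IsComplex} → ℂ) ≃ₗ[ℝ] RealSpace E :=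
    { Equiv.piComm _ with
      map_add' := fun _ _ => rfl
      map_smul' := fun _ _ => rfl }
  let κ := Module.Free.ChooseBasisIndex ℤ (𝓞 E)
  let β₀ := (Pi.basis (fun _ : Fin 3 => (mixedEmbedding.latticeBasis E).map e)).map s
  let b₀ := Pi.basis (fun _ : Fin 3 => RingOfIntegers.basis E)
  let ε := Finite.equivFin (Σ _ : Fin 3, κ)
  refine ⟨_, inferInstance, b₀.reindex ε, β₀.reindex ε, fun i => ?_⟩
  obtain ⟨⟨j, l⟩, rfl⟩ := ε.surjective i
  rw [Module.Basis.reindex_apply, Module.Basis.reindex_apply, Equiv.symm_apply_apply]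
  simp only [β₀, b₀, Module.Basis.map_apply, Pi.basis_apply, mixedEmbedding.latticeBasis_apply]
  ext w i
  change (Pi.single j (e _) : Fin 3 → {w : InfinitePlace E // w.IsComplex} → ℂ) i w = _
  rw [latticeEmb_apply, vecEmb]
  by_cases h : i = j
  · subst h
    rw [Pi.single_eq_same, Pi.single_eq_same, integralBasis_apply]
    rfl
  · rw [Pi.single_eq_of_ne h, Pi.single_eq_of_ne h]
    simp

lemma span_range_latticeBasis {ι : Type*} {b : Module.Basis ι ℤ (Fin 3 → 𝓞 E)}
    {β : Module.Basis ι ℝ (RealSpace E)} (h : ∀ i, β i = latticeEmb E (b i)) :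
    Submodule.span ℤ (Set.range β) = LinearMap.range (latticeEmb E) := by
  have : Set.range β = latticeEmb E '' Set.range b := by
    rw [← Set.range_comp]
    exact congrArg Set.range (funext h)
  rw [this, ← Submodule.map_span, b.span_eq, Submodule.map_top]

variable [NumberField E]

/-- A nonzero integral vector `a` defines a hyperplane `v ⬝ᵥ a = 0` of `E³`. There is a nonzero
integral functional on `R_E³` that vanishes on it. -/
lemma exists_functional_of_dotProduct {a : Fin 3 → 𝓞 E} (ha : a ≠ 0) :
    ∃ f : (Fin 3 → 𝓞 E) →ₗ[ℤ] ℤ, f ≠ 0 ∧ ∀ v, v ⬝ᵥ a = 0 → f v = 0 := by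
  obtain ⟨i, hi⟩ := Function.ne_iff.mp ha
  have hr : (RingOfIntegers.basis E).repr (a i) ≠ 0 := by
    rwa [ne_eq, LinearEquiv.map_eq_zero_iff]
  obtain ⟨l, hl⟩ := Finsupp.ne_iff.mp hr
  let f₀ : (Fin 3 → 𝓞 E) →ₗ[ℤ] 𝓞 E := AddMonoidHom.toIntLinearMap
    { toFun := fun v => v ⬝ᵥ a
      map_zero' := zero_dotProduct _
      map_add' := fun u v => add_dotProduct u v a }
  have hf₀ : ∀ v, f₀ v = v ⬝ᵥ a := fun v => rfl
  refine ⟨(RingOfIntegers.basis E).coord l ∘ₗ f₀, fun h => hl ?_, fun v hv => ?_⟩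
  · have h1 := LinearMap.congr_fun h (Pi.single i 1)
    rw [LinearMap.comp_apply, hf₀, single_dotProduct, one_mul] at h1
    exact h1
  · rw [LinearMap.comp_apply, hf₀, hv, map_zero]

open scoped Classical in
/-- Short lattice vectors outside a given hyperplane. The convex body is the unit ball, of radius
`q / 2`, with respect to norms that differ from the standard ones by linear maps `B w`. If the
product of the determinants of these maps is fixed then `q` can be chosen independently of them: a
lattice vector in the kernel of the functional is divisible by `q`, and then its quotient by `q`
has norm less than one half. -/
lemma exists_short_vector [IsTotallyComplex E] (D : ℝ) (hD : 0 < D) :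
    ∃ q : ℕ, 0 < q ∧ ∀ B : {w : InfinitePlace E // w.IsComplex} → Matrix (Fin 3) (Fin 3) ℂ,
      ∏ w, ‖(B w).det‖ ^ 2 = D → ∀ a : Fin 3 → 𝓞 E, a ≠ 0 → ∃ v : Fin 3 → 𝓞 E, v ≠ 0 ∧
        (∀ w i, ‖(vecEmb w.1.embedding v ᵥ* B w) i‖ < q / 2) ∧ (v ⬝ᵥ a = 0 → ∃ u : Fin 3 → 𝓞 E,
          u ≠ 0 ∧ ∀ w i, ‖(vecEmb w.1.embedding u ᵥ* B w) i‖ < 1 / 2) := by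
  obtain ⟨ι, _, b, β, hβ⟩ := exists_latticeBasis E
  have : Fintype ι := Fintype.ofFinite ι
  let μ : Measure (RealSpace E) := Measure.addHaar
  let d := Module.finrank ℝ (RealSpace E)
  have hw : Nonempty {w : InfinitePlace E // w.IsComplex} :=
    ⟨⟨Classical.arbitrary _, IsTotallyComplex.isComplex _⟩⟩
  have hd : 0 < d := Module.finrank_pos
  -- the volume of the body is proportional to `q ^ d`, to be compared with `q ^ (d - 1)`
  let c₁ : ENNReal := μ (Metric.ball (0 : RealSpace E) 1) / 2 ^ d / ENNReal.ofReal D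
  let c₂ : ENNReal := μ (ZSpan.fundamentalDomain β) * 2 ^ d
  have hc₁ : c₁ ≠ 0 := by
    have := Metric.measure_ball_pos μ (0 : RealSpace E) one_pos
    exact (ENNReal.div_pos (ENNReal.div_pos this.ne' (by simp)).ne' ENNReal.ofReal_ne_top).ne'
  have hc₂ : c₂ ≠ ⊤ := by
    refine ENNReal.mul_ne_top ?_ (by simp)
    exact (ZSpan.fundamentalDomain_isBounded β).measure_lt_top.ne
  obtain ⟨q, hq⟩ := ENNReal.exists_nat_mul_gt hc₁ hc₂
  have hq0 : 0 < q := by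
    rcases Nat.eq_zero_or_pos q with rfl | h
    · simp at hq
    · exact h
  have hqr : (0 : ℝ) < q := by exact_mod_cast hq0
  refine ⟨q, hq0, fun B hB a ha => ?_⟩
  let L : RealSpace E →ₗ[ℝ] RealSpace E := LinearMap.pi fun w =>
    ((Matrix.vecMulLinear (B w)).restrictScalars ℝ).comp (LinearMap.proj w)
  have hL : ∀ y w, L y w = y w ᵥ* B w := fun _ _ => rfl
  have hdetB : ∀ w, LinearMap.det (Matrix.vecMulLinear (B w)) = (B w).det := by
    intro w
    rw [← Matrix.det_transpose, ← LinearMap.det_toLin']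
    congr 1
    ext v i
    simp
  have hdet : LinearMap.det L = D := by
    rw [LinearMap.det_pi, ← hB]
    refine Finset.prod_congr rfl fun w _ => ?_
    rw [LinearMap.det_restrictScalars, hdetB, Algebra.norm_complex_eq]
    exact Complex.normSq_eq_norm_sq _
  let K : Set (RealSpace E) := L ⁻¹' Metric.ball 0 (q / 2)
  have hKmem : ∀ y, y ∈ K ↔ ∀ w i, ‖(y w ᵥ* B w) i‖ < q / 2 := by
    intro y
    have hq2 : (0 : ℝ) < q / 2 := by positivity
    simp only [K, Set.mem_preimage, mem_ball_zero_iff, pi_norm_lt_iff hq2, hL]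
  have hvol : ENNReal.ofReal ((q : ℝ) ^ (d - 1)) * c₂ < μ K := by
    have h1 : μ K = ENNReal.ofReal ((q : ℝ) ^ (d - 1)) * (q * c₁) := by
      rw [Measure.addHaar_preimage_linearMap μ (by rw [hdet]; exact hD.ne'), hdet,
        Measure.addHaar_ball μ _ (by positivity), abs_of_pos (by positivity),
        ENNReal.ofReal_inv_of_pos hD]
      have h2 : ENNReal.ofReal (((q : ℝ) / 2) ^ d) =
          ENNReal.ofReal ((q : ℝ) ^ (d - 1)) * q * (2 ^ d)⁻¹ := by
        rw [div_pow, ENNReal.ofReal_div_of_pos (by positivity), div_eq_mul_inv]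
        congr 1
        · rw [← ENNReal.ofReal_natCast q, ← ENNReal.ofReal_mul (by positivity), ← pow_succ,
            Nat.sub_add_cancel hd]
        · rw [ENNReal.ofReal_pow (by norm_num)]
          norm_num
      simp only [c₁, div_eq_mul_inv]
      change (ENNReal.ofReal D)⁻¹ * (ENNReal.ofReal (((q : ℝ) / 2) ^ d) * _) = _
      rw [h2]
      ring
    rw [h1]
    refine ENNReal.mul_lt_mul_right ?_ ENNReal.ofReal_ne_top hq
    rw [ne_eq, ENNReal.ofReal_eq_zero, not_le]
    positivity
  obtain ⟨f, hf0, hfa⟩ := exists_functional_of_dotProduct ha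
  -- the real extension of the functional, and a generator of its group of values
  let lam : RealSpace E →ₗ[ℝ] ℝ := β.constr ℝ fun i => (f (b i) : ℝ)
  have hlam : ∀ v, lam (latticeEmb E v) = (f v : ℝ) := by
    have : (lam.restrictScalars ℤ) ∘ₗ latticeEmb E =
        (Int.castAddHom ℝ).toIntLinearMap ∘ₗ f := by
      refine b.ext fun i => ?_
      simp [lam, ← hβ]
    exact fun v => LinearMap.congr_fun this v
  obtain ⟨m, hm⟩ := (IsPrincipalIdealRing.principal (LinearMap.range f)).principal
  have hm0 : m ≠ 0 := by
    rintro rfl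
    rw [Submodule.span_zero_singleton, LinearMap.range_eq_bot] at hm
    exact hf0 hm
  obtain ⟨c, hc⟩ : m ∈ LinearMap.range f := by
    rw [hm]; exact Submodule.mem_span_singleton_self m
  have hspan := span_range_latticeBasis hβ
  obtain ⟨v', hv', hv0, hvK, hvq⟩ := exists_lattice_vector_of_functional μ β lam
    (c := latticeEmb E c) (by rw [hspan]; exact ⟨c, rfl⟩) (m := m) (by exact_mod_cast hm0)
    (by rw [hlam, hc]) (by
      rw [hspan]
      rintro _ ⟨v, rfl⟩
      have : f v ∈ LinearMap.range f := ⟨v, rfl⟩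
      rw [hm, Submodule.mem_span_singleton] at this
      obtain ⟨n, hn⟩ := this
      refine ⟨n, ?_⟩
      rw [hlam, ← hn]
      push_cast [smul_eq_mul]
      rfl) (q := q) hq0 (K := K)
    (fun x hx => by
      simp only [K, Set.mem_preimage, map_neg, mem_ball_zero_iff, norm_neg] at hx ⊢
      exact hx)
    ((convex_ball _ _).is_linear_preimage L.isLinear) hvol
  rw [hspan] at hv' hvq
  obtain ⟨v, rfl⟩ := hv'
  refine ⟨v, fun h => hv0 (by rw [h, map_zero]), fun w i => (hKmem _).mp hvK w i, fun h => ?_⟩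
  obtain ⟨_, ⟨u, rfl⟩, hu0, hu⟩ := hvq (by rw [hlam, hfa v h, Int.cast_zero])
  refine ⟨u, fun h => hu0 (by rw [h, map_zero]), fun w i => ?_⟩
  have h1 := (hKmem _).mp hvK w i
  rw [hu, Pi.smul_apply, Matrix.smul_vecMul, Pi.smul_apply, norm_smul, Real.norm_natCast,
    latticeEmb_apply] at h1
  rw [div_eq_mul_one_div] at h1
  exact lt_of_mul_lt_mul_left h1 hqr.le

end Lattice

end CHyp

namespace CHyp

open scoped ComplexOrder
open NumberField

section Cocompact

variable {E : Type*} [Field E] [NumberField E] [IsCMField E]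
  {φ : E →+* ℂ} {H : Matrix (Fin 3) (Fin 3) (𝓞 E)}

omit [NumberField E] [IsCMField E] in
lemma IsAdmissible.det_ne_zero (hH : IsAdmissible φ H) : H.det ≠ 0 := by
  intro h
  apply hH.sig.det_ne_zero
  rw [det_conjugate, h]
  simp

/-- The form is anisotropic: it represents zero only trivially over `R_E`. -/
def IsAnisotropic (H : Matrix (Fin 3) (Fin 3) (𝓞 E)) : Prop :=
  ∀ v : Fin 3 → 𝓞 E, v ≠ 0 → intHerm H v v ≠ 0

omit [NumberField E] [IsCMField E] in
lemma norm_det_conjugate_pos (hH : IsAdmissible φ H) (ν : E →+* ℂ) :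
    0 < ‖(conjugate ν H).det‖ := by
  rw [norm_pos_iff, det_conjugate, ne_eq, map_eq_zero]
  exact_mod_cast hH.det_ne_zero

lemma majorantAt_conjugate (x : Fin 3 → ℂ) (ν : E →+* ℂ) (v : Fin 3 → 𝓞 E) :
    majorantAt φ H x (ComplexEmbedding.conjugate ν) v = majorantAt φ H x ν v := by
  have h1 : ComplexEmbedding.conjugate ν = φ ↔ ν = ComplexEmbedding.conjugate φ :=
    ⟨fun h => by rw [← h, ComplexEmbedding.involutive_conjugate],
      fun h => by rw [h, ComplexEmbedding.involutive_conjugate]⟩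
  have h2 : ComplexEmbedding.conjugate ν = ComplexEmbedding.conjugate φ ↔ ν = φ :=
    ⟨fun h => (ComplexEmbedding.involutive_conjugate E).injective h, fun h => by rw [h]⟩
  unfold majorantAt
  by_cases h : ν = φ ∨ ν = ComplexEmbedding.conjugate φ
  · rw [if_pos (by rwa [h1, h2, or_comm]), if_pos h]
  · rw [if_neg (by rwa [h1, h2, or_comm]), if_neg h, herm_conjugate_conjugate]
    rfl

omit [NumberField E] [IsCMField E] in
/-- The majorants at all embeddings are Hermitian norms whose determinants do not depend on the
negative vector `x`. -/
lemma exists_majorantAt_eq (hH : IsAdmissible φ H) {x : Fin 3 → ℂ}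
    (hx : x ∈ negCone (conjugate φ H)) (ν : E →+* ℂ) :
    ∃ B : Matrix (Fin 3) (Fin 3) ℂ, ‖B.det‖ ^ 2 = ‖(conjugate ν H).det‖ ∧
      ∀ v, majorantAt φ H x ν v = ∑ i, ‖(vecEmb ν v ᵥ* B) i‖ ^ 2 := by
  have key : ∃ B : Matrix (Fin 3) (Fin 3) ℂ, ‖B.det‖ ^ 2 = ‖(conjugate φ H).det‖ ∧
      ∀ v, majorant (conjugate φ H) x v = ∑ i, ‖(v ᵥ* B) i‖ ^ 2 := by
    obtain ⟨B, hB, hB'⟩ := exists_norm_sq_eq_of_posDef (majorantMatrix_posDef hH.sig hx)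
    refine ⟨B, ?_, fun v => ?_⟩
    · rw [hB, det_majorantMatrix hH.sig hx, norm_neg]
    · rw [← hB', herm_majorantMatrix, Complex.add_re, Complex.ofReal_re, majorant]
  unfold majorantAt
  by_cases h : ν = φ ∨ ν = ComplexEmbedding.conjugate φ
  · simp only [if_pos h]
    obtain ⟨B, hB, hB'⟩ := key
    rcases h with rfl | rfl
    · exact ⟨B, hB, fun v => hB' _⟩
    · refine ⟨(starRingEnd ℂ).mapMatrix B, ?_, fun v => ?_⟩
      · rw [← RingHom.map_det, RCLike.norm_conj, hB, det_conjugate, det_conjugate]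
        exact (RCLike.norm_conj _).symm
      · rw [hB']
        refine Finset.sum_congr rfl fun i _ => ?_
        rw [← RCLike.norm_conj]
        congr 2
        simp [Matrix.vecMul, dotProduct, vecEmb]
  · simp only [if_neg h]
    push Not at h
    obtain ⟨B, hB, hB'⟩ := exists_norm_sq_eq_of_posDef (hH.posDef ν h.1 h.2)
    exact ⟨B, hB, fun v => hB' _⟩

/-- For an anisotropic form the lattice `R_E³` has, with respect to each of the majorants, short
vectors outside any given hyperplane. -/
lemma exists_short (hH : IsAdmissible φ H) (han : IsAnisotropic H) :
    ∃ R : ℝ, ∀ x ∈ negCone (conjugate φ H), ∀ a : Fin 3 → 𝓞 E, a ≠ 0 →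
      ∃ v : Fin 3 → 𝓞 E, (∀ ν, majorantAt φ H x ν v ≤ R) ∧ v ⬝ᵥ a ≠ 0 := by
  classical
  let D : ℝ := ∏ w : {w : InfinitePlace E // w.IsComplex}, ‖(conjugate w.1.embedding H).det‖
  obtain ⟨q, hq, hshort⟩ := exists_short_vector (E := E) D
    (Finset.prod_pos fun w _ => norm_det_conjugate_pos hH _)
  refine ⟨3 * (q / 2) ^ 2, fun x hx a ha => ?_⟩
  choose B hBdet hB using fun w : {w : InfinitePlace E // w.IsComplex} =>
    exists_majorantAt_eq hH hx w.1.embedding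
  have hle : ∀ (v : Fin 3 → 𝓞 E) (r : ℝ),
      (∀ w i, ‖(vecEmb w.1.embedding v ᵥ* B w) i‖ < r) →
        ∀ ν, majorantAt φ H x ν v ≤ 3 * r ^ 2 := by
    intro v r hr ν
    let w : {w : InfinitePlace E // w.IsComplex} :=
      ⟨InfinitePlace.mk ν, IsTotallyComplex.isComplex _⟩
    have h1 : majorantAt φ H x ν v = majorantAt φ H x w.1.embedding v := by
      rcases InfinitePlace.embedding_mk_eq ν with h | h
      · rw [h]
      · rw [h, majorantAt_conjugate]
    rw [h1, hB]
    calc _ ≤ ∑ i : Fin 3, r ^ 2 := by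
          gcongr with i
          exact (hr w i).le
      _ = 3 * r ^ 2 := by simp
  obtain ⟨v, hv0, hv, hva⟩ := hshort B (Finset.prod_congr rfl fun w _ => hBdet w) a ha
  refine ⟨v, hle v _ hv, fun h => ?_⟩
  obtain ⟨u, hu0, hu⟩ := hva h
  have h1 : ∀ ν : E →+* ℂ, ‖ν (intHerm H u u : E)‖ < 1 := by
    intro ν
    refine (norm_emb_intHerm_self_le hH hx ν u).trans_lt ((hle u _ hu ν).trans_lt ?_)
    norm_num
  have h2 := InfinitePlace.one_le_of_lt_one (w := InfinitePlace.mk φ) (han u hu0) (fun z _ => by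
    rw [← InfinitePlace.norm_embedding_eq]
    exact h1 _)
  rw [InfinitePlace.apply] at h2
  exact absurd (h1 φ) (not_lt.mpr h2)

open Matrix in
/-- For an anisotropic form the lattice `R_E³` contains, with respect to each of the majorants,
three linearly independent short vectors. They are the rows of the matrix `V`. -/
lemma exists_short_basis (hH : IsAdmissible φ H) (han : IsAnisotropic H) :
    ∃ R : ℝ, ∀ x ∈ negCone (conjugate φ H), ∃ V : Matrix (Fin 3) (Fin 3) (𝓞 E), V.det ≠ 0 ∧
      ∀ ν i, majorantAt φ H x ν (V i) ≤ R := by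
  obtain ⟨R, hR⟩ := exists_short hH han
  refine ⟨R, fun x hx => ?_⟩
  obtain ⟨v₁, h1, h1'⟩ := hR x hx (Pi.single 0 1) (by simp)
  have hv₁ : v₁ 0 ≠ 0 := by simpa using h1'
  obtain ⟨v₂, h2, h2'⟩ := hR x hx (crossProduct v₁ (Pi.single 1 1)) (fun h => hv₁ (by
    simpa [cross_apply] using congrFun h 2))
  obtain ⟨v₃, h3, h3'⟩ := hR x hx (crossProduct v₁ v₂) (fun h => h2' (by
    rw [triple_product_permutation, triple_product_permutation, ← neg_cross, h, neg_zero,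
      dotProduct_zero]))
  refine ⟨Matrix.of ![v₃, v₁, v₂], ?_, fun ν i => ?_⟩
  · rwa [triple_product_eq_det] at h3'
  · fin_cases i
    · exact h3 ν
    · exact h1 ν
    · exact h2 ν

/-- A negative vector at which the majorants of three independent vectors are bounded lies in a
bounded part of the negative cone. -/
lemma exists_mem_boundedCone_of_majorant_le {M : Matrix (Fin 3) (Fin 3) ℂ}
    (hM : HasSignatureTwoOne M) {V : Matrix (Fin 3) (Fin 3) ℂ} (hV : V.det ≠ 0) (R : ℝ) :
    ∃ C : ℝ, ∀ y ∈ negCone M, (∀ i, majorant M y (V i) ≤ R) → y ∈ boundedCone M C := by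
  let P := V * M
  have hP : IsUnit P.det := by
    rw [Matrix.det_mul]
    exact (mul_ne_zero hV hM.det_ne_zero).isUnit
  let T := (Matrix.mulVecLin P⁻¹).toContinuousLinearMap
  let S : ℝ := ∑ i, (|R| + ‖herm M (V i) (V i)‖)
  have hS : 0 ≤ S := Finset.sum_nonneg fun i _ => by positivity
  refine ⟨‖T‖ ^ 2 * S + 1, fun y hy hyR => ⟨hy, ?_⟩⟩
  have hy' : 0 < -(herm M y y).re := neg_pos.mpr hy
  have h1 : star y = T (P *ᵥ star y) := by
    change _ = P⁻¹ *ᵥ (P *ᵥ star y)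
    rw [Matrix.mulVec_mulVec, Matrix.nonsing_inv_mul _ hP, Matrix.one_mulVec]
  have h2 : ∀ i, (P *ᵥ star y) i = herm M (V i) y := fun i => by
    rw [herm_eq_dotProduct_mulVec, ← Matrix.mulVec_mulVec]
    rfl
  have h3 : ‖P *ᵥ star y‖ ≤ √(S * -(herm M y y).re) := by
    rw [pi_norm_le_iff_of_nonneg (Real.sqrt_nonneg _)]
    intro i
    rw [h2]
    apply Real.le_sqrt_of_sq_le
    have h4 : 2 * ‖herm M (V i) y‖ ^ 2 / -(herm M y y).re ≤ S := by
      have h5 := hyR i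
      have h6 : -(herm M (V i) (V i)).re ≤ ‖herm M (V i) (V i)‖ :=
        (neg_le_abs _).trans (Complex.abs_re_le_norm _)
      have h7 : |R| + ‖herm M (V i) (V i)‖ ≤ S := Finset.single_le_sum (f := fun i => |R| + ‖herm M (V i) (V i)‖)
        (fun _ _ => by positivity) (Finset.mem_univ i)
      have h8 := le_abs_self R
      unfold majorant at h5
      linarith
    rw [div_le_iff₀ hy'] at h4
    nlinarith [sq_nonneg ‖herm M (V i) y‖]
  calc ‖y‖ ^ 2 = ‖T (P *ᵥ star y)‖ ^ 2 := by rw [← h1, norm_star]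
    _ ≤ (‖T‖ * √(S * -(herm M y y).re)) ^ 2 := by
        gcongr
        exact (T.le_opNorm _).trans (by gcongr)
    _ = ‖T‖ ^ 2 * S * -(herm M y y).re := by
        rw [mul_pow, Real.sq_sqrt (mul_nonneg hS hy'.le), mul_assoc]
    _ < _ := by linarith

/-- Two integral matrices with the same Gram matrix and the same determinant `d` which are
congruent modulo a multiple of `d` differ by an element of `SU(H, R_E)`. -/
lemma exists_mat_eq_of_gram_eq {V V' : Matrix (Fin 3) (Fin 3) (𝓞 E)} (hV : V.det ≠ 0)
    (hgram : V * H * Vᴴ = V' * H * V'ᴴ) (hdet : V.det = V'.det)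
    {A : Matrix (Fin 3) (Fin 3) (𝓞 E)} (hA : V' = V + V.det • A) :
    ∃ g : SUInt φ H, V' = V * mat g := by
  let B := 1 + V.adjugate * A
  have hB : V' = V * B := by
    rw [Matrix.mul_add, Matrix.mul_one, ← Matrix.mul_assoc, Matrix.mul_adjugate, Matrix.smul_mul,
      Matrix.one_mul, hA]
  have hB1 : B.det = 1 := by
    have := congrArg Matrix.det hB
    rw [Matrix.det_mul, ← hdet] at this
    exact mul_left_cancel₀ hV (by rw [← this, mul_one])
  have hVH : Vᴴ.det ≠ 0 := by
    rw [Matrix.det_conjTranspose]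
    exact star_ne_zero.mpr hV
  have hcancel : ∀ X Y : Matrix (Fin 3) (Fin 3) (𝓞 E), V * X * Vᴴ = V * Y * Vᴴ → X = Y := by
    intro X Y h
    have h1 := congrArg (fun Z => V.adjugate * Z * Vᴴ.adjugate) h
    simp only [← Matrix.mul_assoc, Matrix.adjugate_mul] at h1
    simp only [Matrix.smul_mul, Matrix.one_mul, Matrix.mul_assoc, Matrix.mul_adjugate,
      Matrix.mul_smul, Matrix.mul_one] at h1
    exact smul_right_injective _ hVH (smul_right_injective _ hV (by simpa using h1))
  have hBH : B * H * Bᴴ = H := by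
    apply hcancel
    rw [hgram, hB, Matrix.conjTranspose_mul]
    simp only [Matrix.mul_assoc]
  exact ⟨ofMat B hB1 (mem_of_mat_mul_mul hBH), by rw [mat_ofMat]; exact hB⟩

/-- Cocompactness of `SU(H, R_E)` for an anisotropic form: the translates of a bounded part of the
negative cone cover the whole cone. The Gram matrices and the determinants of the short bases of
`R_E³` are restricted to finitely many values, so that up to the action of `SU(H, R_E)` there are
only finitely many short bases. -/
lemma exists_boundedCone_cover (hH : IsAdmissible φ H) (han : IsAnisotropic H) :
    ∃ C : ℝ, ∀ x ∈ negCone (conjugate φ H), ∃ g : SUInt φ H,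
      x ᵥ* conjugate φ (mat g) ∈ boundedCone (conjugate φ H) C := by
  classical
  obtain ⟨R, hR⟩ := exists_short_basis hH han
  let S : Set (Matrix (Fin 3) (Fin 3) (𝓞 E)) :=
    {V | V.det ≠ 0 ∧ ∃ x ∈ negCone (conjugate φ H), ∀ ν i, majorantAt φ H x ν (V i) ≤ R}
  let gram : Matrix (Fin 3) (Fin 3) (𝓞 E) → Matrix (Fin 3) (Fin 3) (𝓞 E) := fun V => V * H * Vᴴ
  have hgramdet : ∀ V, (gram V).det = V.det * (star V.det * H.det) := fun V => by
    simp only [gram, Matrix.det_mul, Matrix.det_conjTranspose]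
    ring
  have hgram : (gram '' S).Finite := by
    refine (finite_setOf_matrix_norm_le (E := E) (R + R)).subset ?_
    rintro _ ⟨V, ⟨_, x, hx, hV⟩, rfl⟩ ν i j
    have h1 : gram V i j = intHerm H (V i) (V j) := by
      simp only [gram, intHerm]
      rw [Matrix.mul_apply']
      rfl
    rw [h1]
    exact (norm_emb_intHerm_le hH hx ν _ _).trans (add_le_add (hV ν i) (hV ν j))
  have hdet : (Matrix.det '' S).Finite := by
    have h1 : ∀ G : Matrix (Fin 3) (Fin 3) (𝓞 E),
        {d : 𝓞 E | d * (star d * H.det) = G.det}.Finite := by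
      intro G
      let c : (E →+* ℂ) → ℝ := fun ν => ‖ν (G.det : E)‖ / ‖ν (H.det : E)‖ + 1
      refine (finite_setOf_norm_le (E := E) (∑ ν, c ν)).subset fun d hd ν => ?_
      have hHν : 0 < ‖ν (H.det : E)‖ := by
        rw [← det_conjugate]
        exact norm_det_conjugate_pos hH ν
      have h2 : ‖ν (d : E)‖ ^ 2 = ‖ν (G.det : E)‖ / ‖ν (H.det : E)‖ := by
        rw [eq_div_iff hHν.ne', ← show d * (star d * H.det) = G.det from hd]
        simp only [map_mul, norm_mul, emb_star, norm_star]
        ring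
      have h3 : ‖ν (d : E)‖ ≤ c ν := by
        simp only [c]
        rw [← h2]
        nlinarith [sq_nonneg (‖ν (d : E)‖ - 1)]
      exact h3.trans (Finset.single_le_sum (f := c) (fun _ _ => by positivity) (Finset.mem_univ ν))
    refine (hgram.biUnion fun G _ => h1 G).subset ?_
    rintro _ ⟨V, hV, rfl⟩
    exact Set.mem_biUnion (Set.mem_image_of_mem _ hV) (hgramdet V).symm
  -- a common multiple of the determinants
  let D : 𝓞 E := ∏ d ∈ hdet.toFinset, d
  have hD0 : D ≠ 0 := by
    rw [Finset.prod_ne_zero_iff]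
    intro d hd
    obtain ⟨V, hV, rfl⟩ := hdet.mem_toFinset.mp hd
    exact hV.1
  have hDdvd : ∀ V ∈ S, V.det ∣ D := fun V hV =>
    Finset.dvd_prod_of_mem _ (hdet.mem_toFinset.mpr (Set.mem_image_of_mem _ hV))
  have hQ : Finite (𝓞 E ⧸ Ideal.span {D}) :=
    Ideal.finiteQuotientOfFreeOfNeBot _ (by simpa using hD0)
  let cls : Matrix (Fin 3) (Fin 3) (𝓞 E) → Matrix (Fin 3) (Fin 3) (𝓞 E) × 𝓞 E ×
      Matrix (Fin 3) (Fin 3) (𝓞 E ⧸ Ideal.span {D}) := fun V =>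
    (gram V, V.det, V.map (Ideal.Quotient.mk _))
  have hcls : (cls '' S).Finite := by
    refine (hgram.prod (hdet.prod (Set.finite_univ))).subset ?_
    rintro _ ⟨V, hV, rfl⟩
    exact ⟨Set.mem_image_of_mem _ hV, Set.mem_image_of_mem _ hV, Set.mem_univ _⟩
  obtain ⟨T, hTS, hTfin, hT⟩ := Set.exists_subset_image_finite_and.mp
    ⟨cls '' S, subset_rfl, hcls, subset_rfl⟩
  choose! C hC using fun (V : Matrix (Fin 3) (Fin 3) (𝓞 E)) (hV : V.det ≠ 0) =>
    exists_mem_boundedCone_of_majorant_le hH.sig (V := conjugate φ V)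
      (by rw [det_conjugate, ne_eq, map_eq_zero]; exact_mod_cast hV) R
  refine ⟨∑ V ∈ hTfin.toFinset, |C V|, fun x hx => ?_⟩
  obtain ⟨V', hV'det, hV'⟩ := hR x hx
  obtain ⟨V, hVT, hVV'⟩ := hT (Set.mem_image_of_mem cls (show V' ∈ S from ⟨hV'det, x, hx, hV'⟩))
  obtain ⟨h1, h2⟩ := Prod.ext_iff.mp hVV'
  obtain ⟨h2, h3⟩ := Prod.ext_iff.mp h2
  have hVS := hTS hVT
  obtain ⟨e, he⟩ := hDdvd V hVS
  have h4 : ∀ i j, ∃ a, V' i j = V i j + D * a := by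
    intro i j
    have h5 : Ideal.Quotient.mk (Ideal.span {D}) (V' i j) = Ideal.Quotient.mk _ (V i j) :=
      (congrFun (congrFun h3 i) j).symm
    rw [Ideal.Quotient.eq, Ideal.mem_span_singleton] at h5
    obtain ⟨a, ha⟩ := h5
    exact ⟨a, by rw [← ha]; ring⟩
  choose a ha using h4
  obtain ⟨g, hg⟩ := exists_mat_eq_of_gram_eq (φ := φ) (A := Matrix.of fun i j => e * a i j) hVS.1
    h1 h2 (by
      ext i j
      rw [ha, he]
      simp [mul_assoc])
  refine ⟨g⁻¹, ?_⟩
  have hy := vecMul_mem_negCone g⁻¹ hx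
  have h6 := hC V hVS.1 _ hy (fun i => by
    have h7 := hV' φ i
    rw [← majorantAt_vecMul g⁻¹] at h7
    have h8 : V' i ᵥ* mat g⁻¹ = V i := by
      change (V' * mat g⁻¹) i = V i
      rw [hg, Matrix.mul_assoc, mat_mul_inv, Matrix.mul_one]
    rw [h8] at h7
    have h9 : conjugate φ V i = vecEmb φ (V i) := rfl
    rw [h9]
    simpa [majorantAt] using h7)
  refine ⟨h6.1, h6.2.trans_le ?_⟩
  have h10 : 0 ≤ -(herm (conjugate φ H) (x ᵥ* conjugate φ (mat g⁻¹))
      (x ᵥ* conjugate φ (mat g⁻¹))).re := (neg_pos.mpr hy).le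
  gcongr
  exact (le_abs_self _).trans (Finset.single_le_sum (f := fun V => |C V|)
    (fun _ _ => abs_nonneg _) (hTfin.mem_toFinset.mpr hVT))

/-- For an anisotropic form the group `SU(H, R_E)` is finitely generated. -/
lemma fg_of_isAnisotropic (hH : IsAdmissible φ H) (han : IsAnisotropic H) :
    Group.FG (SUInt φ H) := by
  obtain ⟨C, hC⟩ := exists_boundedCone_cover hH han
  let M := conjugate φ H
  have hcont : Continuous fun y : Fin 3 → ℂ => (herm M y y).re :=
    Complex.continuous_re.comp (continuous_herm M continuous_id continuous_id)
  have hmul : ∀ (g : SUInt φ H) (x : Fin 3 → ℂ), x ᵥ* conjugate φ (mat g) ∈ negCone M →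
      x ∈ negCone M := by
    intro g x hx
    have := vecMul_mem_negCone g⁻¹ hx
    rwa [Matrix.vecMul_vecMul, ← conjugate_mul, mat_mul_inv, conjugate_one,
      Matrix.vecMul_one] at this
  have hne : (negCone M).Nonempty := by
    obtain ⟨S, T, hST, hTS, hh⟩ := hH.sig.exists_coordinates
    refine ⟨![0, 0, 1] ᵥ* S, ?_⟩
    change (herm _ _ _).re < 0
    rw [hh]
    simp
  have hinv : {g : SUInt φ H | ∃ y ∈ boundedCone M C,
      y ᵥ* conjugate φ (mat g⁻¹) ∈ boundedCone M C}.Finite := by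
    refine (Set.Finite.preimage (inv_injective.injOn) (finite_setOf_boundedCone hH C)).subset ?_
    rintro g ⟨y, hy, hyg⟩
    exact ⟨y, hy, hyg⟩
  refine fg_of_open_cover (fun (g : SUInt φ H) x => x ᵥ* conjugate φ (mat g⁻¹))
    (fun x => by simp [mat_one, conjugate_one]) (fun g h x => by
      rw [Matrix.vecMul_vecMul, ← conjugate_mul, ← mat_mul, mul_inv_rev])
    (fun g => by fun_prop) (U := boundedCone M C) (C := negCone M) ?_
    hH.sig.isPreconnected_negCone (fun g x hx => vecMul_mem_negCone g⁻¹ hx) (fun y hy => hy.1)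
    ?_ (fun x hx => ?_) hinv
  · exact (isOpen_lt hcont continuous_const).inter
      (isOpen_lt (by fun_prop) (continuous_const.mul hcont.neg))
  · obtain ⟨x, hx⟩ := hne
    obtain ⟨g, hg⟩ := hC x hx
    exact ⟨_, hg⟩
  · obtain ⟨g, hg⟩ := hC x hx
    exact ⟨g⁻¹, by simpa using hg⟩

end Cocompact

end CHyp

/-! ### Congruence subgroups of anisotropic forms -/

namespace CHyp

open scoped ComplexOrder commutatorElement
open NumberField

section Anisotropic

variable {E : Type*} [Field E] [NumberField E] [IsCMField E]
  {φ : E →+* ℂ} {H : Matrix (Fin 3) (Fin 3) (𝓞 E)}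

omit [NumberField E] [IsCMField E] in
lemma exists_vecMul_mem_boundedCone (g : SUInt φ H) (C : ℝ) :
    ∃ C' : ℝ, ∀ y ∈ boundedCone (conjugate φ H) C,
      y ᵥ* conjugate φ (mat g) ∈ boundedCone (conjugate φ H) C' := by
  let T := (Matrix.vecMulLinear (conjugate φ (mat g))).toContinuousLinearMap
  refine ⟨‖T‖ ^ 2 * C + 1, fun y hy => ⟨vecMul_mem_negCone g hy.1, ?_⟩⟩
  have h1 : herm (conjugate φ H) (y ᵥ* conjugate φ (mat g)) (y ᵥ* conjugate φ (mat g)) =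
      herm (conjugate φ H) y y := herm_vecMul (SUInt.toSU φ H g) y y
  have hy' : 0 < -(herm (conjugate φ H) y y).re := neg_pos.mpr hy.1
  rw [h1]
  calc ‖T y‖ ^ 2 ≤ (‖T‖ * ‖y‖) ^ 2 := by gcongr; exact T.le_opNorm y
    _ = ‖T‖ ^ 2 * ‖y‖ ^ 2 := mul_pow _ _ _
    _ ≤ ‖T‖ ^ 2 * (C * -(herm (conjugate φ H) y y).re) := by gcongr; exact hy.2.le
    _ < _ := by linarith

lemma exists_boundedCone_cover_of_finiteIndex (hH : IsAdmissible φ H) (han : IsAnisotropic H)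
    (Λ : Subgroup (SUInt φ H)) [Λ.FiniteIndex] :
    ∃ C : ℝ, ∀ x ∈ negCone (conjugate φ H), ∃ g ∈ Λ,
      x ᵥ* conjugate φ (mat g) ∈ boundedCone (conjugate φ H) C := by
  have : Fintype (SUInt φ H ⧸ Λ) := Fintype.ofFinite _
  obtain ⟨C, hC⟩ := exists_boundedCone_cover hH han
  choose C' hC' using fun r : SUInt φ H => exists_vecMul_mem_boundedCone r C
  refine ⟨∑ q : SUInt φ H ⧸ Λ, |C' q.out|, fun x hx => ?_⟩
  obtain ⟨g, hg⟩ := hC x hx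
  obtain ⟨h, hh⟩ := QuotientGroup.mk_out_eq_mul Λ g⁻¹
  have h1 : (h : SUInt φ H) = g * (QuotientGroup.mk g⁻¹ : SUInt φ H ⧸ Λ).out := by
    rw [hh, mul_inv_cancel_left]
  refine ⟨h, h.2, ?_⟩
  have h2 := hC' (QuotientGroup.mk g⁻¹ : SUInt φ H ⧸ Λ).out _ hg
  rw [Matrix.vecMul_vecMul, ← conjugate_mul, ← mat_mul, ← h1] at h2
  refine ⟨h2.1, h2.2.trans_le ?_⟩
  have h3 := (neg_pos.mpr (show (herm _ _ _).re < 0 from h2.1)).le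
  gcongr
  exact (le_abs_self _).trans (Finset.single_le_sum (f := fun q : SUInt φ H ⧸ Λ => |C' q.out|)
    (fun _ _ => abs_nonneg _) (Finset.mem_univ _))

/-- A cocompact group has trivial centralizer: the displacement of a matrix `z` that commutes with
the group is bounded. -/
lemma isScalar_of_commute (hH : IsAdmissible φ H) (han : IsAnisotropic H)
    (Λ : Subgroup (SUInt φ H)) [Λ.FiniteIndex] (z : Matrix (Fin 3) (Fin 3) ℂ)
    (hz : ∀ g ∈ Λ, conjugate φ (mat g) * z = z * conjugate φ (mat g)) :
    ∃ c : ℂ, z = c • (1 : Matrix (Fin 3) (Fin 3) ℂ) := by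
  obtain ⟨C, hC⟩ := exists_boundedCone_cover_of_finiteIndex hH han Λ
  obtain ⟨K, hK, hKle⟩ := exists_norm_herm_le (conjugate φ H)
  let T := (Matrix.vecMulLinear z).toContinuousLinearMap
  refine hH.sig.isScalar_of_bounded z (K * ‖T‖ * C) fun x hx => ?_
  obtain ⟨g, hg, hxg⟩ := hC x hx
  set y := x ᵥ* conjugate φ (mat g) with hy
  have h1 : herm (conjugate φ H) (y ᵥ* z) y = herm (conjugate φ H) (x ᵥ* z) x := by
    rw [hy, Matrix.vecMul_vecMul, hz g hg, ← Matrix.vecMul_vecMul]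
    exact herm_vecMul (SUInt.toSU φ H g) _ _
  have h2 : herm (conjugate φ H) y y = herm (conjugate φ H) x x :=
    herm_vecMul (SUInt.toSU φ H g) _ _
  rw [← h1, ← h2]
  calc _ ≤ K * ‖T y‖ * ‖y‖ := hKle _ _
    _ ≤ K * (‖T‖ * ‖y‖) * ‖y‖ := by gcongr; exact T.le_opNorm y
    _ = K * ‖T‖ * ‖y‖ ^ 2 := by ring
    _ ≤ K * ‖T‖ * (C * -(herm (conjugate φ H) y y).re) := by gcongr; exact hxg.2.le
    _ = _ := by ring

lemma exists_not_commute (hH : IsAdmissible φ H) (han : IsAnisotropic H)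
    (Λ : Subgroup (SUInt φ H)) [Λ.FiniteIndex] :
    ∃ g ∈ Λ, ∃ h ∈ Λ, mat g * mat h ≠ mat h * mat g := by
  by_contra! hcomm
  -- an abelian group consists of scalars, and then every matrix commutes with it
  have h1 : ∀ h ∈ Λ, ∃ c : ℂ, conjugate φ (mat h) = c • (1 : Matrix (Fin 3) (Fin 3) ℂ) :=
    fun h hh => isScalar_of_commute hH han Λ _ fun g hg => by
      rw [← conjugate_mul, ← conjugate_mul, hcomm g hg h hh]
  obtain ⟨c, hc⟩ := isScalar_of_commute hH han Λ (Matrix.single 0 1 1) fun g hg => by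
    obtain ⟨c, hc⟩ := h1 g hg
    rw [hc, Matrix.smul_mul, Matrix.mul_smul, Matrix.one_mul, Matrix.mul_one]
  have := congrFun (congrFun hc 0) 1
  simp at this

/-- For an anisotropic form the principal congruence subgroups `Λ j` of level `3 ^ j` in `Γ` are
isomorphic to a fixed one only for finitely many `j`. Let `A = Λ b` and `A ≃ Λ j`. Commutators of
`Λ j` are trivial modulo `3 ^ (2 * j)`. For `g, h ∈ A` the element `x = h ^ 3 ^ (j - b)` lies in
`Λ j`, so a power of `[g, x]` with exponent independent of `j` is a product of such commutators. On
the other hand, the power of `3` dividing `g x - x g` grows like `j - b`. -/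
theorem eventually_isEmpty_of_isAnisotropic (hH : IsAdmissible φ H) (han : IsAnisotropic H)
    (Γ : Subgroup (SUInt φ H)) [Γ.FiniteIndex] {b : ℕ} (hb : 1 ≤ b) :
    ∃ N, ∀ j ≥ N, IsEmpty ((Γ ⊓ congr φ H ((3 : 𝓞 E) ^ b) : Subgroup (SUInt φ H)) ≃*
      (Γ ⊓ congr φ H ((3 : 𝓞 E) ^ j) : Subgroup (SUInt φ H))) := by
  have h3 : ∀ j : ℕ, (3 : 𝓞 E) ^ j ≠ 0 := fun j => pow_ne_zero j (OfNat.ofNat_ne_zero 3)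
  have hfi : ∀ j : ℕ, (congr φ H ((3 : 𝓞 E) ^ j)).FiniteIndex := fun j => finiteIndex_congr (h3 j)
  have := fg_of_isAnisotropic hH han
  set A : Subgroup (SUInt φ H) := Γ ⊓ congr φ H ((3 : 𝓞 E) ^ b) with hA
  have hAfg : Group.FG A := inferInstance
  obtain ⟨e, he, hpow⟩ := exists_pow_mem_commutator A
  obtain ⟨g, hg, h, hh, hgh⟩ := exists_not_commute hH han A
  obtain ⟨a, ha⟩ := exists_exactThree (sub_ne_zero.mpr hgh)
  obtain ⟨s, n, hn, hen⟩ := Nat.exists_eq_pow_mul_and_not_dvd he.ne' 3 (by norm_num)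
  refine ⟨a + s + b + 1, fun j hj => ⟨fun f => ?_⟩⟩
  have hbj : b ≤ j := by omega
  let N := congr φ H ((3 : 𝓞 E) ^ j)
  have hΛ : Γ ⊓ N ≤ A := inf_le_inf_left Γ (congr_pow_le hbj)
  have hB : (Γ ⊓ N).subgroupOf A = N.subgroupOf A := by
    ext x
    simp only [Subgroup.mem_subgroupOf, Subgroup.mem_inf]
    exact ⟨fun hx => hx.2, fun hx => ⟨x.2.1, hx⟩⟩
  let F : A ≃* N.subgroupOf A :=
    (f.trans (Subgroup.subgroupOfEquivOfLe hΛ).symm).trans (MulEquiv.subgroupCongr hB)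
  let x : SUInt φ H := h ^ 3 ^ (j - b)
  have hxN : x ∈ N := by
    have := pow_three_pow_mem_congr hb hh.2 (j - b)
    rwa [Nat.add_sub_cancel' hbj] at this
  have hxA : x ∈ A := A.pow_mem hh _
  let N' := congr φ H (((3 : 𝓞 E) ^ j) ^ 2)
  have h1 : ⁅g, x⁆ ^ e ∈ N' := by
    have h2 := hpow (N.subgroupOf A) F ⟨g, hg⟩ ⟨x, hxA⟩ hxN
    have h3 : ⁅N.subgroupOf A, N.subgroupOf A⁆ ≤ N'.subgroupOf A := by
      rw [Subgroup.commutator_le]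
      intro u hu v hv
      exact commutator_mem_congr hu hv
    exact h3 h2
  -- `[g, x]` and `x` commute modulo `N'`
  have h2 : ⁅g, x ^ e⁆ ∈ N' := by
    have hgx : ⁅g, x⁆ ∈ N := by
      rw [commutatorElement_def]
      exact N.mul_mem (Subgroup.Normal.conj_mem inferInstance x hxN g) (N.inv_mem hxN)
    let π := QuotientGroup.mk' N'
    have hcomm : Commute (π ⁅g, x⁆) (π x) := by
      rw [← commutatorElement_eq_one_iff_commute, ← map_commutatorElement]
      exact (QuotientGroup.eq_one_iff _).mpr (commutator_mem_congr hgx hxN)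
    have h4 : π g * π x * (π g)⁻¹ = π ⁅g, x⁆ * π x := by
      rw [← map_inv, ← map_mul, ← map_mul, ← map_mul, commutatorElement_def, inv_mul_cancel_right]
    have h5 : π ⁅g, x⁆ ^ e = 1 := by
      rw [← map_pow]
      exact (QuotientGroup.eq_one_iff _).mpr h1
    have h6 : π g * π x ^ e * (π g)⁻¹ = π x ^ e := by
      rw [← conj_pow, h4, hcomm.mul_pow, h5, one_mul]
    refine (QuotientGroup.eq_one_iff (N := N') _).mp ?_
    change π _ = 1
    rw [map_commutatorElement, commutatorElement_def, map_pow, h6, mul_inv_cancel]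
  obtain ⟨C, hC⟩ := commute_mod_of_commutator_mem h2
  obtain ⟨W, hW⟩ := mem_congr_iff.mp (congr_pow_le hb hh.2)
  rw [pow_one] at hW
  have h4 := ha.pow (s := j - b + s) hW hn
  have h5 : mat (x ^ e) = mat h ^ (3 ^ (j - b + s) * n) := by
    rw [← mat_pow, ← pow_mul, hen, pow_add, mul_assoc]
  rw [← h5, hC, ← pow_mul] at h4
  have := h4.not_dvd rfl
  omega

end Anisotropic

end CHyp

/-! ### Unipotent matrices -/

namespace CHyp

open scoped ComplexOrder commutatorElement
open NumberField Polynomial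

section Unipotent

/-- If the commutator `Z` of two invertible matrices `X` and `Y` commutes with both, then the
eigenvalues of `Z` are roots of unity: on the eigenspace of `Z` for `c`, of dimension `d`, the
determinants give `c ^ d = 1`, and `d ≤ 3`. -/
lemma pow_six_eq_one_of_hasEigenvalue {X Y Z : Matrix (Fin 3) (Fin 3) ℂ} (hX : X.det ≠ 0)
    (hY : Y.det ≠ 0) (hZX : Z * X = X * Z) (hZY : Z * Y = Y * Z) (h : X * Y = Z * (Y * X)) {c : ℂ}
    (hc : Module.End.HasEigenvalue (Matrix.toLin' Z) c) : c ^ 6 = 1 := by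
  let W := Module.End.eigenspace (Matrix.toLin' Z) c
  have hmem : ∀ v, v ∈ W ↔ Z *ᵥ v = c • v := fun v => by
    rw [Module.End.mem_eigenspace_iff, Matrix.toLin'_apply]
  have hinv : ∀ A : Matrix (Fin 3) (Fin 3) ℂ, Z * A = A * Z → ∀ v ∈ W, Matrix.toLin' A v ∈ W := by
    intro A hA v hv
    rw [hmem] at hv ⊢
    rw [Matrix.toLin'_apply, Matrix.mulVec_mulVec, hA, ← Matrix.mulVec_mulVec, hv,
      Matrix.mulVec_smul]
  let fX := (Matrix.toLin' X).restrict (hinv X hZX)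
  let fY := (Matrix.toLin' Y).restrict (hinv Y hZY)
  have hdet : ∀ (A : Matrix (Fin 3) (Fin 3) ℂ) (hA : Z * A = A * Z), A.det ≠ 0 →
      LinearMap.det ((Matrix.toLin' A).restrict (hinv A hA)) ≠ 0 := by
    intro A hA hA0
    rw [ne_eq, LinearMap.det_eq_zero_iff_ker_ne_bot, not_not, LinearMap.ker_eq_bot]
    intro u v huv
    have h1 : A *ᵥ (u : Fin 3 → ℂ) = A *ᵥ v := congrArg Subtype.val huv
    exact Subtype.ext (Matrix.mulVec_injective_of_isUnit
      ((Matrix.isUnit_iff_isUnit_det A).mpr hA0.isUnit) h1)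
  have hcomm : fX ∘ₗ fY = c • (fY ∘ₗ fX) := by
    ext v : 2
    have h1 : (Y * X) *ᵥ (v : Fin 3 → ℂ) ∈ W := by
      rw [← Matrix.mulVec_mulVec]
      exact hinv Y hZY _ (hinv X hZX _ v.2)
    rw [hmem, Matrix.mulVec_mulVec, ← h] at h1
    simpa [fX, fY, LinearMap.coe_restrict_apply] using h1
  have h1 := congrArg LinearMap.det hcomm
  rw [LinearMap.det_comp, LinearMap.det_smul, LinearMap.det_comp, mul_comm (LinearMap.det fX)] at h1
  have h2 : c ^ Module.finrank ℂ W = 1 :=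
    mul_right_cancel₀ (mul_ne_zero (hdet Y hZY hY) (hdet X hZX hX)) (by rw [← h1, one_mul])
  have h3 : Module.finrank ℂ W ≤ 3 := by
    simpa using Submodule.finrank_le W
  have h4 : 0 < Module.finrank ℂ W := by
    rw [Module.finrank_pos_iff]
    exact Submodule.nontrivial_iff_ne_bot.mpr hc
  generalize Module.finrank ℂ W = d at h2 h3 h4
  interval_cases d
  · rw [show 6 = 1 * 6 from rfl, pow_mul, h2, one_pow]
  · rw [show 6 = 2 * 3 from rfl, pow_mul, h2, one_pow]
  · rw [show 6 = 3 * 2 from rfl, pow_mul, h2, one_pow]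

lemma pow_six_sub_one_pow_three {X Y Z : Matrix (Fin 3) (Fin 3) ℂ} (hX : X.det ≠ 0)
    (hY : Y.det ≠ 0) (hZX : Z * X = X * Z) (hZY : Z * Y = Y * Z) (h : X * Y = Z * (Y * X)) :
    (Z ^ 6 - 1) ^ 3 = 0 := by
  have hsplit := IsAlgClosed.splits Z.charpoly
  have hcard : Multiset.card Z.charpoly.roots = 3 := by
    rw [← hsplit.natDegree_eq_card_roots, Matrix.charpoly_natDegree_eq_dim, Fintype.card_fin]
  have hdvd : Z.charpoly ∣ (Polynomial.X ^ 6 - 1 : ℂ[X]) ^ 3 := by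
    have h1 : (Polynomial.X ^ 6 - 1 : ℂ[X]) ^ 3 =
        (Z.charpoly.roots.map fun _ => (Polynomial.X ^ 6 - 1 : ℂ[X])).prod := by
      rw [Multiset.map_const', Multiset.prod_replicate, hcard]
    rw [h1]
    conv_lhs => rw [hsplit.eq_prod_roots_of_monic Z.charpoly_monic]
    refine Multiset.prod_dvd_prod_of_dvd _ _ fun c hc => ?_
    rw [dvd_iff_isRoot, IsRoot, eval_sub, eval_pow, eval_X, eval_one, sub_eq_zero]
    refine pow_six_eq_one_of_hasEigenvalue hX hY hZX hZY h ?_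
    rw [Module.End.hasEigenvalue_iff_isRoot_charpoly, Matrix.charpoly_toLin']
    exact isRoot_of_mem_roots hc
  obtain ⟨P, hP⟩ := hdvd
  have := congrArg (aeval Z) hP
  rw [map_mul, Matrix.aeval_self_charpoly, zero_mul] at this
  simpa using this

/-- The determinant of a unipotent matrix is one. -/
lemma det_one_add_of_isNilpotent {R : Type*} [CommRing R] [IsDomain R]
    {N : Matrix (Fin 3) (Fin 3) R} (hN : IsNilpotent N) : (1 + N).det = 1 := by
  have h1 := Matrix.isNilpotent_charpoly_sub_pow_of_isNilpotent (hN.neg)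
  have h2 := sub_eq_zero.mp h1.eq_zero
  have h3 := congrArg (eval 1) h2
  rw [Matrix.eval_charpoly, sub_neg_eq_add, map_one] at h3
  simpa using h3

end Unipotent

section Roots

variable {R : Type*} [CommRing R] [StarRing R] {n H : Matrix (Fin 3) (Fin 3) R}

omit [StarRing R] in
/-- The matrix `u = 1 + r n + c r² n²` with `2 c = 1 - r` is the `r`-th root of the unipotent
matrix `1 + r² n` given by the binomial series. -/
lemma unipotent_root_pow {r : ℕ} {c : ℤ} (hc : 2 * c = 1 - r) (hn : n ^ 3 = 0) :
    (1 + (r : R) • n + ((c : R) * (r : R) ^ 2) • n ^ 2) ^ r = 1 + ((r : R) ^ 2) • n := by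
  have key : ∀ k : ℕ, (1 + (r : R) • n + ((c : R) * (r : R) ^ 2) • n ^ 2) ^ k =
      1 + ((k : R) * r) • n + (((k * c + ∑ i ∈ Finset.range k, (i : ℤ) : ℤ) : R) * (r : R) ^ 2) •
        n ^ 2 := by
    intro k
    induction k with
    | zero => simp
    | succ k ih =>
      have h4 : n ^ 2 * n = 0 := by rw [← pow_succ, hn]
      have h5 : n * n ^ 2 = 0 := by rw [← pow_succ', hn]
      have h6 : n ^ 2 * n ^ 2 = 0 := by rw [← pow_add, pow_succ, hn, zero_mul]
      rw [pow_succ, ih, Finset.sum_range_succ]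
      simp only [mul_add, add_mul, Matrix.smul_mul, Matrix.mul_smul, one_mul, mul_one, h4, h5, h6,
        smul_zero, add_zero, ← pow_two]
      push_cast
      module
  rw [key r]
  have h1 : (r * c + ∑ i ∈ Finset.range r, (i : ℤ) : ℤ) = 0 := by
    have h2 := Finset.sum_range_id_mul_two r
    have h3 : (∑ i ∈ Finset.range r, (i : ℤ)) * 2 = r * (r - 1) := by
      rcases Nat.eq_zero_or_pos r with rfl | hr
      · simp
      · have := congrArg (Nat.cast : ℕ → ℤ) h2
        push_cast [Nat.cast_sub hr] at this
        exact this
    have h4 : 2 * (r * c + ∑ i ∈ Finset.range r, (i : ℤ) : ℤ) = 0 := by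
      linear_combination (r : ℤ) * hc + h3
    omega
  rw [h1, Int.cast_zero, zero_mul, zero_smul, add_zero, ← pow_two]

/-- The binomial root of a unipotent matrix preserving a form preserves it as well. -/
lemma unipotent_root_preserves [IsDomain R] {r : R} (hr : r ≠ 0) (hrs : star r = r) {c : R}
    (hcs : star c = c) (hc : 2 * c = 1 - r) (hn : n ^ 3 = 0)
    (hH : (1 + r ^ 2 • n) * H * (1 + r ^ 2 • n)ᴴ = H) :
    (1 + r • n + (c * r ^ 2) • n ^ 2) * H * (1 + r • n + (c * r ^ 2) • n ^ 2)ᴴ = H := by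
  set m := nᴴ with hm
  have hm3 : m ^ 3 = 0 := by rw [hm, ← Matrix.conjTranspose_pow, hn, Matrix.conjTranspose_zero]
  have hmm : m * m = m ^ 2 := (pow_two m).symm
  have hm12 : m * m ^ 2 = 0 := by rw [← pow_succ', hm3]
  have hm21 : m ^ 2 * m = 0 := by rw [← pow_succ, hm3]
  have hm22 : m ^ 2 * m ^ 2 = 0 := by rw [← pow_add, pow_succ, hm3, zero_mul]
  have hct : (1 + r ^ 2 • n)ᴴ = 1 + r ^ 2 • m := by
    rw [Matrix.conjTranspose_add, Matrix.conjTranspose_one, Matrix.conjTranspose_smul, star_pow,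
      hrs]
  have hct' : (1 + r • n + (c * r ^ 2) • n ^ 2)ᴴ = 1 + r • m + (c * r ^ 2) • m ^ 2 := by
    rw [Matrix.conjTranspose_add, Matrix.conjTranspose_add, Matrix.conjTranspose_one,
      Matrix.conjTranspose_smul, Matrix.conjTranspose_smul, Matrix.conjTranspose_pow, star_mul,
      star_pow, hrs, hcs, mul_comm (r ^ 2)]
  rw [hct] at hH
  rw [hct']
  -- the matrix `l` with `(1 + r² l) (1 + r² m) = 1`
  set l := -m + r ^ 2 • m ^ 2 with hl
  have hl2 : l ^ 2 = m ^ 2 := by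
    rw [pow_two l, hl]
    simp only [mul_add, add_mul, Matrix.smul_mul, Matrix.mul_smul, neg_mul, mul_neg, neg_neg, hm12,
      hm21, hm22, smul_zero, neg_zero, add_zero, hmm]
  have h1 : (1 + r ^ 2 • m) * (1 + r ^ 2 • l) = 1 := by
    simp only [hl, mul_add, add_mul, Matrix.smul_mul, Matrix.mul_smul, mul_neg, hm12, smul_zero,
      one_mul, mul_one, smul_add, add_zero, hmm]
    module
  have h2 : n * H = H * l := by
    have h3 := congrArg (· * (1 + r ^ 2 • l)) hH
    simp only [Matrix.mul_assoc, h1, mul_one] at h3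
    rw [add_mul, mul_add, one_mul, mul_one, add_right_inj, Matrix.smul_mul, Matrix.mul_smul] at h3
    exact smul_right_injective _ (pow_ne_zero 2 hr) h3
  have h3 : (1 + r • n + (c * r ^ 2) • n ^ 2) * H = H * (1 + r • l + (c * r ^ 2) • l ^ 2) := by
    have h4 : n ^ 2 * H = H * l ^ 2 := by
      rw [pow_two, Matrix.mul_assoc, h2, ← Matrix.mul_assoc, h2, Matrix.mul_assoc, ← pow_two]
    simp only [add_mul, mul_add, Matrix.smul_mul, Matrix.mul_smul, h2, h4, one_mul, mul_one]
  have h5 : (1 + r • l + (c * r ^ 2) • l ^ 2) * (1 + r • m + (c * r ^ 2) • m ^ 2) = 1 := by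
    rw [hl2, hl]
    simp only [mul_add, add_mul, Matrix.smul_mul, Matrix.mul_smul, neg_mul, hm12, hm21, hm22,
      smul_zero, smul_neg, neg_zero, one_mul, mul_one, smul_add, add_zero, hmm]
    have h6 : r ^ 3 + 2 * (c * r ^ 2) - r ^ 2 = 0 := by linear_combination r ^ 2 * hc
    have h7 : (r ^ 3 + 2 * (c * r ^ 2) - r ^ 2) • m ^ 2 = 0 := by rw [h6, zero_smul]
    rw [← sub_eq_zero, ← h7]
    module
  rw [h3, Matrix.mul_assoc, h5, Matrix.mul_one]

/-- The exponential of `2 N`, where `N` is nilpotent and skew-adjoint with respect to a form,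
preserves the form. -/
lemma unipotent_exp_preserves {N : Matrix (Fin 3) (Fin 3) R} (hN : N ^ 3 = 0)
    (hNH : N * H = -(H * Nᴴ)) :
    (1 + (2 : R) • N + (2 : R) • N ^ 2) * H * (1 + (2 : R) • N + (2 : R) • N ^ 2)ᴴ = H := by
  set m := Nᴴ with hm
  have hm3 : m ^ 3 = 0 := by rw [hm, ← Matrix.conjTranspose_pow, hN, Matrix.conjTranspose_zero]
  have hmm : m * m = m ^ 2 := (pow_two m).symm
  have hm12 : m * m ^ 2 = 0 := by rw [← pow_succ', hm3]
  have hm21 : m ^ 2 * m = 0 := by rw [← pow_succ, hm3]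
  have hm22 : m ^ 2 * m ^ 2 = 0 := by rw [← pow_add, pow_succ, hm3, zero_mul]
  have h2 : N ^ 2 * H = H * m ^ 2 := by
    rw [pow_two, Matrix.mul_assoc, hNH, Matrix.mul_neg, ← Matrix.mul_assoc, hNH, Matrix.neg_mul,
      neg_neg, Matrix.mul_assoc, ← pow_two]
  have h3 : (1 + (2 : R) • N + (2 : R) • N ^ 2) * H = H * (1 - (2 : R) • m + (2 : R) • m ^ 2) := by
    simp only [add_mul, mul_add, mul_sub, Matrix.smul_mul, Matrix.mul_smul, hNH, h2, one_mul,
      mul_one]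
    module
  have h4 : (1 + (2 : R) • N + (2 : R) • N ^ 2)ᴴ = 1 + (2 : R) • m + (2 : R) • m ^ 2 := by
    rw [Matrix.conjTranspose_add, Matrix.conjTranspose_add, Matrix.conjTranspose_one,
      Matrix.conjTranspose_smul, Matrix.conjTranspose_smul, Matrix.conjTranspose_pow, star_ofNat]
  have h5 : (1 - (2 : R) • m + (2 : R) • m ^ 2) * (1 + (2 : R) • m + (2 : R) • m ^ 2) = 1 := by
    simp only [mul_add, add_mul, sub_mul, Matrix.smul_mul, Matrix.mul_smul, hm12, hm21, hm22,
      smul_zero, one_mul, mul_one, add_zero, sub_zero, hmm]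
    module
  rw [h3, h4, Matrix.mul_assoc, h5, Matrix.mul_one]

end Roots

end CHyp

/-! ### Congruence subgroups of isotropic forms -/

namespace CHyp

open scoped ComplexOrder commutatorElement
open NumberField

/-- Powers of two elements whose commutator commutes with both. -/
lemma commutator_pow_of_commute {G : Type*} [Group G] {x y : G} (hx : Commute ⁅x, y⁆ x)
    (hy : Commute ⁅x, y⁆ y) (m n : ℕ) : ⁅x ^ m, y ^ n⁆ = ⁅x, y⁆ ^ (n * m) := by
  set z := ⁅x, y⁆ with hz
  have h1 : x * y * x⁻¹ = z * y := by rw [hz, commutatorElement_def, inv_mul_cancel_right]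
  have h2 : x * y ^ n * x⁻¹ = z ^ n * y ^ n := by rw [← conj_pow, h1, hy.mul_pow]
  have h3 : (y ^ n)⁻¹ * x * y ^ n = z ^ n * x := by
    have h4 : x * y ^ n = z ^ n * y ^ n * x := by rw [← h2, inv_mul_cancel_right]
    rw [mul_assoc, h4, (hy.pow_pow n n).eq, mul_assoc, inv_mul_cancel_left]
  have h5 : (y ^ n)⁻¹ * x ^ m * y ^ n = z ^ (n * m) * x ^ m := by
    have h6 := conj_pow (i := m) (a := (y ^ n)⁻¹) (b := x)
    rw [inv_inv] at h6
    rw [← h6, h3, (hx.pow_left n).mul_pow, pow_mul]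
  have h7 : x ^ m * y ^ n = z ^ (n * m) * y ^ n * x ^ m := by
    rw [(hy.pow_pow (n * m) n).eq, mul_assoc, ← h5]
    group
  rw [commutatorElement_def, h7]
  group

section Isotropic

variable {E : Type*} [Field E] [NumberField E] [IsCMField E]
  {φ : E →+* ℂ} {H : Matrix (Fin 3) (Fin 3) (𝓞 E)}

/-- A central commutator in a principal congruence subgroup of level `3 ^ a` has, up to a bounded
power, a root of order `3 ^ a` in the same subgroup. The sixth power of the commutator is unipotent
and congruent to one modulo `3 ^ (2 * a)`, so that its root is given by the binomial series. -/
lemma exists_root_of_central_commutator {a : ℕ} {x y : SUInt φ H}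
    (hx : x ∈ congr φ H ((3 : 𝓞 E) ^ a)) (hy : y ∈ congr φ H ((3 : 𝓞 E) ^ a))
    (hzx : Commute ⁅x, y⁆ x) (hzy : Commute ⁅x, y⁆ y) :
    ∃ u ∈ congr φ H ((3 : 𝓞 E) ^ a), u ^ 3 ^ a = ⁅x, y⁆ ^ 6 := by
  set z := ⁅x, y⁆ with hz
  have h3 : ((3 : 𝓞 E) ^ a) ≠ 0 := pow_ne_zero _ (OfNat.ofNat_ne_zero 3)
  obtain ⟨n, hn⟩ := mem_congr_iff.mp ((congr φ H _).pow_mem (commutator_mem_congr hx hy) 6)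
  rw [← hz] at hn
  have hn3 : n ^ 3 = 0 := by
    have h1 : (conjugate φ (mat z) ^ 6 - 1) ^ 3 = 0 := by
      have hdet : ∀ g : SUInt φ H, (conjugate φ (mat g)).det ≠ 0 := fun g => by
        rw [det_conjugate, det_mat]
        simp
      have hcomm : ∀ g : SUInt φ H, Commute z g →
          conjugate φ (mat z) * conjugate φ (mat g) = conjugate φ (mat g) * conjugate φ (mat z) :=
        fun g hg => by rw [← conjugate_mul, ← conjugate_mul, ← mat_mul, ← mat_mul, hg.eq]
      refine pow_six_sub_one_pow_three (hdet x) (hdet y) (hcomm x hzx) (hcomm y hzy) ?_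
      rw [← conjugate_mul, ← conjugate_mul, ← conjugate_mul, ← mat_mul, ← mat_mul, ← mat_mul, hz,
        commutatorElement_def]
      congr 2
      group
    have h2 : (mat (z ^ 6) - 1) ^ 3 = 0 := by
      apply conjugate_injective φ
      rw [conjugate_eq_mapMatrix, conjugate_eq_mapMatrix, map_pow, map_sub, map_one, map_zero,
        mat_pow, map_pow]
      exact h1
    rw [hn, add_sub_cancel_left, smul_pow] at h2
    exact (smul_eq_zero.mp h2).resolve_left (pow_ne_zero _ (pow_ne_zero _ h3))
  -- the coefficient `c` of the quadratic term
  obtain ⟨c, hc⟩ : ∃ c : ℤ, 2 * c = 1 - (3 ^ a : ℕ) := by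
    have h1 : Odd ((3 : ℤ) ^ a) := Odd.pow (by decide)
    obtain ⟨d, hd⟩ := h1
    exact ⟨-d, by push_cast; rw [hd]; ring⟩
  have hcast : ((3 ^ a : ℕ) : 𝓞 E) = (3 : 𝓞 E) ^ a := by push_cast; rfl
  set r : 𝓞 E := (3 : 𝓞 E) ^ a with hr
  set U := 1 + r • n + ((c : 𝓞 E) * r ^ 2) • n ^ 2 with hU
  have hUpow : U ^ 3 ^ a = 1 + r ^ 2 • n := by
    have := unipotent_root_pow (R := 𝓞 E) hc hn3
    rwa [hcast] at this
  have hUH : U * H * Uᴴ = H := by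
    refine unipotent_root_preserves h3 ?_ ?_ ?_ hn3 ?_
    · rw [hr, star_pow, star_ofNat]
    · exact star_intCast c
    · have := congrArg (Int.cast : ℤ → 𝓞 E) hc
      push_cast at this
      exact this
    · rw [← hn]
      exact mat_mul_mul _
  have hUdet : U.det = 1 := by
    rw [hU, add_assoc]
    refine det_one_add_of_isNilpotent ⟨3, ?_⟩
    have h1 : r • n + ((c : 𝓞 E) * r ^ 2) • n ^ 2 = n * (r • 1 + ((c : 𝓞 E) * r ^ 2) • n) := by
      rw [mul_add, Matrix.mul_smul, Matrix.mul_smul, mul_one, ← pow_two]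
    have h2 : Commute n (r • 1 + ((c : 𝓞 E) * r ^ 2) • n) :=
      ((Commute.one_right n).smul_right r).add_right ((Commute.refl n).smul_right _)
    rw [h1, h2.mul_pow, hn3, zero_mul]
  refine ⟨ofMat U hUdet (mem_of_mat_mul_mul hUH), mem_congr_iff.mpr
    ⟨n + ((c : 𝓞 E) * r) • n ^ 2, ?_⟩, mat_injective ?_⟩
  · rw [mat_ofMat, hU, smul_add, smul_smul, add_assoc]
    congr 3
    ring
  · rw [mat_pow, mat_ofMat, hUpow, hn]

lemma exists_star_eq_neg (E : Type*) [Field E] [NumberField E] [IsCMField E] :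
    ∃ t : 𝓞 E, t ≠ 0 ∧ star t = -t := by
  obtain ⟨x, hx⟩ : ∃ x : 𝓞 E, star x ≠ x := by
    by_contra! h
    apply IsCMField.complexConj_ne_one E
    ext x
    obtain ⟨a, b, _, rfl⟩ := IsFractionRing.div_surjective (A := 𝓞 E) x
    have h1 : ∀ a : 𝓞 E, IsCMField.complexConj E (a : E) = a := fun a =>
      congrArg (algebraMap (𝓞 E) E) (h a)
    rw [map_div₀, h1, h1]
    rfl
  exact ⟨x - star x, sub_ne_zero.mpr hx.symm, by rw [star_sub, star_star, neg_sub]⟩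

lemma intHerm_eq (v w : Fin 3 → 𝓞 E) : intHerm H v w = v ⬝ᵥ (H *ᵥ star w) := by
  rw [intHerm, Matrix.dotProduct_mulVec]

lemma star_intHerm (hH : IsAdmissible φ H) (v w : Fin 3 → 𝓞 E) :
    star (intHerm H v w) = intHerm H w v := by
  have h1 : φ ((star (intHerm H v w) : 𝓞 E) : E) = φ (intHerm H w v : E) := by
    rw [emb_star, emb_intHerm, emb_intHerm, star_herm hH.sig.isHermitian]
  exact_mod_cast φ.injective h1

lemma mulVec_star_ne_zero (hH : IsAdmissible φ H) {w : Fin 3 → 𝓞 E} (hw : w ≠ 0) :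
    H *ᵥ star w ≠ 0 := fun h =>
  star_ne_zero.mpr hw (Matrix.eq_zero_of_mulVec_eq_zero hH.det_ne_zero h)

open Matrix in
/-- The orthogonal complement of an isotropic vector contains anisotropic vectors. -/
lemma exists_orthogonal_anisotropic (hH : IsAdmissible φ H) {w : Fin 3 → 𝓞 E} (hw : w ≠ 0)
    (hww : intHerm H w w = 0) : ∃ y, intHerm H y w = 0 ∧ intHerm H y y ≠ 0 := by
  set p := H *ᵥ star w with hp
  by_contra! hall
  -- the vectors orthogonal to `w` would all be proportional to `w`
  have h1 : ∀ e : Fin 3 → 𝓞 E, ∃ a : ℂ, vecEmb φ (crossProduct p e) = a • vecEmb φ w := by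
    intro e
    have h2 : intHerm H (crossProduct p e) w = 0 := by
      rw [intHerm_eq, ← hp, dotProduct_comm, dot_self_cross]
    refine hH.sig.isotropic_orthogonal ?_ ?_ ?_ ?_
    · intro h
      exact hw (vecEmb_injective φ (h.trans (by ext; simp [vecEmb])))
    all_goals
      rw [← emb_intHerm]
    · rw [hww]; simp
    · rw [hall _ h2]; simp
    · rw [h2]; simp
  obtain ⟨a, ha⟩ := h1 (Pi.single 0 1)
  obtain ⟨b, hb⟩ := h1 (Pi.single 1 1)
  obtain ⟨c, hc⟩ := h1 (Pi.single 2 1)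
  have hp0 : p ≠ 0 := mulVec_star_ne_zero hH hw
  apply hp0
  have h2 : ∀ i, φ (p i : E) ^ 2 = 0 := by
    have e0 := congrFun ha 0
    have e1 := congrFun ha 1
    have e2 := congrFun ha 2
    have f0 := congrFun hb 0
    have f1 := congrFun hb 1
    have f2 := congrFun hb 2
    have g0 := congrFun hc 0
    have g1 := congrFun hc 1
    simp [vecEmb, cross_apply, -mul_eq_zero, -zero_eq_mul] at e0 e1 e2 f0 f1 f2 g0 g1
    intro i
    fin_cases i
    · change φ (p 0 : E) ^ 2 = 0
      linear_combination φ (p 0 : E) * f2 - b * φ (w 2 : E) * g1 + c * φ (w 2 : E) * f1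
    · change φ (p 1 : E) ^ 2 = 0
      linear_combination φ (p 1 : E) * g0 - c * φ (w 0 : E) * e2 + c * φ (w 2 : E) * e0
    · change φ (p 2 : E) ^ 2 = 0
      linear_combination φ (p 2 : E) * e1 - a * φ (w 1 : E) * f0 + b * φ (w 1 : E) * e0
  ext i
  have := h2 i
  rw [pow_eq_zero_iff two_ne_zero, map_eq_zero] at this
  exact_mod_cast this

/-- The unipotent radical of the stabilizer of an isotropic vector is a Heisenberg group: for an
isotropic form, `SU(H, R_E)` contains two elements whose commutator has infinite order and commutes
with both. They are `exp(2 N)` for `N v = h(v, w) y - h(v, y) w`, where `w` is isotropic, and for the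
analogous `N'` with `t y` in place of `y`, where `t` is purely imaginary. -/
lemma exists_heisenberg (hH : IsAdmissible φ H) {w : Fin 3 → 𝓞 E} (hw : w ≠ 0)
    (hww : intHerm H w w = 0) :
    ∃ x y : SUInt φ H, Commute ⁅x, y⁆ x ∧ Commute ⁅x, y⁆ y ∧ ∀ k : ℕ, 0 < k → ⁅x, y⁆ ^ k ≠ 1 := by
  obtain ⟨y, hyw, hyy⟩ := exists_orthogonal_anisotropic hH hw hww
  obtain ⟨t, ht, hts⟩ := exists_star_eq_neg E
  set p := H *ᵥ star w with hp
  set q := H *ᵥ star y with hq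
  set P := Matrix.vecMulVec p y with hP
  set Q := Matrix.vecMulVec q w with hQ
  set R := Matrix.vecMulVec p w with hR
  set h := intHerm H y y with hh
  have hwp : w ⬝ᵥ p = 0 := by rw [hp, ← intHerm_eq, hww]
  have hyp : y ⬝ᵥ p = 0 := by rw [hp, ← intHerm_eq, hyw]
  have hwq : w ⬝ᵥ q = 0 := by rw [hq, ← intHerm_eq, ← star_intHerm hH, hyw, star_zero]
  have hyq : y ⬝ᵥ q = h := by rw [hq, ← intHerm_eq]
  have PP : P * P = 0 := by simp [hP, Matrix.vecMulVec_mul_vecMulVec, hyp]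
  have PQ : P * Q = h • R := by
    simp [hP, hQ, hR, Matrix.vecMulVec_mul_vecMulVec, hyq, Matrix.vecMulVec_smul]
  have QP : Q * P = 0 := by simp [hP, hQ, Matrix.vecMulVec_mul_vecMulVec, hwp]
  have QQ : Q * Q = 0 := by simp [hQ, Matrix.vecMulVec_mul_vecMulVec, hwq]
  have PR : P * R = 0 := by simp [hP, hR, Matrix.vecMulVec_mul_vecMulVec, hyp]
  have RP : R * P = 0 := by simp [hP, hR, Matrix.vecMulVec_mul_vecMulVec, hwp]
  have QR : Q * R = 0 := by simp [hQ, hR, Matrix.vecMulVec_mul_vecMulVec, hwp]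
  have RQ : R * Q = 0 := by simp [hQ, hR, Matrix.vecMulVec_mul_vecMulVec, hwq]
  have RR : R * R = 0 := by simp [hR, Matrix.vecMulVec_mul_vecMulVec, hwp]
  have hHH : Hᴴ = H := isHermitian_of_sig hH.sig
  have hvecH : ∀ v : Fin 3 → 𝓞 E, v ᵥ* H = star (H *ᵥ star v) := fun v => by
    rw [Matrix.star_mulVec, star_star, hHH]
  have hPH : P * H = Matrix.vecMulVec p (star q) := by
    rw [hP, Matrix.vecMulVec_mul, hvecH]
  have hQH : Q * H = Matrix.vecMulVec q (star p) := by
    rw [hQ, Matrix.vecMulVec_mul, hvecH]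
  have hHP : H * Pᴴ = Matrix.vecMulVec q (star p) := by
    rw [hP, Matrix.conjTranspose_vecMulVec, Matrix.mul_vecMulVec]
  have hHQ : H * Qᴴ = Matrix.vecMulVec p (star q) := by
    rw [hQ, Matrix.conjTranspose_vecMulVec, Matrix.mul_vecMulVec]
  set N := P - Q with hN
  set N' := t • (P + Q) with hN'
  have hNN : N ^ 2 = -(h • R) := by
    rw [pow_two, hN, sub_mul, mul_sub, mul_sub, PP, PQ, QP, QQ]
    simp
  have hNN' : N' ^ 2 = t ^ 2 • h • R := by
    rw [pow_two, hN', Matrix.smul_mul, Matrix.mul_smul, add_mul, mul_add, mul_add, PP, PQ, QP, QQ,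
      smul_smul, ← pow_two]
    simp
  have hRN : R * N = 0 := by rw [hN, mul_sub, RP, RQ, sub_zero]
  have hNR : N * R = 0 := by rw [hN, sub_mul, PR, QR, sub_zero]
  have hRN' : R * N' = 0 := by rw [hN', Matrix.mul_smul, mul_add, RP, RQ, add_zero, smul_zero]
  have hNR' : N' * R = 0 := by rw [hN', Matrix.smul_mul, add_mul, PR, QR, add_zero, smul_zero]
  have hN3 : N ^ 3 = 0 := by rw [pow_succ, hNN, Matrix.neg_mul, Matrix.smul_mul, hRN]; simp
  have hN3' : N' ^ 3 = 0 := by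
    rw [pow_succ, hNN', Matrix.smul_mul, Matrix.smul_mul, hRN']; simp
  have hskew : N * H = -(H * Nᴴ) := by
    rw [hN, sub_mul, hPH, hQH, Matrix.conjTranspose_sub, mul_sub, hHP, hHQ, neg_sub]
  have hskew' : N' * H = -(H * N'ᴴ) := by
    rw [hN', Matrix.smul_mul, add_mul, hPH, hQH, Matrix.conjTranspose_smul,
      Matrix.conjTranspose_add, hts, Matrix.mul_smul, mul_add, hHP, hHQ, neg_smul, neg_neg,
      add_comm]
  have hdet : ∀ M : Matrix (Fin 3) (Fin 3) (𝓞 E), M ^ 3 = 0 →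
      (1 + (2 : 𝓞 E) • M + (2 : 𝓞 E) • M ^ 2).det = 1 := by
    intro M hM
    rw [add_assoc]
    refine det_one_add_of_isNilpotent ⟨3, ?_⟩
    have h1 : (2 : 𝓞 E) • M + (2 : 𝓞 E) • M ^ 2 = M * ((2 : 𝓞 E) • 1 + (2 : 𝓞 E) • M) := by
      rw [mul_add, Matrix.mul_smul, Matrix.mul_smul, mul_one, ← pow_two]
    have h2 : Commute M ((2 : 𝓞 E) • 1 + (2 : 𝓞 E) • M) :=
      ((Commute.one_right M).smul_right _).add_right ((Commute.refl M).smul_right _)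
    rw [h1, h2.mul_pow, hM, zero_mul]
  let x := ofMat (φ := φ) _ (hdet N hN3) (mem_of_mat_mul_mul (unipotent_exp_preserves hN3 hskew))
  let x' := ofMat (φ := φ) _ (hdet N' hN3')
    (mem_of_mat_mul_mul (unipotent_exp_preserves hN3' hskew'))
  have hx : mat x = 1 + (2 : 𝓞 E) • N + (2 : 𝓞 E) • N ^ 2 := rfl
  have hx' : mat x' = 1 + (2 : 𝓞 E) • N' + (2 : 𝓞 E) • N' ^ 2 := rfl
  have hRx : R * mat x = R := by
    rw [hx, hNN]
    simp [mul_add, hRN, RR]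
  have hxR : mat x * R = R := by
    rw [hx, hNN]
    simp [add_mul, hNR, RR]
  have hRx' : R * mat x' = R := by
    rw [hx', hNN']
    simp [mul_add, hRN', RR]
  have hxR' : mat x' * R = R := by
    rw [hx', hNN']
    simp [add_mul, hNR', RR]
  have hRinv : ∀ g : SUInt φ H, R * mat g = R → R * mat g⁻¹ = R := by
    intro g hg
    conv_lhs => rw [← hg]
    rw [Matrix.mul_assoc, mat_mul_inv, Matrix.mul_one]
  set s := 8 * t * h with hs
  have hcomm : mat x * mat x' - mat x' * mat x = s • R := by
    have h1 : N * N' = (t * h) • R := by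
      rw [hN, hN', Matrix.mul_smul, sub_mul, mul_add, mul_add, PP, PQ, QP, QQ, mul_smul]
      simp
    have h2 : N' * N = -((t * h) • R) := by
      rw [hN, hN', Matrix.smul_mul, add_mul, mul_sub, mul_sub, PP, PQ, QP, QQ, mul_smul]
      simp
    rw [hx, hx', hNN, hNN']
    simp only [add_mul, mul_add, one_mul, mul_one, Matrix.smul_mul, Matrix.mul_smul, h1, h2, hRN',
      hNR, hRN, hNR', RR, smul_zero, Matrix.neg_mul, Matrix.mul_neg, hs]
    module
  have hz : mat ⁅x, x'⁆ = 1 + s • R := by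
    rw [mat_commutator_sub, hcomm, Matrix.smul_mul, ← Matrix.mul_assoc, hRinv x hRx,
      hRinv x' hRx']
  have hzpow : ∀ k : ℕ, mat (⁅x, x'⁆ ^ k) = 1 + ((k : 𝓞 E) * s) • R := by
    intro k
    induction k with
    | zero => simp [mat_one]
    | succ k ih =>
      rw [pow_succ, mat_mul, ih, hz]
      simp only [add_mul, mul_add, one_mul, mul_one, Matrix.smul_mul, Matrix.mul_smul, RR]
      push_cast
      module
  refine ⟨x, x', mat_injective ?_, mat_injective ?_, fun k hk hk1 => ?_⟩
  · rw [mat_mul, mat_mul, hz, add_mul, mul_add, Matrix.smul_mul, Matrix.mul_smul, hRx, hxR, one_mul,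
      mul_one]
  · rw [mat_mul, mat_mul, hz, add_mul, mul_add, Matrix.smul_mul, Matrix.mul_smul, hRx', hxR',
      one_mul, mul_one]
  · have h1 := hzpow k
    rw [hk1, mat_one, left_eq_add, smul_eq_zero] at h1
    rcases h1 with h1 | h1
    · have h8 : (8 : 𝓞 E) ≠ 0 := OfNat.ofNat_ne_zero 8
      have hk' : (k : 𝓞 E) ≠ 0 := by exact_mod_cast hk.ne'
      exact mul_ne_zero hk' (mul_ne_zero (mul_ne_zero h8 ht) hyy) h1
    · rw [hR, Matrix.vecMulVec_eq_zero] at h1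
      exact h1.elim (mulVec_star_ne_zero hH hw) hw

/-- For an isotropic form the principal congruence subgroups `Λ j` of level `3 ^ j` in `Γ` are
isomorphic to a fixed one only for finitely many `j`: in `Λ j` the central commutators have, up to a
fixed power, roots of order `3 ^ j`. In a fixed congruence subgroup a fixed element different from
one has such roots only for finitely many `j`. -/
theorem eventually_isEmpty_of_isotropic (hH : IsAdmissible φ H) {w : Fin 3 → 𝓞 E} (hw : w ≠ 0)
    (hww : intHerm H w w = 0) (Γ : Subgroup (SUInt φ H)) [Γ.FiniteIndex] {b : ℕ} (hb : 1 ≤ b) :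
    ∃ N, ∀ j ≥ N, IsEmpty ((Γ ⊓ congr φ H ((3 : 𝓞 E) ^ b) : Subgroup (SUInt φ H)) ≃*
      (Γ ⊓ congr φ H ((3 : 𝓞 E) ^ j) : Subgroup (SUInt φ H))) := by
  have h3 : ∀ j : ℕ, (3 : 𝓞 E) ^ j ≠ 0 := fun j => pow_ne_zero j (OfNat.ofNat_ne_zero 3)
  have := finiteIndex_congr (φ := φ) (H := H) (h3 b)
  set A : Subgroup (SUInt φ H) := Γ ⊓ congr φ H ((3 : 𝓞 E) ^ b) with hA
  obtain ⟨x, y, hzx, hzy, hz⟩ := exists_heisenberg hH hw hww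
  set D := Γ.normalCore.index with hD
  have hD0 : 0 < D := Nat.pos_of_ne_zero Subgroup.FiniteIndex.index_ne_zero
  have hDΓ : ∀ g : SUInt φ H, g ^ D ∈ Γ := fun g =>
    Γ.normalCore_le (Γ.normalCore.pow_index_mem g)
  set m := A.normalCore.index with hm
  have hm0 : 0 < m := Nat.pos_of_ne_zero Subgroup.FiniteIndex.index_ne_zero
  have hmA : ∀ g : SUInt φ H, g ^ m ∈ A := fun g =>
    A.normalCore_le (A.normalCore.pow_index_mem g)
  have hcomm : ⁅x ^ m, y ^ m⁆ = ⁅x, y⁆ ^ (m * m) :=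
    commutator_pow_of_commute hzx hzy m m
  set z := ⁅x ^ m, y ^ m⁆ with hz'
  have hz1 : z ^ (6 * D) ≠ 1 := by
    rw [hcomm, ← pow_mul]
    exact hz _ (by positivity)
  have hz2 : mat (z ^ (6 * D)) - 1 ≠ 0 := by
    rw [sub_ne_zero, ← mat_one (φ := φ) (H := H)]
    exact fun h => hz1 (mat_injective h)
  obtain ⟨a, ha⟩ := exists_exactThree hz2
  refine ⟨a + 1, fun j hj => ⟨fun f => ?_⟩⟩
  let X : A := ⟨x ^ m, hmA x⟩
  let Y : A := ⟨y ^ m, hmA y⟩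
  have hXY : ((⁅X, Y⁆ : A) : SUInt φ H) = z := rfl
  have hX : Commute ⁅X, Y⁆ X := Subtype.ext (by
    have := (hzx.pow_left (m * m)).pow_right m
    rw [← hcomm] at this
    exact this)
  have hY : Commute ⁅X, Y⁆ Y := Subtype.ext (by
    have := (hzy.pow_left (m * m)).pow_right m
    rw [← hcomm] at this
    exact this)
  have hX' := hX.map f
  have hY' := hY.map f
  rw [map_commutatorElement] at hX' hY'
  obtain ⟨u, hu, hu'⟩ := exists_root_of_central_commutator (f X).2.2 (f Y).2.2
    (hX'.map (Subgroup.subtype _)) (hY'.map (Subgroup.subtype _))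
  let v : (Γ ⊓ congr φ H ((3 : 𝓞 E) ^ j) : Subgroup (SUInt φ H)) :=
    ⟨u ^ D, hDΓ u, Subgroup.pow_mem _ hu D⟩
  have hv : v ^ 3 ^ j = f (⁅X, Y⁆ ^ (6 * D)) := by
    apply Subtype.ext
    rw [map_pow, map_commutatorElement]
    change (u ^ D) ^ 3 ^ j = (⁅((f X : _) : SUInt φ H), ((f Y : _) : SUInt φ H)⁆) ^ (6 * D)
    rw [← pow_mul, mul_comm, pow_mul, hu', pow_mul]
  have h4 : f.symm v ^ 3 ^ j = ⁅X, Y⁆ ^ (6 * D) := by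
    rw [← map_pow, hv, MulEquiv.symm_apply_apply]
  have h5 : ((f.symm v : A) : SUInt φ H) ^ 3 ^ j = z ^ (6 * D) := by
    have := congrArg (Subgroup.subtype A) h4
    rw [map_pow, map_pow] at this
    exact this
  have h6 := pow_three_pow_mem_congr hb (f.symm v).2.2 j
  rw [h5] at h6
  obtain ⟨B, hB⟩ := mem_congr_iff.mp h6
  have := ha.not_dvd (b := b + j) (C := B) (by rw [hB, add_sub_cancel_left])
  omega

end Isotropic

end CHyp

/-! ### The sequence of congruence subgroups -/

namespace CHyp

open scoped ComplexOrder
open NumberField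

section Sequence

variable {E : Type*} [Field E] [NumberField E] {φ : E →+* ℂ} {H : Matrix (Fin 3) (Fin 3) (𝓞 E)}

omit [NumberField E] in
lemma isCongruenceSubgroupOf_inf_congr (Γ : Subgroup (SUInt φ H)) {r : 𝓞 E} (hr : r ≠ 0) :
    IsCongruenceSubgroupOf (Γ ⊓ congr φ H r) Γ :=
  ⟨inf_le_left, Ideal.span {r}, by rwa [ne_eq, Ideal.span_singleton_eq_bot],
    fun _ hg h => ⟨hg, h⟩⟩

/-- For a regular elliptic `τ` the discriminant of the characteristic polynomial is a nonzero
algebraic integer, hence not divisible by high powers of `3`. Then the elements congruent to `τ`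
modulo such a power of `3` have distinct eigenvalues, too. -/
lemma exists_roots_nodup {τ : SUInt φ H} (hτ : IsRegularElliptic (SUInt.toSU φ H τ)) :
    ∃ a₀ : ℕ, ∀ a ≥ a₀, ∀ n ∈ congr φ H ((3 : 𝓞 E) ^ a),
      (conjugate φ (mat (n * τ))).charpoly.roots.Nodup := by
  let f := φ.comp (algebraMap (𝓞 E) E)
  have hdisc : ∀ g : SUInt φ H, (conjugate φ (mat g)).charpoly.roots.Nodup ↔
      (charCubic (mat g)).discr ≠ 0 := fun g => by
    rw [charpoly_roots_nodup_iff, conjugate_eq_mapMatrix, ← map_discr_charCubic, RingHom.comp_apply,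
      ne_eq, map_eq_zero]
    exact not_congr RingOfIntegers.coe_eq_zero_iff
  have h1 := (hdisc τ).mp ((ncard_eigenvalues_eq_three_iff _).mp hτ.2)
  obtain ⟨a₀, ha₀⟩ := exists_not_three_pow_dvd h1
  refine ⟨a₀, fun a ha n hn => (hdisc _).mpr fun h0 => ha₀ ((pow_dvd_pow 3 ha).trans ?_)⟩
  let π := Ideal.Quotient.mk (Ideal.span {(3 : 𝓞 E) ^ a})
  have h2 : π.mapMatrix (mat (n * τ)) = π.mapMatrix (mat τ) := by
    have h3 : π.mapMatrix (mat n) = 1 := congrArg Subtype.val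
      (show Matrix.SpecialLinearGroup.map π n.1 = 1 from hn)
    rw [mat_mul, map_mul, h3, one_mul]
  rw [← Ideal.mem_span_singleton, ← Ideal.Quotient.eq_zero_iff_mem, map_discr_charCubic, ← h2,
    ← map_discr_charCubic, h0, map_zero]

/-- The principal congruence subgroups of level `3 ^ j` in `Γ` are isomorphic to a fixed one only
for finitely many `j`. -/
theorem eventually_isEmpty [IsCMField E] (hH : IsAdmissible φ H) (Γ : Subgroup (SUInt φ H))
    [Γ.FiniteIndex] {b : ℕ} (hb : 1 ≤ b) :
    ∃ N, ∀ j ≥ N, IsEmpty ((Γ ⊓ congr φ H ((3 : 𝓞 E) ^ b) : Subgroup (SUInt φ H)) ≃*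
      (Γ ⊓ congr φ H ((3 : 𝓞 E) ^ j) : Subgroup (SUInt φ H))) := by
  by_cases han : IsAnisotropic H
  · exact eventually_isEmpty_of_isAnisotropic hH han Γ hb
  · unfold IsAnisotropic at han
    push Not at han
    obtain ⟨w, hw, hww⟩ := han
    exact eventually_isEmpty_of_isotropic hH hw hww Γ hb

end Sequence

end CHyp

theorem lemma3p2 {k E : Type*} [Field k] [NumberField k] [Field E] [NumberField E] [Algebra k E]
    [NumberField.IsTotallyReal k] [NumberField.IsTotallyComplex E]
    [Algebra.IsQuadraticExtension k E]
    (φ : E →+* ℂ) (H : Matrix (Fin 3) (Fin 3) (NumberField.RingOfIntegers E))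
    (hsig : CHyp.HasSignatureTwoOne (CHyp.conjugate φ H))
    (hdef : ∀ ν : E →+* ℂ, ν.comp (algebraMap k E) ≠ φ.comp (algebraMap k E) →
      CHyp.HasSignatureThreeZero (CHyp.conjugate ν H))
    (Γ : Subgroup (CHyp.SUInt φ H)) [Γ.FiniteIndex]
    (p : ℕ) (hp : p.Prime)
    (τ : CHyp.SUInt φ H) (hτΓ : τ ∈ Γ)
    (hτ : CHyp.IsRegularElliptic (CHyp.SUInt.toSU φ H τ)) (hτp : orderOf τ = p) :
    ∃ Λ : ℕ → Subgroup (CHyp.SUInt φ H),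
      (∀ i, CHyp.IsCongruenceSubgroupOf (Λ i) Γ ∧ (Λ i).IsFiniteRelIndex Γ ∧
        CHyp.AdmitsAction p (Λ i)) ∧
      ∀ i j, i ≠ j → IsEmpty (Λ i ≃* Λ j) := by
  have : NumberField.IsCMField E := NumberField.IsCMField.ofCMExtension k E
  have hH : CHyp.IsAdmissible φ H := CHyp.isAdmissible_of_forall hsig hdef
  have h3 : ∀ j : ℕ, (3 : NumberField.RingOfIntegers E) ^ j ≠ 0 := fun j =>
    pow_ne_zero j (OfNat.ofNat_ne_zero 3)
  let Λ : ℕ → Subgroup (CHyp.SUInt φ H) := fun j => Γ ⊓ CHyp.congr φ H (3 ^ j)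
  have hfi : ∀ j, (CHyp.congr φ H (3 ^ j)).FiniteIndex := fun j => CHyp.finiteIndex_congr (h3 j)
  obtain ⟨a₀, ha₀⟩ := CHyp.exists_roots_nodup hτ
  have hempty : ∀ b, ∃ N, 1 ≤ b → ∀ j ≥ N, IsEmpty (Λ b ≃* Λ j) := fun b => by
    by_cases hb : 1 ≤ b
    · obtain ⟨N, hN⟩ := CHyp.eventually_isEmpty hH Γ hb
      exact ⟨N, fun _ => hN⟩
    · exact ⟨0, fun h => absurd h hb⟩
  choose N hN using hempty
  -- each level is beyond the bounds attached to all the previous ones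
  let a : ℕ → ℕ := fun i => Nat.rec (a₀ + 1) (fun _ m => max m (N m)) i
  have ha_succ : ∀ i, a (i + 1) = max (a i) (N (a i)) := fun i => rfl
  have ha_mono : Monotone a := monotone_nat_of_le_succ fun i => by
    rw [ha_succ]; exact le_max_left _ _
  have ha_ge : ∀ i, a₀ + 1 ≤ a i := fun i => ha_mono (Nat.zero_le i)
  have hlt : ∀ i j, i < j → IsEmpty (Λ (a i) ≃* Λ (a j)) := fun i j hij => by
    refine hN (a i) ((Nat.le_add_left 1 a₀).trans (ha_ge i)) _ ?_
    exact (le_max_right (a i) _).trans ((ha_succ i).symm.le.trans (ha_mono hij))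
  refine ⟨fun i => Λ (a i), fun i => ⟨?_, Subgroup.isFiniteRelIndex_of_finiteIndex (h := ?_), ?_⟩, fun i j hij => ?_⟩
  · exact CHyp.isCongruenceSubgroupOf_inf_congr Γ (h3 _)
  · exact inferInstanceAs (Γ ⊓ CHyp.congr φ H (3 ^ a i)).FiniteIndex
  · refine CHyp.admitsAction_of_normalizes hH hp ?_ (by rw [← hτp, pow_orderOf_eq_one]) hτ.1
      fun n hn => ha₀ _ ((Nat.le_succ a₀).trans (ha_ge i)) n hn.2
    rw [Subgroup.mem_normalizer_iff]
    intro g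
    have h1 : τ * g * τ⁻¹ ∈ Γ ↔ g ∈ Γ := by
      rw [Subgroup.mul_mem_cancel_right _ (Γ.inv_mem hτΓ), Subgroup.mul_mem_cancel_left _ hτΓ]
    have h2 := (inferInstance : (CHyp.congr φ H (3 ^ a i)).Normal).mem_comm_iff
      (a := τ * g) (b := τ⁻¹)
    rw [inv_mul_cancel_left] at h2
    simp only [Λ, Subgroup.mem_inf, h1, h2]
  · rcases lt_or_gt_of_ne hij with h | h
    · exact hlt i j h
    · exact ⟨fun f => (hlt j i h).false f.symm⟩
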